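/- **Setting.** For $d,m,n\ge 1$ consider the shallow network with $N$ hidden units $$f(z;\theta)=\frac1{\sqrt N}\sum_{\ell=1}^N a_\ell\,\sigma(\langle w_\ell,z\rangle+b_\ell)+b_0,\qquad \theta=(a,W,b,b_0),\quad z\in\mathbb R^d,$$ where $w_\ell$ is the $\ell$-th row of $W$ and $\sigma\in C^2(\mathbb R)$ with $\|\sigma'\|_\infty,\|\sigma''\|_\infty<\infty$. Let $M>0$, $B_M=\{z:\|z\|_2\le M\}$ and $D=3\max\{|\sigma(0)|,M\|\sigma'\|_\infty,\|\sigma'\|_\infty,1\}$. The training inputs $x_1,\dots,x_n\in B_M$ and labels $y\in\mathbb R^n$ are fixed. Put $\|v\|_{\mathbb R^n}=(\frac1n\sum_i v_i^2)^{1/2}$ and $\hat r(\theta)_i=f(x_i;\theta)-y_i$. The parameters follow gradient flow $\partial_t\theta_t=-\nabla_\theta\Phi(\theta_t)$ of $\Phi(\theta)=\frac1{2n}\sum_i\hat r(\theta)_i^2$; write $\hat r_0=\hat r(\theta_0)$. Let $K_t(z,z')=\langle\nabla_\theta f(z;\theta_t),\nabla_\theta f(z';\theta_t)\rangle$, $K^\infty(z,z')=\mathbb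 E_{\theta_0}[K_0(z,z')]$, $(H_t)_{ij}=K_t(x_i,x_j)$, $H^\infty_{ij}=K^\infty(x_i,x_j)$, $G_t=\frac1nH_t$, $G^\infty=\frac1nH^\infty$. *Standard initialization:* $N=m$ and all entries of $\theta_0$ are independent, those of $a$, $W$, $b$ and $b_0$ having laws $\mathcal A,\mathcal W,\mathcal B,\mathcal B'$, each with mean zero, variance one and subgaussian norm $\|Y\|_{\psi_2}=\inf\{s>0:\mathbb E\,e^{Y^2/s^2}\le2\}$ at most $K$, where $K\ge1$. *Doubling trick:* draw $(a,W,b)$ in this way for $m$ units and start from the network with $N=2m$ units having outer weights $(a,-a)$, inner weights $\binom WW$, inner biases $\binom bb$ and $b_0=0$. **Theorem.** There are an absolute exponent $p\in\mathbb N$ and, for all $\sigma,M,K$ as above, a constant $C>0$ depending only on $\sigma,M,K$, such that the following holds for all such laws, all $d,m,n\ge1$, all training data as above, and all $\delta\in(0,1)$, $T>0$, $\Gamma>1$. Put $\Lambda=C\big(\log(1/\delta)+d(1+\log m)^p\big)$ (that is, $O(\log(1/\delta)+\tilde O(d))$) and $$\varepsilon_t=C\,\frac{\sqrt d}{\sqrt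 m}\big[1+t\,\Gamma^3\|\hat r_0\|_{\mathbb R^n}\big]\,(1+\log(m/\delta))^p$$ (that is, $\tilde O\big(\frac{\sqrt d}{\sqrt m}[1+t\Gamma^3\|\hat r_0\|_{\mathbb R^n}]\big)$). Assume $$m\ge\frac{4D^2\|y\|_{\mathbb R^n}^2T^2}{(\log\Gamma)^2},\qquad m\ge\Lambda,\qquad m\ge\frac{4D^2\Lambda T^2}{(\log\Gamma)^2}.$$ Then, for the standard initialization, with probability at least $1-\delta$ we have for all $t\in[0,T]$ $$\sup_{z,z'\in B_M}|K_t(z,z')-K^\infty(z,z')|\le\varepsilon_t,\qquad \|H^\infty-H_t\|_{op}\le n\,\varepsilon_t,\qquad \|G^\infty-G_t\|_{op}\le\varepsilon_t.$$ For the doubling trick the same conclusion holds without the third assumption on $m$. -/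

import Mathlib

open MeasureTheory ProbabilityTheory Set
open scoped ENNReal NNReal Gradient

noncomputable section

namespace ShallowNTK

/-- Index set of the parameters `(a, W, b, b₀)` of a shallow network with hidden units `ι` and
input dimension `d`. For `m` hidden units it has `m + m d + m + 1` elements. -/
abbrev ParamIdx (ι : Type) (d : ℕ) : Type := ι ⊕ (ι × Fin d) ⊕ ι ⊕ Unit

/-- The parameter space `ℝ^p` with its Euclidean structure. -/
abbrev Param (ι : Type) (d : ℕ) : Type := EuclideanSpace ℝ (ParamIdx ι d)

/-- The input space `ℝ^d` with its Euclidean structure. -/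
abbrev Input (d : ℕ) : Type := EuclideanSpace ℝ (Fin d)

section Network

variable {ι : Type} {d n : ℕ}

/-- Outer weights. -/
def Param.a (θ : Param ι d) (l : ι) : ℝ := θ (Sum.inl l)

/-- Inner weights. -/
def Param.W (θ : Param ι d) (l : ι) (j : Fin d) : ℝ := θ (Sum.inr (Sum.inl (l, j)))

/-- Inner biases. -/
def Param.b (θ : Param ι d) (l : ι) : ℝ := θ (Sum.inr (Sum.inr (Sum.inl l)))

/-- Outer bias. -/
def Param.b₀ (θ : Param ι d) : ℝ := θ (Sum.inr (Sum.inr (Sum.inr ())))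

variable [Fintype ι]

/-- The network `f(z; θ) = N^{-1/2} ∑ₗ aₗ σ(⟨wₗ, z⟩ + bₗ) + b₀`, where `N` is the number of
hidden units. -/
def net (σ : ℝ → ℝ) (θ : Param ι d) (z : Input d) : ℝ :=
  (1 / √(Fintype.card ι : ℝ)) * ∑ l, Param.a θ l * σ (∑ j, Param.W θ l j * z j + Param.b θ l)
    + Param.b₀ θ

/-- The neural tangent kernel at `θ`: the inner product of the gradients of the network output
with respect to all parameters. -/
def ntk (σ : ℝ → ℝ) (θ : Param ι d) (z z' : Input d) : ℝ :=
  inner ℝ (∇ (fun θ' : Param ι d => net σ θ' z) θ) (∇ (fun θ' : Param ι d => net σ θ' z') θ)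

/-- The residual vector on the training set. -/
def residual (σ : ℝ → ℝ) (x : Fin n → Input d) (y : Fin n → ℝ) (θ : Param ι d) : Fin n → ℝ :=
  fun i => net σ θ (x i) - y i

/-- The squared loss `Φ(θ) = (1 / 2n) ∑ᵢ (f(xᵢ; θ) - yᵢ)²`. -/
def loss (σ : ℝ → ℝ) (x : Fin n → Input d) (y : Fin n → ℝ) (θ : Param ι d) : ℝ :=
  1 / (2 * (n : ℝ)) * ∑ i, residual σ x y θ i ^ 2

/-- `γ` solves the gradient flow equation `γ' = -∇Φ(γ)` on `[0, T]` (one-sided derivatives at the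
end points). -/
def IsGradientFlow (Φ : Param ι d → ℝ) (T : ℝ) (γ : ℝ → Param ι d) : Prop :=
  ∀ t ∈ Icc 0 T, HasDerivWithinAt γ (-∇ Φ (γ t)) (Icc 0 T) t

end Network

/-- The normalized Euclidean norm `(n⁻¹ ∑ᵢ vᵢ²)^{1/2}` on `ℝⁿ`. -/
def normalizedNorm {n : ℕ} (v : Fin n → ℝ) : ℝ := √(1 / (n : ℝ) * ∑ i, v i ^ 2)

/-- The Gram matrix of a kernel on the training inputs. -/
def gram {d n : ℕ} (k : Input d → Input d → ℝ) (x : Fin n → Input d) :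
    Matrix (Fin n) (Fin n) ℝ :=
  Matrix.of fun i j => k (x i) (x j)

/-- The operator norm of a matrix induced by the Euclidean norm. -/
def opNorm {n : ℕ} (A : Matrix (Fin n) (Fin n) ℝ) : ℝ :=
  ‖Matrix.toEuclideanCLM (n := Fin n) (𝕜 := ℝ) A‖

/-- The supremum norm of a (bounded) function on the real line. -/
def supNorm (g : ℝ → ℝ) : ℝ := ⨆ u, |g u|

/-- `σ` is `C²` with bounded first and second derivatives. -/
structure IsAdmissibleActivation (σ : ℝ → ℝ) : Prop where
  contDiff : ContDiff ℝ 2 σ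
  bdd_deriv : BddAbove (range fun u => |deriv σ u|)
  bdd_deriv2 : BddAbove (range fun u => |deriv (deriv σ) u|)

/-- `D = 3 max {|σ(0)|, M ‖σ'‖_∞, ‖σ'‖_∞, 1}`. -/
def constD (σ : ℝ → ℝ) (M : ℝ) : ℝ :=
  3 * max (max |σ 0| (M * supNorm (deriv σ))) (max (supNorm (deriv σ)) 1)

/-- The subgaussian norm `inf {s > 0 : E exp(Y² / s²) ≤ 2}` of a random variable `Y` of law `μ`;
it is `∞` when there is no such `s`. -/
def psi2Norm (μ : Measure ℝ) : ℝ≥0∞ :=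
  ⨅ (s : ℝ≥0) (_ : 0 < s) (_ : ∫⁻ u, ENNReal.ofReal (Real.exp (u ^ 2 / (s : ℝ) ^ 2)) ∂μ ≤ 2),
    (s : ℝ≥0∞)

/-- `μ` is a probability law on the line with mean zero, variance one and subgaussian norm at
most `K`. -/
structure IsInitLaw (K : ℝ) (μ : Measure ℝ) : Prop where
  isProb : IsProbabilityMeasure μ
  mean_zero : ∫ u, u ∂μ = 0
  variance_one : variance id μ = 1
  subgaussian : psi2Norm μ ≤ ENNReal.ofReal K

/-- The joint law of the random numbers used for the initialization: all entries are independent,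
the entries of `a`, `W`, `b` and `b₀` having laws `μa`, `μw`, `μb` and `μb₀`. -/
def initLaw (μa μw μb μb₀ : Measure ℝ) (m d : ℕ) : Measure (ParamIdx (Fin m) d → ℝ) :=
  Measure.pi
    (Sum.elim (fun _ => μa) (Sum.elim (fun _ => μw) (Sum.elim (fun _ => μb) (fun _ => μb₀))))

/-- Standard initialization: the parameters are the random numbers themselves. -/
def standardInit {m d : ℕ} (ω : ParamIdx (Fin m) d → ℝ) : Param (Fin m) d :=
  WithLp.toLp 2 ω

/-- Initialization by the doubling trick: `2m` hidden units, with `W` and `b` repeated,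
`a` replaced by `(a, -a)`, and `b₀ = 0`. -/
def doubledInit {m d : ℕ} (ω : ParamIdx (Fin m) d → ℝ) : Param (Fin m ⊕ Fin m) d :=
  WithLp.toLp 2 fun i =>
    match i with
    | Sum.inl (Sum.inl l) => Param.a (standardInit ω) l
    | Sum.inl (Sum.inr l) => -Param.a (standardInit ω) l
    | Sum.inr (Sum.inl (Sum.inl l, j)) => Param.W (standardInit ω) l j
    | Sum.inr (Sum.inl (Sum.inr l, j)) => Param.W (standardInit ω) l j
    | Sum.inr (Sum.inr (Sum.inl (Sum.inl l))) => Param.b (standardInit ω) l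
    | Sum.inr (Sum.inr (Sum.inl (Sum.inr l))) => Param.b (standardInit ω) l
    | Sum.inr (Sum.inr (Sum.inr _)) => 0

/-- The analytical kernel `K^∞(z, z') = E K_{θ₀}(z, z')`, the expectation being over the random
initial parameter `θ₀`. -/
def ntkInf {Ω ι : Type} [MeasurableSpace Ω] [Fintype ι] {d : ℕ} (σ : ℝ → ℝ) (P : Measure Ω)
    (θ₀ : Ω → Param ι d) (z z' : Input d) : ℝ :=
  ∫ ω, ntk σ (θ₀ ω) z z' ∂P

/-- For every gradient flow of the loss on `[0, T]` started at `θ₀` and every `t ∈ [0, T]`: the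
kernel `K_t` is within `B t` of `kinf` uniformly on pairs of points of the ball of radius `M`,
the Gram matrices `H_t` and `H^∞` satisfy `‖H^∞ - H_t‖ ≤ n B t`, and the normalized Gram matrices
`G_t = H_t / n` and `G^∞ = H^∞ / n` satisfy `‖G^∞ - G_t‖ ≤ B t`, in operator norm. -/
def DeviationBound {ι : Type} [Fintype ι] {d n : ℕ} (σ : ℝ → ℝ) (M : ℝ)
    (x : Fin n → Input d) (y : Fin n → ℝ) (T : ℝ) (kinf : Input d → Input d → ℝ)
    (θ₀ : Param ι d) (B : ℝ → ℝ) : Prop :=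
  ∀ γ : ℝ → Param ι d, IsGradientFlow (loss σ x y) T γ → γ 0 = θ₀ → ∀ t ∈ Icc 0 T,
    (∀ z z' : Input d, ‖z‖ ≤ M → ‖z'‖ ≤ M → |ntk σ (γ t) z z' - kinf z z'| ≤ B t) ∧
    opNorm (gram kinf x - gram (ntk σ (γ t)) x) ≤ n * B t ∧
    opNorm ((1 / (n : ℝ)) • gram kinf x - (1 / (n : ℝ)) • gram (ntk σ (γ t)) x) ≤ B t

/-- The width requirement `log(1/δ) + d (1 + log m)^p`, that is, `log(1/δ) + Õ(d)`. -/
def widthTerm (p d m : ℕ) (δ : ℝ) : ℝ :=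
  Real.log (1 / δ) + d * (1 + Real.log m) ^ p

/-- The bound `C (√d / √m) (1 + t Γ³ r) (1 + log(m/δ))^p`, that is,
`Õ((√d / √m) (1 + t Γ³ r))`. -/
def deviationRate (C : ℝ) (p d m : ℕ) (δ Γ r t : ℝ) : ℝ :=
  C * (√(d : ℝ) / √(m : ℝ) * (1 + t * Γ ^ 3 * r)) * (1 + Real.log (m / δ)) ^ p

end ShallowNTK

end

/-!
The kernel is an explicit average over the hidden units (`ntk_eq`), each unit contributing
`σ(u) σ(u') + a² σ'(u) σ'(u') (1 + ⟨z, z'⟩)` with `u`, `u'` its preactivations at `z`, `z'`. The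
deviation from the mean kernel splits into the deviation at initialization and the drift along the
flow.

*Drift.* The loss is nonincreasing along the flow, so the residual stays below its initial norm `r`
(`IsGradientFlow.normalizedNorm_residual_le`). The parameters `(a_l, w_l, b_l)` of a single unit
therefore move with speed at most a multiple of `r / √N` times the size of that unit on the data,
plus a multiple of `r / √N` times its displacement, and Grönwall's inequality for the displacement
(`IsGradientFlow.norm_unitCLM_sub_le`) shows that each unit moves by at most a multiple of
`t Γ r / √m`, up to logarithms. The size of a unit on the data is measured by its outer weight and
the root mean square of its preactivations at the training inputs, both of which are independent of
the dimension. At arbitrary points of the ball the preactivations are of order `√d` up to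
logarithms, and this is where the factor `√d` in the drift comes from. These bounds combine into the
deterministic statement `deviationBound_of_init`.

*Initialization.* The terms of the average are independent for different units and at most quadratic
in subgaussian variables, so they have exponential moments
(`lintegral_exp_abs_le_of_quadratic`) and Bernstein's inequality
(`measureReal_abs_sum_sub_integral_ge_le`) applies at each pair of points. A union bound over a
cover of the ball of mesh `m⁻⁵`, whose cardinality has logarithm of order `d (1 + log m)`, and a
Lipschitz bound between the points of the cover make it uniform (`measure_exists_deviation_le`). The
outputs of the units are treated in the same way; having mean zero, they show that the squared
output of the network at initialization is at most of order `log(1/δ) + d (1 + log m)³`. Together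
with union bounds for the sizes of the units, this gives `measure_not_goodInit_le`.

The doubled network has the same kernel as the standard one (`ntk_doubledInit`), units of the same
size, and vanishing output (`net_doubledInit`). So the same good event serves both cases, and in the
second the initial residual is `-y`, which makes the third assumption on the width superfluous.
-/

namespace ShallowNTK

/-! ### Subgaussian laws -/

/-- The infimum defining the subgaussian norm need not be attained, so the exponential moment is
stated at the scale `2 K` instead of `K`. -/
theorem IsInitLaw.lintegral_exp_sq_le {K : ℝ} {μ : Measure ℝ} (h : IsInitLaw K μ) (hK : 1 ≤ K) :
    ∫⁻ u, ENNReal.ofReal (Real.exp (u ^ 2 / (2 * K) ^ 2)) ∂μ ≤ 2 := by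
  have hlt : psi2Norm μ < ENNReal.ofReal (2 * K) :=
    h.subgaussian.trans_lt ((ENNReal.ofReal_lt_ofReal_iff (by linarith)).2 (by linarith))
  simp only [psi2Norm, iInf_lt_iff] at hlt
  obtain ⟨s, hs, hs2, hsK⟩ := hlt
  refine le_trans (lintegral_mono fun u => ENNReal.ofReal_le_ofReal (Real.exp_le_exp.2 ?_)) hs2
  have hs' : (s : ℝ) ≤ 2 * K := by
    have h2 : ENNReal.ofReal (s : ℝ) < ENNReal.ofReal (2 * K) := by simpa using hsK
    exact (((ENNReal.ofReal_lt_ofReal_iff (by linarith)).1 h2)).le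
  have hs0 : (0 : ℝ) < s := by exact_mod_cast hs
  gcongr

/-- The comparison that turns a mean-zero exponential moment of a square into a bound on the
moment generating function. -/
theorem exp_le_add_exp_sq (x : ℝ) : Real.exp x ≤ x + Real.exp (x ^ 2) := by
  have h2 := Real.add_one_le_exp (x ^ 2)
  rcases le_or_gt |x| 1 with h | h
  · have h1 := (abs_le.1 (Real.abs_exp_sub_one_sub_id_le h)).2
    linarith
  · rcases lt_abs.1 h with h | h
    · have : Real.exp x ≤ Real.exp (x ^ 2) := Real.exp_le_exp.2 (by nlinarith)
      linarith
    · have : Real.exp x ≤ 1 := Real.exp_le_one_iff.2 (by linarith)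
      nlinarith

theorem exp_mul_le_of_le_one {θ y : ℝ} (h0 : 0 ≤ θ) (h1 : θ ≤ 1) :
    Real.exp (θ * y) ≤ 1 - θ + θ * Real.exp y := by
  have := convexOn_exp.2 (mem_univ y) (mem_univ 0) h0 (sub_nonneg.2 h1) (by ring)
  simp only [smul_eq_mul, mul_zero, add_zero, Real.exp_zero, mul_one] at this
  linarith

/-- A centred law with `E exp(u² / κ²) ≤ 2` has a Gaussian moment generating function. -/
theorem hasSubgaussianMGF_id_of_lintegral_exp_sq_le {μ : Measure ℝ} [IsProbabilityMeasure μ]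
    {κ : ℝ≥0} (hκ : 0 < κ) (hmean : ∫ u, u ∂μ = 0)
    (h : ∫⁻ u, ENNReal.ofReal (Real.exp (u ^ 2 / (κ : ℝ) ^ 2)) ∂μ ≤ 2) :
    HasSubgaussianMGF id (2 * κ ^ 2) μ := by
  have hκ0 : (0 : ℝ) < κ := by exact_mod_cast hκ
  have hΨ : Integrable (fun u : ℝ => Real.exp (u ^ 2 / (κ : ℝ) ^ 2)) μ := by
    refine ⟨by fun_prop, ?_⟩
    rw [hasFiniteIntegral_iff_ofReal (ae_of_all _ fun u => (Real.exp_pos _).le)]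
    exact h.trans_lt (by simp)
  have hΨ2 : ∫ u, Real.exp (u ^ 2 / (κ : ℝ) ^ 2) ∂μ ≤ 2 := by
    rw [integral_eq_lintegral_of_nonneg_ae (ae_of_all _ fun u => (Real.exp_pos _).le) (by fun_prop)]
    exact ENNReal.toReal_le_of_le_ofReal (by norm_num) (by simpa using h)
  have hyoung : ∀ t u : ℝ, t * u ≤ t ^ 2 * κ ^ 2 / 2 + (u ^ 2 / (κ : ℝ) ^ 2) / 2 := by
    intro t u
    have h1 : t * u = (t * κ) * (u / κ) := by field_simp
    have h2 : u ^ 2 / (κ : ℝ) ^ 2 = (u / κ) ^ 2 := by rw [div_pow]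
    rw [h1, h2]
    nlinarith [sq_nonneg (t * κ - u / κ)]
  have hhalf : ∀ u : ℝ, Real.exp ((u ^ 2 / (κ : ℝ) ^ 2) / 2) ≤
      (1 + Real.exp (u ^ 2 / (κ : ℝ) ^ 2)) / 2 := by
    intro u
    have := exp_mul_le_of_le_one (θ := 1 / 2) (y := u ^ 2 / (κ : ℝ) ^ 2) (by norm_num) (by norm_num)
    rw [show u ^ 2 / (κ : ℝ) ^ 2 / 2 = 1 / 2 * (u ^ 2 / (κ : ℝ) ^ 2) by ring]
    linarith
  -- Young's inequality bounds `exp (t u)` without using the mean; good enough for large `t`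
  have hbd : ∀ t u : ℝ, Real.exp (t * u) ≤
      Real.exp (t ^ 2 * κ ^ 2 / 2) * ((1 + Real.exp (u ^ 2 / (κ : ℝ) ^ 2)) / 2) := by
    intro t u
    calc Real.exp (t * u) ≤ Real.exp (t ^ 2 * κ ^ 2 / 2 + (u ^ 2 / (κ : ℝ) ^ 2) / 2) :=
          Real.exp_le_exp.2 (hyoung t u)
      _ = Real.exp (t ^ 2 * κ ^ 2 / 2) * Real.exp ((u ^ 2 / (κ : ℝ) ^ 2) / 2) := Real.exp_add _ _
      _ ≤ _ := by gcongr; exact hhalf u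
  have hbdint : ∀ t : ℝ, Integrable (fun u : ℝ => Real.exp (t ^ 2 * κ ^ 2 / 2) *
      ((1 + Real.exp (u ^ 2 / (κ : ℝ) ^ 2)) / 2)) μ := fun t =>
    (((integrable_const 1).add hΨ).div_const 2).const_mul _
  have hint : ∀ t : ℝ, Integrable (fun u : ℝ => Real.exp (t * u)) μ := fun t =>
    (hbdint t).mono' (by fun_prop) (ae_of_all _ fun u => by
      rw [Real.norm_eq_abs, abs_of_pos (Real.exp_pos _)]; exact hbd t u)
  have hid : Integrable (fun u : ℝ => u) μ := by
    refine ((hint 1).add (hint (-1))).mono' (by fun_prop) (ae_of_all _ fun u => ?_)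
    simp only [Pi.add_apply, one_mul, Real.norm_eq_abs]
    have := Real.add_one_le_exp u
    have := Real.add_one_le_exp (-1 * u)
    have := Real.exp_pos u
    have := Real.exp_pos (-1 * u)
    rw [abs_le]; constructor <;> linarith
  refine ⟨hint, fun t => ?_⟩
  have hgoal : ((2 * κ ^ 2 : ℝ≥0) : ℝ) * t ^ 2 / 2 = t ^ 2 * κ ^ 2 := by push_cast; ring
  rw [hgoal]
  simp only [mgf, id]
  set θ := t ^ 2 * (κ : ℝ) ^ 2 with hθ
  have hθ0 : 0 ≤ θ := by positivity
  have hθΨ : Integrable (fun u : ℝ => (1 - θ) + θ * Real.exp (u ^ 2 / (κ : ℝ) ^ 2)) μ :=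
    (integrable_const _).add (hΨ.const_mul θ)
  -- for `θ ≤ 1` the mean-zero comparison applies and `exp (θ y)` is convex in `θ`
  rcases le_or_gt θ 1 with h1 | h1
  · calc ∫ u, Real.exp (t * u) ∂μ
        ≤ ∫ u, (t * u + ((1 - θ) + θ * Real.exp (u ^ 2 / (κ : ℝ) ^ 2))) ∂μ := by
          refine integral_mono (hint t) ((hid.const_mul t).add hθΨ) fun u => ?_
          have e1 := exp_le_add_exp_sq (t * u)
          have e2 := exp_mul_le_of_le_one (y := u ^ 2 / (κ : ℝ) ^ 2) hθ0 h1
          have e3 : θ * (u ^ 2 / (κ : ℝ) ^ 2) = (t * u) ^ 2 := by rw [hθ]; field_simp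
          rw [e3] at e2
          linarith
      _ = (1 - θ) + θ * ∫ u, Real.exp (u ^ 2 / (κ : ℝ) ^ 2) ∂μ := by
          rw [integral_add (hid.const_mul t) hθΨ,
            integral_add (integrable_const _) (hΨ.const_mul θ), integral_const_mul,
            integral_const_mul, hmean]
          simp
      _ ≤ θ + 1 := by nlinarith
      _ ≤ Real.exp θ := Real.add_one_le_exp θ
  · calc ∫ u, Real.exp (t * u) ∂μ
        ≤ ∫ u, Real.exp (θ / 2) * ((1 + Real.exp (u ^ 2 / (κ : ℝ) ^ 2)) / 2) ∂μ :=
          integral_mono (hint t) (hbdint t) fun u => hbd t u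
      _ = Real.exp (θ / 2) * ((1 + ∫ u, Real.exp (u ^ 2 / (κ : ℝ) ^ 2) ∂μ) / 2) := by
          rw [integral_const_mul, integral_div, integral_add (integrable_const _) hΨ]
          simp
      _ ≤ Real.exp (θ / 2) * Real.exp (θ / 2) := by
          gcongr
          have := Real.add_one_le_exp (θ / 2)
          linarith
      _ = Real.exp θ := by rw [← Real.exp_add]; ring_nf

theorem lintegral_exp_sq_div_four_gaussianReal :
    ∫⁻ g, ENNReal.ofReal (Real.exp (g ^ 2 / 4)) ∂(gaussianReal 0 1) ≤ 2 := by
  rw [gaussianReal_of_var_ne_zero _ one_ne_zero,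
    lintegral_withDensity_eq_lintegral_mul _ (measurable_gaussianPDF 0 1) (by fun_prop)]
  have h1 : ∀ g : ℝ, (gaussianPDF 0 1 * fun g => ENNReal.ofReal (Real.exp (g ^ 2 / 4))) g =
      ENNReal.ofReal ((√(2 * Real.pi))⁻¹ * Real.exp (-(1 / 4) * g ^ 2)) := by
    intro g
    rw [Pi.mul_apply, gaussianPDF, ← ENNReal.ofReal_mul (gaussianPDFReal_nonneg _ _ _),
      gaussianPDFReal, mul_assoc, ← Real.exp_add]
    congr 3
    · simp
    · simp; ring
  simp_rw [h1]
  rw [← ofReal_integral_eq_lintegral_ofReal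
    ((integrable_exp_neg_mul_sq (by norm_num)).const_mul _) (ae_of_all _ fun g => by positivity),
    integral_const_mul, integral_gaussian]
  have hpi := Real.pi_pos
  have : (√(2 * Real.pi))⁻¹ * √(Real.pi / (1 / 4)) ≤ 2 := by
    rw [inv_mul_le_iff₀ (by positivity)]
    refine Real.sqrt_le_iff.2 ⟨by positivity, ?_⟩
    rw [mul_pow, Real.sq_sqrt (by positivity)]
    linarith
  calc ENNReal.ofReal _ ≤ ENNReal.ofReal 2 := ENNReal.ofReal_le_ofReal this
    _ = 2 := by simp

/-- Squares of subgaussian variables have exponential moments. The square is linearized with an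
independent standard Gaussian `g`: `exp(s x²) = E exp(√(2s) g x)`. -/
theorem lintegral_exp_mul_sq_le_of_hasSubgaussianMGF {Ω : Type*} [MeasurableSpace Ω]
    {P : Measure Ω} [IsProbabilityMeasure P] {X : Ω → ℝ} {v : ℝ≥0} (hm : Measurable X)
    (hX : HasSubgaussianMGF X v P) {s : ℝ} (hs : 0 ≤ s) (hsv : s * v ≤ 1 / 4) :
    ∫⁻ ω, ENNReal.ofReal (Real.exp (s * X ω ^ 2)) ∂P ≤ 2 := by
  have hsq : √(2 * s) ^ 2 = 2 * s := Real.sq_sqrt (by positivity)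
  have hlin : ∀ x : ℝ, ENNReal.ofReal (Real.exp (s * x ^ 2)) =
      ∫⁻ g, ENNReal.ofReal (Real.exp (√(2 * s) * x * g)) ∂(gaussianReal 0 1) := by
    intro x
    have hmgf := congrFun (mgf_id_gaussianReal (μ := 0) (v := 1)) (√(2 * s) * x)
    have hint : Integrable (fun g => Real.exp (√(2 * s) * x * g)) (gaussianReal 0 1) := by
      by_contra hcon
      have h0 := mgf_undef (X := id) hcon
      rw [hmgf] at h0
      exact (Real.exp_pos _).ne' h0
    rw [← ofReal_integral_eq_lintegral_ofReal hint (ae_of_all _ fun g => (Real.exp_pos _).le)]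
    simp only [mgf, id] at hmgf
    rw [hmgf]
    congr 2
    rw [mul_pow, hsq]
    simp; ring
  simp_rw [hlin]
  rw [lintegral_lintegral_swap (by fun_prop)]
  refine le_trans (lintegral_mono fun g => ?_) lintegral_exp_sq_div_four_gaussianReal
  have h1 : ∀ ω, √(2 * s) * X ω * g = (√(2 * s) * g) * X ω := fun ω => by ring
  simp_rw [h1]
  rw [← ofReal_integral_eq_lintegral_ofReal (hX.integrable_exp_mul _)
    (ae_of_all _ fun g => (Real.exp_pos _).le)]
  refine ENNReal.ofReal_le_ofReal ((hX.mgf_le _).trans (Real.exp_le_exp.2 ?_))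
  rw [mul_pow, hsq]
  nlinarith [sq_nonneg g]

/-! ### Bernstein's inequality and independence of blocks -/

section Bernstein

theorem exp_le_one_add_add_sq_mul_exp_abs (x : ℝ) :
    Real.exp x ≤ 1 + x + x ^ 2 * Real.exp |x| := by
  have h1 : 1 ≤ Real.exp |x| := Real.one_le_exp (abs_nonneg x)
  rcases le_total 0 x with h | h
  · rw [abs_of_nonneg h] at h1 ⊢
    have h2 : Real.exp x * Real.exp (-x) = 1 := by rw [← Real.exp_add]; simp
    have h3 := Real.add_one_le_exp (-x)
    have h4 : Real.exp x - 1 ≤ x * Real.exp x := by nlinarith [Real.exp_pos x]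
    nlinarith
  · have h2 : Real.exp x ≤ 1 + x + x ^ 2 := by
      rcases le_or_gt (-1) x with h' | h'
      · have := (abs_le.1 (Real.abs_exp_sub_one_sub_id_le (abs_le.2 ⟨h', h.trans zero_le_one⟩))).2
        linarith
      · have := Real.exp_le_one_iff.2 h
        nlinarith
    nlinarith [sq_nonneg x]

variable {Ω : Type*} [MeasurableSpace Ω] {P : Measure Ω}

theorem integrable_exp_of_lintegral_le {Y : Ω → ℝ} (hY : Measurable Y) {A : ℝ}
    (h : ∫⁻ ω, ENNReal.ofReal (Real.exp (Y ω)) ∂P ≤ ENNReal.ofReal A) :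
    Integrable (fun ω => Real.exp (Y ω)) P := by
  refine ⟨by fun_prop, ?_⟩
  rw [hasFiniteIntegral_iff_ofReal (ae_of_all _ fun u => (Real.exp_pos _).le)]
  exact h.trans_lt (by simp)

theorem integral_exp_le_of_lintegral_le {Y : Ω → ℝ} (hY : Measurable Y) {A : ℝ} (hA : 0 ≤ A)
    (h : ∫⁻ ω, ENNReal.ofReal (Real.exp (Y ω)) ∂P ≤ ENNReal.ofReal A) :
    ∫ ω, Real.exp (Y ω) ∂P ≤ A := by
  rw [integral_eq_lintegral_of_nonneg_ae (ae_of_all _ fun u => (Real.exp_pos _).le) (by fun_prop)]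
  exact ENNReal.toReal_le_of_le_ofReal hA h

theorem integrable_exp_mul_of_subexponential {Y : Ω → ℝ} (hY : Measurable Y)
    {c A t : ℝ} (ht : |t| ≤ c)
    (h : ∫⁻ ω, ENNReal.ofReal (Real.exp (c * |Y ω|)) ∂P ≤ ENNReal.ofReal A) :
    Integrable (fun ω => Real.exp (t * Y ω)) P := by
  refine (integrable_exp_of_lintegral_le (by fun_prop) h).mono' (by fun_prop)
    (ae_of_all _ fun ω => ?_)
  rw [Real.norm_eq_abs, abs_of_pos (Real.exp_pos _)]
  refine Real.exp_le_exp.2 ((le_abs_self _).trans ?_)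
  rw [abs_mul]
  gcongr

theorem integrable_of_subexponential {Y : Ω → ℝ} (hY : Measurable Y)
    {c A : ℝ} (hc : 0 < c)
    (h : ∫⁻ ω, ENNReal.ofReal (Real.exp (c * |Y ω|)) ∂P ≤ ENNReal.ofReal A) :
    Integrable Y P := by
  refine ((integrable_exp_of_lintegral_le (by fun_prop) h).const_mul c⁻¹).mono' (by fun_prop)
    (ae_of_all _ fun ω => ?_)
  rw [Real.norm_eq_abs, inv_mul_eq_div, le_div_iff₀ hc]
  have := Real.add_one_le_exp (c * |Y ω|)
  linarith

/-- The moment generating function of a variable with `E exp(c |Y|) ≤ A` is Gaussian around the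
mean for small arguments. -/
theorem mgf_le_of_subexponential [IsProbabilityMeasure P] {Y : Ω → ℝ} (hY : Measurable Y)
    {c A t : ℝ} (hc : 0 < c) (hA : 0 ≤ A) (ht : |t| ≤ c / 2)
    (h : ∫⁻ ω, ENNReal.ofReal (Real.exp (c * |Y ω|)) ∂P ≤ ENNReal.ofReal A) :
    mgf Y P t ≤ Real.exp (t * ∫ ω, Y ω ∂P + 8 * A / c ^ 2 * t ^ 2) := by
  have hint := integrable_exp_mul_of_subexponential hY (ht.trans (by linarith)) h
  have hE := integrable_exp_of_lintegral_le (by fun_prop) h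
  have hEA := integral_exp_le_of_lintegral_le (by fun_prop) hA h
  have hYi := integrable_of_subexponential hY hc h
  have hpt : ∀ ω, Real.exp (t * Y ω) ≤
      (1 + t * Y ω) + 8 / c ^ 2 * t ^ 2 * Real.exp (c * |Y ω|) := by
    intro ω
    have h1 := exp_le_one_add_add_sq_mul_exp_abs (t * Y ω)
    have h2 : Real.exp |t * Y ω| ≤ Real.exp (c / 2 * |Y ω|) := by
      rw [abs_mul]; gcongr
    -- `y² / 2 ≤ exp y` at `y = c |Y| / 2` absorbs the quadratic factor
    have h3 := Real.quadratic_le_exp_of_nonneg (x := c / 2 * |Y ω|) (by positivity)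
    have h4 : Y ω ^ 2 ≤ 8 / c ^ 2 * Real.exp (c / 2 * |Y ω|) := by
      rw [div_mul_eq_mul_div, le_div_iff₀ (by positivity)]
      have h5 : (c / 2 * |Y ω|) ^ 2 = c ^ 2 / 4 * Y ω ^ 2 := by rw [mul_pow, sq_abs]; ring
      have h6 : 0 ≤ c / 2 * |Y ω| := by positivity
      rw [h5] at h3
      nlinarith
    have h7 : Real.exp (c * |Y ω|) = Real.exp (c / 2 * |Y ω|) * Real.exp (c / 2 * |Y ω|) := by
      rw [← Real.exp_add]; ring_nf
    calc Real.exp (t * Y ω) ≤ 1 + t * Y ω + (t * Y ω) ^ 2 * Real.exp |t * Y ω| := h1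
      _ ≤ 1 + t * Y ω + (t ^ 2 * (8 / c ^ 2 * Real.exp (c / 2 * |Y ω|)))
            * Real.exp (c / 2 * |Y ω|) := by
          rw [mul_pow]; gcongr
      _ = _ := by rw [h7]; ring
  have hi1 : Integrable (fun ω => 1 + t * Y ω) P := (integrable_const _).add (hYi.const_mul t)
  calc mgf Y P t
      ≤ ∫ ω, ((1 + t * Y ω) + 8 / c ^ 2 * t ^ 2 * Real.exp (c * |Y ω|)) ∂P :=
        integral_mono hint (hi1.add (hE.const_mul _)) hpt
    _ = 1 + t * ∫ ω, Y ω ∂P + 8 / c ^ 2 * t ^ 2 * ∫ ω, Real.exp (c * |Y ω|) ∂P := by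
        rw [integral_add hi1 (hE.const_mul _), integral_add (integrable_const _)
          (hYi.const_mul t), integral_const_mul, integral_const_mul]
        simp
    _ ≤ 1 + t * ∫ ω, Y ω ∂P + 8 / c ^ 2 * t ^ 2 * A := by gcongr
    _ ≤ Real.exp (t * ∫ ω, Y ω ∂P + 8 * A / c ^ 2 * t ^ 2) := by
        refine le_trans (le_of_eq ?_) (Real.add_one_le_exp _)
        ring

theorem measureReal_sum_sub_integral_ge_le [IsProbabilityMeasure P] {ι : Type*} [Fintype ι]
    {Y : ι → Ω → ℝ} (hY : ∀ l, Measurable (Y l)) (hind : iIndepFun Y P) {c A τ : ℝ} (hc : 0 < c)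
    (hA : 0 < A) (hτ : 0 ≤ τ) (hτA : τ ≤ 8 * A / c)
    (h : ∀ l, ∫⁻ ω, ENNReal.ofReal (Real.exp (c * |Y l ω|)) ∂P ≤ ENNReal.ofReal A) :
    P.real {ω | Fintype.card ι * τ ≤ ∑ l, (Y l ω - ∫ ω', Y l ω' ∂P)} ≤
      Real.exp (-(Fintype.card ι * τ ^ 2 * c ^ 2 / (32 * A))) := by
  -- `V` is the variance proxy, and `t` minimizes the exponent `V t² - t τ` of Chernoff's bound
  set V := 8 * A / c ^ 2 with hV
  have hV0 : 0 < V := by positivity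
  set t := τ / (2 * V) with htdef
  have ht0 : 0 ≤ t := by positivity
  have ht : |t| ≤ c / 2 := by
    rw [abs_of_nonneg ht0, htdef, div_le_iff₀ (by positivity)]
    refine hτA.trans (le_of_eq ?_)
    rw [hV]; field_simp
  set E : ℝ := ∑ l, ∫ ω', Y l ω' ∂P with hE
  have hset : {ω | Fintype.card ι * τ ≤ ∑ l, (Y l ω - ∫ ω', Y l ω' ∂P)} =
      {ω | Fintype.card ι * τ + E ≤ (∑ l, Y l) ω} := by
    ext ω
    simp only [mem_ofPred_eq, Finset.sum_sub_distrib, Finset.sum_apply]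
    rw [le_sub_iff_add_le]
  have hint : Integrable (fun ω => Real.exp (t * (∑ l, Y l) ω)) P := by
    have := hind.integrable_exp_mul_sum hY (s := Finset.univ) (t := t) fun l _ =>
      integrable_exp_mul_of_subexponential (hY l) (ht.trans (by linarith)) (h l)
    simpa using this
  rw [hset]
  refine (measure_ge_le_exp_mul_mgf _ ht0 hint).trans ?_
  rw [hind.mgf_sum hY]
  calc Real.exp (-t * (Fintype.card ι * τ + E)) * ∏ l, mgf (Y l) P t
      ≤ Real.exp (-t * (Fintype.card ι * τ + E)) *
          ∏ l, Real.exp (t * ∫ ω, Y l ω ∂P + V * t ^ 2) := by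
        gcongr with l
        · exact fun _ _ => mgf_nonneg
        · exact mgf_le_of_subexponential (hY l) hc hA.le ht (h l)
    _ = Real.exp (-(Fintype.card ι * τ ^ 2 * c ^ 2 / (32 * A))) := by
        rw [← Real.exp_sum, ← Real.exp_add, Finset.sum_add_distrib, ← Finset.mul_sum, ← hE]
        congr 1
        simp only [Finset.sum_const, Finset.card_univ, nsmul_eq_mul]
        rw [htdef, hV]
        field_simp
        ring

/-- **Bernstein's inequality** for independent subexponential variables, in the range where the
Gaussian part of the tail dominates. -/
theorem measureReal_abs_sum_sub_integral_ge_le [IsProbabilityMeasure P] {ι : Type*} [Fintype ι]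
    {Y : ι → Ω → ℝ} (hY : ∀ l, Measurable (Y l)) (hind : iIndepFun Y P) {c A τ : ℝ} (hc : 0 < c)
    (hA : 0 < A) (hτ : 0 ≤ τ) (hτA : τ ≤ 8 * A / c)
    (h : ∀ l, ∫⁻ ω, ENNReal.ofReal (Real.exp (c * |Y l ω|)) ∂P ≤ ENNReal.ofReal A) :
    P.real {ω | Fintype.card ι * τ ≤ |∑ l, (Y l ω - ∫ ω', Y l ω' ∂P)|} ≤
      2 * Real.exp (-(Fintype.card ι * τ ^ 2 * c ^ 2 / (32 * A))) := by
  have h1 := measureReal_sum_sub_integral_ge_le hY hind hc hA hτ hτA h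
  have h2 := measureReal_sum_sub_integral_ge_le (Y := fun l ω => -Y l ω) (fun l => (hY l).neg)
    (hind.comp (fun _ x => -x) fun _ => measurable_neg) hc hA hτ hτA (by simpa using h)
  have hsub : {ω | Fintype.card ι * τ ≤ |∑ l, (Y l ω - ∫ ω', Y l ω' ∂P)|} ⊆
      {ω | Fintype.card ι * τ ≤ ∑ l, (Y l ω - ∫ ω', Y l ω' ∂P)} ∪
      {ω | Fintype.card ι * τ ≤ ∑ l, (-Y l ω - ∫ ω', -Y l ω' ∂P)} := by
    intro ω hω
    rw [mem_ofPred_eq] at hω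
    rcases le_abs.1 hω with h | h
    · exact Or.inl h
    · refine Or.inr (h.trans (le_of_eq ?_))
      rw [← Finset.sum_neg_distrib]
      refine Finset.sum_congr rfl fun l _ => ?_
      rw [integral_neg]; ring
  calc _ ≤ _ := measureReal_mono hsub
    _ ≤ _ := measureReal_union_le _ _
    _ ≤ _ := by linarith

end Bernstein

/-- Disjoint blocks of coordinates are independent under a product measure. -/
theorem iIndepFun_blocks {I ι κ : Type} [Fintype I] [Fintype ι] [Fintype κ]
    (μ : I → Measure ℝ) [∀ i, IsProbabilityMeasure (μ i)] (e : ι → κ → I)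
    (he : Function.Injective (fun p : (_ : ι) × κ => e p.1 p.2)) :
    iIndepFun (fun l (ω : I → ℝ) k => ω (e l k)) (Measure.pi μ) := by
  have hblock : ∀ l, (Measure.pi μ).map (fun (ω : I → ℝ) k => ω (e l k)) =
      Measure.infinitePi fun k => μ (e l k) := by
    intro l
    rw [← Measure.infinitePi_eq_pi]
    exact Measure.map_infinitePi_infinitePi_of_inj (P := μ) (f := e l) fun k k' h => by
      have := he (a₁ := ⟨l, k⟩) (a₂ := ⟨l, k'⟩) h
      simpa using this
  rw [iIndepFun_iff_map_fun_eq_infinitePi_map (by fun_prop)]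
  simp_rw [hblock]
  rw [← Measure.infinitePi_map_piCurry (X := fun (_ : ι) (_ : κ) => ℝ) (fun l k => μ (e l k)),
    ← Measure.map_infinitePi_infinitePi_of_inj (P := μ) he, Measure.infinitePi_eq_pi,
    Measure.map_map (by fun_prop) (by fun_prop)]
  rfl

/-! ### Gradients of the network and of the loss -/

section Gradients

variable {ι : Type} {d n : ℕ}

/-- The preactivation `⟨w_l, z⟩ + b_l` of the hidden unit `l`. -/
noncomputable def preact (θ : Param ι d) (l : ι) (z : Input d) : ℝ :=
  ∑ j, Param.W θ l j * z j + Param.b θ l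

/-- The contribution of the hidden unit `l` to the neural tangent kernel, before averaging. -/
noncomputable def kernelTerm (σ : ℝ → ℝ) (θ : Param ι d) (l : ι) (z z' : Input d) : ℝ :=
  σ (preact θ l z) * σ (preact θ l z') +
    Param.a θ l ^ 2 * (deriv σ (preact θ l z) * deriv σ (preact θ l z')) * (1 + inner ℝ z z')

variable [Fintype ι]

/-- The gradient of the network output with respect to the parameters. -/
noncomputable def netGrad (σ : ℝ → ℝ) (θ : Param ι d) (z : Input d) : Param ι d :=
  WithLp.toLp 2 fun i =>
    match i with
    | Sum.inl l => (1 / √(Fintype.card ι : ℝ)) * σ (preact θ l z)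
    | Sum.inr (Sum.inl (l, j)) =>
        (1 / √(Fintype.card ι : ℝ)) * (Param.a θ l * deriv σ (preact θ l z)) * z j
    | Sum.inr (Sum.inr (Sum.inl l)) =>
        (1 / √(Fintype.card ι : ℝ)) * (Param.a θ l * deriv σ (preact θ l z))
    | Sum.inr (Sum.inr (Sum.inr _)) => 1

/-- The coordinate functionals of the parameter space. -/
noncomputable abbrev coordCLM (i : ParamIdx ι d) : Param ι d →L[ℝ] ℝ := EuclideanSpace.proj i

theorem hasFDerivAt_preact (θ : Param ι d) (l : ι) (z : Input d) :
    HasFDerivAt (fun θ : Param ι d => preact θ l z)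
      (∑ j, z j • coordCLM (Sum.inr (Sum.inl (l, j))) +
        coordCLM (Sum.inr (Sum.inr (Sum.inl l)))) θ := by
  unfold preact Param.W Param.b
  refine HasFDerivAt.add (HasFDerivAt.fun_sum fun j _ => ?_) ?_
  · exact (coordCLM (Sum.inr (Sum.inl (l, j)))).hasFDerivAt.mul_const (z j)
  · exact (coordCLM (Sum.inr (Sum.inr (Sum.inl l)))).hasFDerivAt

theorem hasGradientAt_net {σ : ℝ → ℝ} (hσ : Differentiable ℝ σ) (θ : Param ι d) (z : Input d) :
    HasGradientAt (fun θ' : Param ι d => net σ θ' z) (netGrad σ θ z) θ := by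
  rw [hasGradientAt_iff_hasFDerivAt]
  have ha : ∀ l, HasFDerivAt (fun θ : Param ι d => Param.a θ l)
      (coordCLM (Sum.inl l)) θ := fun l =>
    (coordCLM (Sum.inl l)).hasFDerivAt
  have hs : ∀ l, HasFDerivAt (fun θ : Param ι d => σ (preact θ l z)) _ θ := fun l =>
    (hσ (preact θ l z)).hasDerivAt.comp_hasFDerivAt θ (hasFDerivAt_preact θ l z)
  have hb : HasFDerivAt (fun θ : Param ι d => Param.b₀ θ)
      (coordCLM (Sum.inr (Sum.inr (Sum.inr ())))) θ :=
    (coordCLM (Sum.inr (Sum.inr (Sum.inr ())))).hasFDerivAt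
  have key := ((HasFDerivAt.fun_sum (u := Finset.univ)
    fun l _ => (ha l).mul (hs l)).const_mul (1 / √(Fintype.card ι : ℝ))).add hb
  refine HasFDerivAt.congr_fderiv (f := fun θ' : Param ι d => net σ θ' z) key ?_
  ext h
  simp only [InnerProductSpace.toDual_apply_apply, PiLp.inner_apply, Fintype.sum_sum_type,
    Fintype.sum_prod_type, netGrad]
  simp only [RCLike.inner_apply, conj_trivial, add_apply,
    smul_apply, sum_apply, PiLp.proj_apply, smul_eq_mul,
    Finset.mul_sum]
  simp only [mul_one, mul_add, Finset.sum_add_distrib, Finset.mul_sum]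
  have e1 : ∀ l : ι, 1 / √(Fintype.card ι : ℝ) * (σ (preact θ l z) * h (Sum.inl l)) =
    h (Sum.inl l) * (1 / √(Fintype.card ι : ℝ) * σ (preact θ l z)) := fun l => by ring
  have e2 : ∀ (l : ι) (j : Fin d), 1 / √(Fintype.card ι : ℝ) * (Param.a θ l *
      (deriv σ (preact θ l z) * (z j * h (Sum.inr (Sum.inl (l, j)))))) =
    h (Sum.inr (Sum.inl (l, j))) *
      (1 / √(Fintype.card ι : ℝ) * (Param.a θ l * deriv σ (preact θ l z)) * z j) :=
    fun l j => by ring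
  have e3 : ∀ l : ι, 1 / √(Fintype.card ι : ℝ) * (Param.a θ l * (deriv σ (preact θ l z) *
      h (Sum.inr (Sum.inr (Sum.inl l))))) = h (Sum.inr (Sum.inr (Sum.inl l))) *
      (1 / √(Fintype.card ι : ℝ) * (Param.a θ l * deriv σ (preact θ l z))) := fun l => by ring
  simp only [e1, e2, e3]
  simp
  ring

/-- The neural tangent kernel is an average of one term for each hidden unit; the outer bias
contributes the `1`. -/
theorem ntk_eq {σ : ℝ → ℝ} (hσ : Differentiable ℝ σ) (θ : Param ι d) (z z' : Input d) :
    ntk σ θ z z' = 1 + 1 / (Fintype.card ι : ℝ) * ∑ l, kernelTerm σ θ l z z' := by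
  rw [ntk, (hasGradientAt_net hσ θ z).gradient, (hasGradientAt_net hσ θ z').gradient]
  have hN : (1 / √(Fintype.card ι : ℝ)) * (1 / √(Fintype.card ι : ℝ)) =
      1 / (Fintype.card ι : ℝ) := by
    rw [div_mul_div_comm, Real.mul_self_sqrt (Nat.cast_nonneg _), one_mul]
  simp only [PiLp.inner_apply, Fintype.sum_sum_type,
    Fintype.sum_prod_type, netGrad, RCLike.inner_apply, conj_trivial, kernelTerm,
    Finset.mul_sum, ← hN]
  have e2 : ∀ l : ι, ∑ j, 1 / √(Fintype.card ι : ℝ) * (Param.a θ l * deriv σ (preact θ l z')) *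
        z' j * (1 / √(Fintype.card ι : ℝ) * (Param.a θ l * deriv σ (preact θ l z)) * z j) =
      1 / √(Fintype.card ι : ℝ) * (1 / √(Fintype.card ι : ℝ)) * (Param.a θ l ^ 2 *
        (deriv σ (preact θ l z) * deriv σ (preact θ l z')) * ∑ j, z' j * z j) := by
    intro l
    rw [Finset.mul_sum, Finset.mul_sum]
    exact Finset.sum_congr rfl fun j _ => by ring
  simp only [e2, Finset.univ_unique, Finset.sum_const, Finset.card_singleton, one_smul, mul_one]
  rw [← add_assoc, ← add_assoc, ← Finset.sum_add_distrib, ← Finset.sum_add_distrib, add_comm]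
  congr 1
  exact Finset.sum_congr rfl fun l _ => by ring

/-- The gradient of the squared loss. -/
noncomputable def lossGrad (σ : ℝ → ℝ) (x : Fin n → Input d) (y : Fin n → ℝ) (θ : Param ι d) :
    Param ι d :=
  (1 / (n : ℝ)) • ∑ i, residual σ x y θ i • netGrad σ θ (x i)

theorem hasGradientAt_loss {σ : ℝ → ℝ} (hσ : Differentiable ℝ σ) (x : Fin n → Input d)
    (y : Fin n → ℝ) (θ : Param ι d) :
    HasGradientAt (loss (ι := ι) σ x y) (lossGrad σ x y θ) θ := by
  rw [hasGradientAt_iff_hasFDerivAt]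
  have hr : ∀ i, HasFDerivAt (fun θ : Param ι d => residual σ x y θ i)
      (InnerProductSpace.toDual ℝ (Param ι d) (netGrad σ θ (x i))) θ := fun i =>
    (hasGradientAt_iff_hasFDerivAt.1 (hasGradientAt_net hσ θ (x i))).sub_const (y i)
  have key := (HasFDerivAt.fun_sum (u := Finset.univ)
    fun i _ => (hr i).pow 2).const_mul (1 / (2 * (n : ℝ)))
  refine HasFDerivAt.congr_fderiv (f := loss (ι := ι) σ x y) key ?_
  ext h
  simp only [lossGrad, InnerProductSpace.toDual_apply_apply, smul_apply,
    sum_apply, inner_smul_left, sum_inner, smul_eq_mul, conj_trivial,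
    Finset.mul_sum]
  refine Finset.sum_congr rfl fun i _ => ?_
  simp only [nsmul_eq_mul, Nat.cast_ofNat, Nat.add_one_sub_one, pow_one]
  by_cases hn : (n : ℝ) = 0
  · simp [hn]
  · field_simp

theorem IsGradientFlow.hasDerivWithinAt {σ : ℝ → ℝ} (hσ : Differentiable ℝ σ)
    {x : Fin n → Input d} {y : Fin n → ℝ} {T : ℝ} {γ : ℝ → Param ι d}
    (h : IsGradientFlow (loss σ x y) T γ) {t : ℝ} (ht : t ∈ Icc 0 T) :
    HasDerivWithinAt γ (-lossGrad σ x y (γ t)) (Icc 0 T) t := by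
  have := h t ht
  rwa [(hasGradientAt_loss hσ x y (γ t)).gradient] at this

theorem normalizedNorm_residual {σ : ℝ → ℝ} (x : Fin n → Input d) (y : Fin n → ℝ)
    (θ : Param ι d) : normalizedNorm (residual σ x y θ) = √(2 * loss σ x y θ) := by
  rw [normalizedNorm, loss]
  congr 1
  by_cases hn : (n : ℝ) = 0
  · simp [hn]
  · field_simp

/-- The training loss does not increase along the flow. -/
theorem IsGradientFlow.normalizedNorm_residual_le {σ : ℝ → ℝ} (hσ : Differentiable ℝ σ)
    {x : Fin n → Input d} {y : Fin n → ℝ} {T : ℝ} {γ : ℝ → Param ι d}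
    (h : IsGradientFlow (loss σ x y) T γ) {t : ℝ} (ht : t ∈ Icc 0 T) :
    normalizedNorm (residual σ x y (γ t)) ≤ normalizedNorm (residual σ x y (γ 0)) := by
  have hd : ∀ s ∈ Icc 0 T, HasDerivWithinAt (fun s => loss σ x y (γ s))
      (-‖lossGrad σ x y (γ s)‖ ^ 2) (Icc 0 T) s := by
    intro s hs
    have := (hasGradientAt_iff_hasFDerivAt.1
      (hasGradientAt_loss hσ x y (γ s))).comp_hasDerivWithinAt s (h.hasDerivWithinAt hσ hs)
    rwa [InnerProductSpace.toDual_apply_apply, inner_neg_right, real_inner_self_eq_norm_sq]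
      at this
  have hanti : AntitoneOn (fun s => loss σ x y (γ s)) (Icc 0 T) := by
    refine antitoneOn_of_deriv_nonpos (convex_Icc 0 T) (fun s hs => (hd s hs).continuousWithinAt)
      (fun s hs => ?_) (fun s hs => ?_)
    · exact ((hd s (interior_subset hs)).mono interior_subset).differentiableWithinAt
    · rw [((hd s (interior_subset hs)).hasDerivAt (mem_interior_iff_mem_nhds.1 hs)).deriv]
      exact neg_nonpos.2 (by positivity)
  rw [normalizedNorm_residual, normalizedNorm_residual]
  exact Real.sqrt_le_sqrt (mul_le_mul_of_nonneg_left
    (hanti ⟨le_rfl, ht.1.trans ht.2⟩ ht ht.1) zero_le_two)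

end Gradients

/-! ### Displacement of one hidden unit along the flow -/

section Drift

variable {ι : Type} {d n : ℕ}

/-- Size constants of an activation on the ball of radius `M`: `L` and `L₂` are Lipschitz constants
of `σ` and `σ'`, and `S` bounds `|σ 0|`, `L` and `M L`. -/
structure ActivationBounds (σ : ℝ → ℝ) (M L L₂ S : ℝ) : Prop where
  differentiable : Differentiable ℝ σ
  M_nonneg : 0 ≤ M
  lip : ∀ u v, |σ u - σ v| ≤ L * |u - v|
  deriv_le : ∀ u, |deriv σ u| ≤ L
  deriv_lip : ∀ u v, |deriv σ u - deriv σ v| ≤ L₂ * |u - v|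
  zero_le : |σ 0| ≤ S
  L_le : L ≤ S
  ML_le : M * L ≤ S

theorem ActivationBounds.L_nonneg {σ : ℝ → ℝ} {M L L₂ S : ℝ} (h : ActivationBounds σ M L L₂ S) :
    0 ≤ L := (abs_nonneg _).trans (h.deriv_le 0)

theorem ActivationBounds.L₂_nonneg {σ : ℝ → ℝ} {M L L₂ S : ℝ} (h : ActivationBounds σ M L L₂ S) :
    0 ≤ L₂ := by simpa using (abs_nonneg _).trans (h.deriv_lip 1 0)

theorem ActivationBounds.S_nonneg {σ : ℝ → ℝ} {M L L₂ S : ℝ} (h : ActivationBounds σ M L L₂ S) :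
    0 ≤ S := h.L_nonneg.trans h.L_le

theorem ActivationBounds.abs_le {σ : ℝ → ℝ} {M L L₂ S : ℝ} (h : ActivationBounds σ M L L₂ S)
    (u : ℝ) : |σ u| ≤ S + S * |u| := by
  have h1 := h.lip u 0
  have h2 := abs_sub_abs_le_abs_sub (σ u) (σ 0)
  have h3 := h.zero_le
  rw [sub_zero] at h1
  have h4 := mul_le_mul_of_nonneg_right h.L_le (abs_nonneg u)
  linarith

/-- The Cauchy–Schwarz inequality for the normalized norm. -/
theorem abs_average_mul_le (r c : Fin n → ℝ) :
    1 / (n : ℝ) * ∑ i, |r i| * |c i| ≤ normalizedNorm r * normalizedNorm c := by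
  rw [normalizedNorm, normalizedNorm, ← Real.sqrt_mul (by positivity)]
  refine Real.le_sqrt_of_sq_le ?_
  have h := Finset.sum_mul_sq_le_sq_mul_sq Finset.univ (fun i => |r i|) fun i => |c i|
  simp only [sq_abs] at h
  rw [mul_pow]
  calc (1 / (n : ℝ)) ^ 2 * (∑ i, |r i| * |c i|) ^ 2
      ≤ (1 / (n : ℝ)) ^ 2 * ((∑ i, r i ^ 2) * ∑ i, c i ^ 2) := by gcongr
    _ = _ := by ring

theorem average_abs_le_normalizedNorm (hn : 1 ≤ n) (r : Fin n → ℝ) :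
    1 / (n : ℝ) * ∑ i, |r i| ≤ normalizedNorm r := by
  have h := abs_average_mul_le r fun _ => 1
  have hn0 : (n : ℝ) ≠ 0 := by positivity
  have h1 : normalizedNorm (fun _ : Fin n => (1 : ℝ)) = 1 := by
    simp [normalizedNorm, hn0]
  simpa [h1] using h

/-- The triple `(a_l, w_l, b_l)` of parameters of the hidden unit `l`. The product carries the
supremum of the norms of the three entries. -/
noncomputable def unitCLM (l : ι) : Param ι d →L[ℝ] ℝ × Input d × ℝ :=
  (coordCLM (Sum.inl l)).prod
    (((EuclideanSpace.equiv (Fin d) ℝ).symm.toContinuousLinearMap.comp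
      (ContinuousLinearMap.pi fun j => coordCLM (Sum.inr (Sum.inl (l, j))))).prod
    (coordCLM (Sum.inr (Sum.inr (Sum.inl l)))))

theorem preact_eq_inner (l : ι) (θ : Param ι d) (z : Input d) :
    preact θ l z = inner ℝ (unitCLM l θ).2.1 z + (unitCLM l θ).2.2 := by
  rw [PiLp.inner_apply, preact]
  congr 1
  exact Finset.sum_congr rfl fun j _ => by
    rw [RCLike.inner_apply, conj_trivial, mul_comm]; rfl

theorem abs_preact_sub_le {l : ι} {θ θ' : Param ι d} {z : Input d} {M : ℝ} (hz : ‖z‖ ≤ M) :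
    |preact θ l z - preact θ' l z| ≤ (M + 1) * ‖unitCLM l θ - unitCLM l θ'‖ := by
  have h1 : preact θ l z - preact θ' l z =
      inner ℝ (unitCLM l θ - unitCLM l θ').2.1 z + (unitCLM l θ - unitCLM l θ').2.2 := by
    rw [preact_eq_inner, preact_eq_inner]
    simp only [Prod.snd_sub, Prod.fst_sub, inner_sub_left]
    ring
  rw [h1]
  set h := unitCLM l θ - unitCLM l θ'
  have h2 : ‖h.2.1‖ ≤ ‖h‖ := (norm_fst_le h.2).trans (norm_snd_le h)
  have h3 : ‖h.2.2‖ ≤ ‖h‖ := (norm_snd_le h.2).trans (norm_snd_le h)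
  calc |inner ℝ h.2.1 z + h.2.2| ≤ |inner ℝ h.2.1 z| + |h.2.2| := abs_add_le _ _
    _ ≤ ‖h.2.1‖ * ‖z‖ + ‖h.2.2‖ := add_le_add (abs_real_inner_le_norm _ _) le_rfl
    _ ≤ ‖h‖ * M + ‖h‖ := by gcongr
    _ = _ := by ring

variable [Fintype ι]

theorem unitCLM_lossGrad (σ : ℝ → ℝ) (x : Fin n → Input d) (y : Fin n → ℝ) (θ : Param ι d)
    (l : ι) :
    unitCLM l (lossGrad σ x y θ) = (1 / (n : ℝ)) • ∑ i, residual σ x y θ i •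
      ((1 / √(Fintype.card ι : ℝ)) * σ (preact θ l (x i)),
        ((1 / √(Fintype.card ι : ℝ)) * (Param.a θ l * deriv σ (preact θ l (x i)))) • x i,
        (1 / √(Fintype.card ι : ℝ)) * (Param.a θ l * deriv σ (preact θ l (x i)))) := by
  rw [lossGrad, map_smul, map_sum]
  congr 1

/-- The speed of the parameters of one hidden unit under the gradient flow is controlled by the
size of that unit's parameters on the data, with a factor `N^{-1/2}`. -/
theorem norm_unitCLM_lossGrad_le {σ : ℝ → ℝ} {M L L₂ S : ℝ} (hσ : ActivationBounds σ M L L₂ S)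
    (hn : 1 ≤ n) {x : Fin n → Input d} (hx : ∀ i, ‖x i‖ ≤ M) (y : Fin n → ℝ) (θ θ₀ : Param ι d)
    (l : ι) {R : ℝ} (hR : normalizedNorm (residual σ x y θ) ≤ R) :
    ‖unitCLM l (lossGrad σ x y θ)‖ ≤
      2 * (S * (R / √(Fintype.card ι : ℝ))) * ‖unitCLM l θ - unitCLM l θ₀‖ +
        S * (R / √(Fintype.card ι : ℝ)) *
          (1 + |Param.a θ₀ l| + normalizedNorm fun i => preact θ₀ l (x i)) := by
  set r := residual σ x y θ with hr
  set c := 1 / √(Fintype.card ι : ℝ) with hc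
  have hc0 : 0 ≤ c := by positivity
  set h := ‖unitCLM l θ - unitCLM l θ₀‖ with hh
  set v := normalizedNorm fun i => preact θ₀ l (x i) with hv
  have hv0 : 0 ≤ v := Real.sqrt_nonneg _
  have hR0 : 0 ≤ R := (Real.sqrt_nonneg _).trans hR
  have hS0 := hσ.S_nonneg
  have hL0 := hσ.L_nonneg
  have hh0 : 0 ≤ h := norm_nonneg _
  have havg : 1 / (n : ℝ) * ∑ i, |r i| ≤ R := (average_abs_le_normalizedNorm hn r).trans hR
  have hA : |Param.a θ l| ≤ |Param.a θ₀ l| + h := by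
    have h1 : |Param.a θ l - Param.a θ₀ l| ≤ h := norm_fst_le (unitCLM l θ - unitCLM l θ₀)
    have h2 := abs_sub_abs_le_abs_sub (Param.a θ l) (Param.a θ₀ l)
    linarith
  have hLM : L * (M + 1) ≤ 2 * S := by
    have := hσ.L_le; have := hσ.ML_le; nlinarith
  have hact : ∀ i, |σ (preact θ l (x i))| ≤ S * (1 + 2 * h) + S * |preact θ₀ l (x i)| := by
    intro i
    have h1 := hσ.lip (preact θ l (x i)) (preact θ₀ l (x i))
    have h2 := abs_preact_sub_le (l := l) (θ := θ) (θ' := θ₀) (hx i)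
    have h3 := hσ.abs_le (preact θ₀ l (x i))
    have h4 := abs_sub_abs_le_abs_sub (σ (preact θ l (x i))) (σ (preact θ₀ l (x i)))
    have h5 : L * |preact θ l (x i) - preact θ₀ l (x i)| ≤ 2 * S * h :=
      calc _ ≤ L * ((M + 1) * h) := by gcongr
        _ = L * (M + 1) * h := by ring
        _ ≤ _ := by gcongr
    linarith
  -- a weighted average of vectors of norm at most `B` has norm at most `R B`
  have hvec : ∀ {E : Type} [NormedAddCommGroup E] [NormedSpace ℝ E] (u : Fin n → E) (B : ℝ),
      0 ≤ B → (∀ i, ‖u i‖ ≤ B) → ‖(1 / (n : ℝ)) • ∑ i, r i • u i‖ ≤ R * B := by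
    intro E _ _ u B hB hu
    rw [norm_smul, Real.norm_of_nonneg (by positivity)]
    calc 1 / (n : ℝ) * ‖∑ i, r i • u i‖ ≤ 1 / (n : ℝ) * ∑ i, |r i| * B := by
          gcongr
          refine (norm_sum_le _ _).trans (Finset.sum_le_sum fun i _ => ?_)
          rw [norm_smul]
          exact mul_le_mul_of_nonneg_left (hu i) (norm_nonneg _)
      _ = (1 / (n : ℝ) * ∑ i, |r i|) * B := by rw [← Finset.sum_mul, mul_assoc]
      _ ≤ R * B := by gcongr
  have hder : ∀ i, |c * (Param.a θ l * deriv σ (preact θ l (x i)))| ≤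
      c * ((|Param.a θ₀ l| + h) * L) := by
    intro i
    rw [abs_mul, abs_mul, abs_of_nonneg hc0]
    have := hσ.deriv_le (preact θ l (x i))
    gcongr
  have hgoal : 2 * (S * (R / √(Fintype.card ι : ℝ))) * h +
        S * (R / √(Fintype.card ι : ℝ)) * (1 + |Param.a θ₀ l| + v) =
      R * c * S * (2 * h + 1 + |Param.a θ₀ l| + v) := by rw [hc]; ring
  rw [hgoal, unitCLM_lossGrad]
  have ha0 := abs_nonneg (Param.a θ₀ l)
  refine norm_prod_le_iff.2 ⟨?_, norm_prod_le_iff.2 ⟨?_, ?_⟩⟩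
  · simp only [Prod.smul_fst, Prod.fst_sum, smul_eq_mul]
    calc ‖1 / (n : ℝ) * ∑ i, r i * (c * σ (preact θ l (x i)))‖
        ≤ 1 / (n : ℝ) * ∑ i, |r i| * (c * (S * (1 + 2 * h) + S * |preact θ₀ l (x i)|)) := by
          rw [norm_mul, Real.norm_of_nonneg (by positivity)]
          gcongr
          refine (norm_sum_le _ _).trans (Finset.sum_le_sum fun i _ => ?_)
          rw [Real.norm_eq_abs, abs_mul, abs_mul, abs_of_nonneg hc0]
          have := hact i
          gcongr
      _ = c * S * (1 + 2 * h) * (1 / (n : ℝ) * ∑ i, |r i|) +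
            c * S * (1 / (n : ℝ) * ∑ i, |r i| * |preact θ₀ l (x i)|) := by
          simp only [Finset.mul_sum, ← Finset.sum_add_distrib]
          exact Finset.sum_congr rfl fun i _ => by ring
      _ ≤ c * S * (1 + 2 * h) * R + c * S * (R * v) := by
          have hrv := (abs_average_mul_le r fun i => preact θ₀ l (x i)).trans
            (mul_le_mul_of_nonneg_right hR hv0)
          exact add_le_add (mul_le_mul_of_nonneg_left havg (by positivity))
            (mul_le_mul_of_nonneg_left hrv (by positivity))
      _ ≤ _ := by nlinarith [mul_nonneg (mul_nonneg hR0 hc0) (mul_nonneg hS0 ha0)]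
  · simp only [Prod.smul_fst, Prod.smul_snd, Prod.fst_sum, Prod.snd_sum]
    refine (hvec _ (c * ((|Param.a θ₀ l| + h) * L) * M) (mul_nonneg (by positivity) hσ.M_nonneg)
      fun i => ?_).trans ?_
    · rw [norm_smul]
      exact mul_le_mul (hder i) (hx i) (norm_nonneg _) (by positivity)
    · calc R * (c * ((|Param.a θ₀ l| + h) * L) * M)
          = R * c * (|Param.a θ₀ l| + h) * (M * L) := by ring
        _ ≤ R * c * (|Param.a θ₀ l| + h) * S := by
          have := hσ.ML_le
          gcongr
        _ = R * c * S * (|Param.a θ₀ l| + h) := by ring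
        _ ≤ _ := mul_le_mul_of_nonneg_left (by linarith) (by positivity)
  · simp only [Prod.smul_snd, Prod.snd_sum]
    refine (hvec _ (c * ((|Param.a θ₀ l| + h) * L)) (by positivity) hder).trans ?_
    calc R * (c * ((|Param.a θ₀ l| + h) * L))
          = R * c * (|Param.a θ₀ l| + h) * L := by ring
        _ ≤ R * c * (|Param.a θ₀ l| + h) * S := by
          have := hσ.L_le
          gcongr
        _ = R * c * S * (|Param.a θ₀ l| + h) := by ring
        _ ≤ _ := mul_le_mul_of_nonneg_left (by linarith) (by positivity)

theorem gronwallBound_zero_le {κ ε t : ℝ} (hκ : 0 ≤ κ) (hε : 0 ≤ ε) :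
    gronwallBound 0 κ ε t ≤ ε * t * Real.exp (κ * t) := by
  rcases hκ.eq_or_lt with h | h
  · rw [← h, gronwallBound_K0]; simp
  · rw [gronwallBound_of_K_ne_0 h.ne']
    have h1 : Real.exp (κ * t) * Real.exp (-(κ * t)) = 1 := by rw [← Real.exp_add]; simp
    have h2 := Real.add_one_le_exp (-(κ * t))
    have h3 : Real.exp (κ * t) - 1 ≤ κ * t * Real.exp (κ * t) := by
      nlinarith [Real.exp_pos (κ * t)]
    calc 0 * Real.exp (κ * t) + ε / κ * (Real.exp (κ * t) - 1)
        ≤ ε / κ * (κ * t * Real.exp (κ * t)) := by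
          rw [zero_mul, zero_add]; gcongr
      _ = _ := by field_simp

/-- Grönwall's inequality for one hidden unit. Measuring the displacement rather than the
parameters keeps the dimension-dependent size of `w_l` out of the bound. -/
theorem IsGradientFlow.norm_unitCLM_sub_le {σ : ℝ → ℝ} {M L L₂ S : ℝ}
    (hσ : ActivationBounds σ M L L₂ S) (hn : 1 ≤ n) {x : Fin n → Input d} (hx : ∀ i, ‖x i‖ ≤ M)
    {y : Fin n → ℝ} {T : ℝ} {γ : ℝ → Param ι d} (h : IsGradientFlow (loss σ x y) T γ) (l : ι)
    {t : ℝ} (ht : t ∈ Icc 0 T) :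
    ‖unitCLM l (γ t) - unitCLM l (γ 0)‖ ≤
      S * (normalizedNorm (residual σ x y (γ 0)) / √(Fintype.card ι : ℝ)) *
        (1 + |Param.a (γ 0) l| + normalizedNorm fun i => preact (γ 0) l (x i)) * t *
      Real.exp (2 * (S * (normalizedNorm (residual σ x y (γ 0)) / √(Fintype.card ι : ℝ))) * t) := by
  have hd : ∀ s ∈ Icc 0 T, HasDerivWithinAt (fun s => unitCLM l (γ s) - unitCLM l (γ 0))
      (unitCLM l (-lossGrad σ x y (γ s))) (Icc 0 T) s := fun s hs =>
    (((unitCLM l).hasFDerivAt.comp_hasDerivWithinAt s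
      (h.hasDerivWithinAt hσ.differentiable hs))).sub_const _
  have hR0 : 0 ≤ normalizedNorm (residual σ x y (γ 0)) := Real.sqrt_nonneg _
  have hv0 : 0 ≤ normalizedNorm fun i => preact (γ 0) l (x i) := Real.sqrt_nonneg _
  have hS0 := hσ.S_nonneg
  have key := norm_le_gronwallBound_of_norm_deriv_right_le (δ := 0)
    (fun s hs => (hd s hs).continuousWithinAt)
    (fun s hs => ((hd s ⟨hs.1, hs.2.le⟩).mono_of_mem_nhdsWithin
      (Filter.mem_of_superset (Icc_mem_nhdsGE hs.2) (Icc_subset_Icc_left hs.1))))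
    (by simp)
    (fun s hs => by
      rw [map_neg, norm_neg]
      exact norm_unitCLM_lossGrad_le hσ hn hx y (γ s) (γ 0) l
        (h.normalizedNorm_residual_le hσ.differentiable ⟨hs.1, hs.2.le⟩)) t ht
  rw [sub_zero] at key
  exact key.trans (gronwallBound_zero_le (by positivity) (by positivity))

end Drift

/-! ### Deterministic deviation bound -/

section Deterministic

variable {ι : Type} {d n : ℕ}

theorem opNorm_le_of_abs_le {A : Matrix (Fin n) (Fin n) ℝ} {B : ℝ} (hB : 0 ≤ B)
    (h : ∀ i j, |A i j| ≤ B) : opNorm A ≤ n * B := by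
  refine ContinuousLinearMap.opNorm_le_bound _ (by positivity) fun v => ?_
  refine le_of_sq_le_sq ?_ (by positivity)
  rw [EuclideanSpace.real_norm_sq_eq, mul_pow, EuclideanSpace.real_norm_sq_eq]
  have hrow : ∀ i, (Matrix.toEuclideanCLM (n := Fin n) (𝕜 := ℝ) A v) i ^ 2 ≤
      n * B ^ 2 * ∑ j, v j ^ 2 := by
    intro i
    have h1 : (Matrix.toEuclideanCLM (n := Fin n) (𝕜 := ℝ) A v) i = ∑ j, A i j * v j := rfl
    rw [h1]
    refine (Finset.sum_mul_sq_le_sq_mul_sq Finset.univ _ _).trans ?_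
    gcongr
    calc ∑ j, A i j ^ 2 ≤ ∑ _j : Fin n, B ^ 2 :=
          Finset.sum_le_sum fun j _ => sq_le_sq' (abs_le.1 (h i j)).1 (abs_le.1 (h i j)).2
      _ = n * B ^ 2 := by simp
  calc ∑ i, (Matrix.toEuclideanCLM (n := Fin n) (𝕜 := ℝ) A v) i ^ 2
      ≤ ∑ _i : Fin n, n * B ^ 2 * ∑ j, v j ^ 2 := Finset.sum_le_sum fun i _ => hrow i
    _ = _ := by simp; ring

theorem abs_one_add_inner_le {M : ℝ} {z z' : Input d} (hz : ‖z‖ ≤ M) (hz' : ‖z'‖ ≤ M) :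
    |1 + inner ℝ z z'| ≤ 1 + M ^ 2 := by
  have h1 := abs_real_inner_le_norm z z'
  have h2 : ‖z‖ * ‖z'‖ ≤ M * M :=
    mul_le_mul hz hz' (norm_nonneg _) ((norm_nonneg _).trans hz)
  calc |1 + inner ℝ z z'| ≤ |1| + |inner ℝ z z'| := abs_add_le _ _
    _ ≤ 1 + M ^ 2 := by rw [abs_one]; nlinarith

/-- Change of one kernel term when the parameters of the unit move by at most `H`. -/
theorem abs_kernelTerm_sub_le {σ : ℝ → ℝ} {M L L₂ S : ℝ} (hσ : ActivationBounds σ M L L₂ S)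
    {θ θ₀ : Param ι d} {l : ι} {z z' : Input d} (hz : ‖z‖ ≤ M) (hz' : ‖z'‖ ≤ M) {B D₁ Γ H : ℝ}
    (hB : 1 ≤ B) (hD : 1 ≤ D₁) (hΓ : 1 ≤ Γ) (ha : |Param.a θ₀ l| ≤ B)
    (hu : |preact θ₀ l z| ≤ D₁ * B) (hu' : |preact θ₀ l z'| ≤ D₁ * B)
    (hH : ‖unitCLM l θ - unitCLM l θ₀‖ ≤ H) (hHΓ : H ≤ 2 * B * Γ ^ 2) :
    |kernelTerm σ θ l z z' - kernelTerm σ θ₀ l z z'| ≤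
      (16 * S ^ 2 + (1 + M ^ 2) * (4 * L ^ 2 + 2 * L * L₂ * (M + 1))) *
        (D₁ * B ^ 2 * Γ ^ 2 * H) := by
  have hS0 := hσ.S_nonneg
  have hL0 := hσ.L_nonneg
  have hL20 := hσ.L₂_nonneg
  have hM0 := hσ.M_nonneg
  have hH0 : 0 ≤ H := (norm_nonneg _).trans hH
  have hΓ2 : 1 ≤ Γ ^ 2 := one_le_pow₀ hΓ
  have hLM : L * (M + 1) ≤ 2 * S := by
    have := hσ.L_le; have := hσ.ML_le; nlinarith
  have hdu : ∀ w : Input d, ‖w‖ ≤ M → |preact θ l w - preact θ₀ l w| ≤ (M + 1) * H := fun w hw =>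
    (abs_preact_sub_le hw).trans (mul_le_mul_of_nonneg_left hH (by positivity))
  have hds : ∀ w : Input d, ‖w‖ ≤ M →
      |σ (preact θ l w) - σ (preact θ₀ l w)| ≤ 2 * S * H := fun w hw =>
    calc _ ≤ L * |preact θ l w - preact θ₀ l w| := hσ.lip _ _
      _ ≤ L * ((M + 1) * H) := mul_le_mul_of_nonneg_left (hdu w hw) hL0
      _ = L * (M + 1) * H := by ring
      _ ≤ _ := mul_le_mul_of_nonneg_right hLM hH0
  have hds' : ∀ w : Input d, ‖w‖ ≤ M →
      |deriv σ (preact θ l w) - deriv σ (preact θ₀ l w)| ≤ L₂ * ((M + 1) * H) := fun w hw =>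
    (hσ.deriv_lip _ _).trans (mul_le_mul_of_nonneg_left (hdu w hw) hL20)
  have hDB : 1 ≤ D₁ * B := by nlinarith
  have hs0 : ∀ w, |preact θ₀ l w| ≤ D₁ * B → |σ (preact θ₀ l w)| ≤ 2 * S * (D₁ * B) := by
    intro w hw
    have h1 := hσ.abs_le (preact θ₀ l w)
    nlinarith [mul_le_mul_of_nonneg_left hw hS0]
  have hst : |σ (preact θ l z')| ≤ 6 * S * (D₁ * B * Γ ^ 2) := by
    have h1 := abs_sub_abs_le_abs_sub (σ (preact θ l z')) (σ (preact θ₀ l z'))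
    have h2 := hds z' hz'
    have h3 := hs0 z' hu'
    have h4 : 2 * S * H ≤ 2 * S * (2 * B * Γ ^ 2) := by gcongr
    have h5 : S * (B * Γ ^ 2) ≤ S * (D₁ * B * Γ ^ 2) := by
      gcongr; nlinarith
    have h6 : S * (D₁ * B) ≤ S * (D₁ * B * Γ ^ 2) :=
      mul_le_mul_of_nonneg_left (le_mul_of_one_le_right (by positivity) hΓ2) hS0
    nlinarith
  -- first part of the kernel term
  have hI : |σ (preact θ l z) * σ (preact θ l z') - σ (preact θ₀ l z) * σ (preact θ₀ l z')| ≤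
      16 * S ^ 2 * (D₁ * B * Γ ^ 2 * H) := by
    have e : σ (preact θ l z) * σ (preact θ l z') - σ (preact θ₀ l z) * σ (preact θ₀ l z') =
        (σ (preact θ l z) - σ (preact θ₀ l z)) * σ (preact θ l z') +
        σ (preact θ₀ l z) * (σ (preact θ l z') - σ (preact θ₀ l z')) := by ring
    rw [e]
    calc _ ≤ 2 * S * H * (6 * S * (D₁ * B * Γ ^ 2)) + 2 * S * (D₁ * B) * (2 * S * H) := by
          refine (abs_add_le _ _).trans (add_le_add ?_ ?_)
          · rw [abs_mul]
            exact mul_le_mul (hds z hz) hst (abs_nonneg _) (by positivity)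
          · rw [abs_mul]
            exact mul_le_mul (hs0 z hu) (hds z' hz') (abs_nonneg _) (by positivity)
      _ = S ^ 2 * H * (D₁ * B) * (12 * Γ ^ 2 + 4 * 1) := by ring
      _ ≤ S ^ 2 * H * (D₁ * B) * (12 * Γ ^ 2 + 4 * Γ ^ 2) := by gcongr
      _ = _ := by ring
  -- second part of the kernel term
  have hA : |Param.a θ l ^ 2 - Param.a θ₀ l ^ 2| ≤ H * (4 * B * Γ ^ 2) := by
    have h1 : |Param.a θ l - Param.a θ₀ l| ≤ H :=
      (norm_fst_le (unitCLM l θ - unitCLM l θ₀)).trans hH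
    have e : Param.a θ l ^ 2 - Param.a θ₀ l ^ 2 =
      (Param.a θ l - Param.a θ₀ l) * ((Param.a θ l - Param.a θ₀ l) + 2 * Param.a θ₀ l) := by ring
    rw [e, abs_mul]
    refine mul_le_mul h1 ((abs_add_le _ _).trans ?_) (abs_nonneg _) hH0
    rw [abs_mul, abs_two]
    nlinarith
  have hda : ∀ u v : ℝ, |deriv σ u * deriv σ v| ≤ L ^ 2 := fun u v => by
    rw [abs_mul, sq]
    exact mul_le_mul (hσ.deriv_le u) (hσ.deriv_le v) (abs_nonneg _) hL0
  have hP : |deriv σ (preact θ l z) * deriv σ (preact θ l z') -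
      deriv σ (preact θ₀ l z) * deriv σ (preact θ₀ l z')| ≤ 2 * L * L₂ * (M + 1) * H := by
    have e : deriv σ (preact θ l z) * deriv σ (preact θ l z') -
        deriv σ (preact θ₀ l z) * deriv σ (preact θ₀ l z') =
        (deriv σ (preact θ l z) - deriv σ (preact θ₀ l z)) * deriv σ (preact θ l z') +
        deriv σ (preact θ₀ l z) * (deriv σ (preact θ l z') - deriv σ (preact θ₀ l z')) := by ring
    rw [e]
    calc _ ≤ L₂ * ((M + 1) * H) * L + L * (L₂ * ((M + 1) * H)) := by
          refine (abs_add_le _ _).trans (add_le_add ?_ ?_)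
          · rw [abs_mul]
            exact mul_le_mul (hds' z hz) (hσ.deriv_le _) (abs_nonneg _) (by positivity)
          · rw [abs_mul]
            exact mul_le_mul (hσ.deriv_le _) (hds' z' hz') (abs_nonneg _) hL0
      _ = _ := by ring
  have hII : |Param.a θ l ^ 2 * (deriv σ (preact θ l z) * deriv σ (preact θ l z')) -
      Param.a θ₀ l ^ 2 * (deriv σ (preact θ₀ l z) * deriv σ (preact θ₀ l z'))| ≤
      (4 * L ^ 2 + 2 * L * L₂ * (M + 1)) * (B ^ 2 * Γ ^ 2 * H) := by
    have e : Param.a θ l ^ 2 * (deriv σ (preact θ l z) * deriv σ (preact θ l z')) -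
      Param.a θ₀ l ^ 2 * (deriv σ (preact θ₀ l z) * deriv σ (preact θ₀ l z')) =
      (Param.a θ l ^ 2 - Param.a θ₀ l ^ 2) *
        (deriv σ (preact θ l z) * deriv σ (preact θ l z')) +
      Param.a θ₀ l ^ 2 * (deriv σ (preact θ l z) * deriv σ (preact θ l z') -
        deriv σ (preact θ₀ l z) * deriv σ (preact θ₀ l z')) := by ring
    rw [e]
    calc _ ≤ H * (4 * B * Γ ^ 2) * L ^ 2 + B ^ 2 * (2 * L * L₂ * (M + 1) * H) := by
          refine (abs_add_le _ _).trans (add_le_add ?_ ?_)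
          · rw [abs_mul]
            exact mul_le_mul hA (hda _ _) (abs_nonneg _) (by positivity)
          · rw [abs_mul]
            refine mul_le_mul ?_ hP (abs_nonneg _) (by positivity)
            rw [abs_of_nonneg (sq_nonneg _)]
            exact sq_le_sq' (abs_le.1 ha).1 (abs_le.1 ha).2
      _ = H * (4 * (B * 1) * Γ ^ 2) * L ^ 2 + B ^ 2 * (2 * L * L₂ * (M + 1) * (H * 1)) := by ring
      _ ≤ H * (4 * (B * B) * Γ ^ 2) * L ^ 2 + B ^ 2 * (2 * L * L₂ * (M + 1) * (H * Γ ^ 2)) := by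
          gcongr
      _ = _ := by ring
  have hin := abs_one_add_inner_le hz hz'
  have e : kernelTerm σ θ l z z' - kernelTerm σ θ₀ l z z' =
      (σ (preact θ l z) * σ (preact θ l z') - σ (preact θ₀ l z) * σ (preact θ₀ l z')) +
      (Param.a θ l ^ 2 * (deriv σ (preact θ l z) * deriv σ (preact θ l z')) -
      Param.a θ₀ l ^ 2 * (deriv σ (preact θ₀ l z) * deriv σ (preact θ₀ l z'))) *
        (1 + inner ℝ z z') := by
    simp only [kernelTerm]; ring
  rw [e]
  calc _ ≤ 16 * S ^ 2 * (D₁ * B * Γ ^ 2 * H) +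
        (4 * L ^ 2 + 2 * L * L₂ * (M + 1)) * (B ^ 2 * Γ ^ 2 * H) * (1 + M ^ 2) := by
        refine (abs_add_le _ _).trans (add_le_add hI ?_)
        rw [abs_mul]
        exact mul_le_mul hII hin (abs_nonneg _) (by positivity)
    _ = 16 * S ^ 2 * (D₁ * (B * 1) * Γ ^ 2 * H) +
        (4 * L ^ 2 + 2 * L * L₂ * (M + 1)) * (1 * (B ^ 2 * Γ ^ 2 * H)) * (1 + M ^ 2) := by ring
    _ ≤ 16 * S ^ 2 * (D₁ * (B * B) * Γ ^ 2 * H) +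
        (4 * L ^ 2 + 2 * L * L₂ * (M + 1)) * (D₁ * (B ^ 2 * Γ ^ 2 * H)) * (1 + M ^ 2) := by
        gcongr
    _ = _ := by ring

variable [Fintype ι]

theorem abs_average_sub_le [Nonempty ι] {f g : ι → ℝ} {C : ℝ} (h : ∀ l, |f l - g l| ≤ C) :
    |1 / (Fintype.card ι : ℝ) * ∑ l, f l - 1 / (Fintype.card ι : ℝ) * ∑ l, g l| ≤ C := by
  have hN : (0 : ℝ) < Fintype.card ι := by exact_mod_cast Fintype.card_pos
  rw [← mul_sub, ← Finset.sum_sub_distrib, abs_mul, abs_of_pos (by positivity),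
    one_div, inv_mul_le_iff₀ hN]
  calc |∑ l, (f l - g l)| ≤ ∑ l, |f l - g l| := Finset.abs_sum_le_sum_abs _ _
    _ ≤ ∑ _l : ι, C := Finset.sum_le_sum fun l _ => h l
    _ = _ := by simp

/-- Deviation of the kernel along the flow, for an initial parameter whose units are of moderate
size and whose kernel is close to `kinf`. The condition on the horizon `T` keeps the exponential
factor in the drift of every unit below `Γ`. The dimension enters through `D₁` alone, the size of
the preactivations at arbitrary points of the ball relative to their size on the data. -/
theorem deviationBound_of_init {σ : ℝ → ℝ} {M L L₂ S : ℝ} (hσ : ActivationBounds σ M L L₂ S)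
    (hn : 1 ≤ n) {x : Fin n → Input d} (hx : ∀ i, ‖x i‖ ≤ M) (y : Fin n → ℝ) {T Γ : ℝ}
    (hΓ : 1 < Γ) {kinf : Input d → Input d → ℝ} {θ₀ : Param ι d} {m : ℕ}
    (hm : 1 ≤ m) (hmN : m ≤ Fintype.card ι) {B D₁ ε₀ : ℝ} (hB : 1 ≤ B) (hD : 1 ≤ D₁)
    (ha : ∀ l, |Param.a θ₀ l| ≤ B) (hv : ∀ l, normalizedNorm (fun i => preact θ₀ l (x i)) ≤ B)
    (hu : ∀ l z, ‖z‖ ≤ M → |preact θ₀ l z| ≤ D₁ * B)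
    (hT : 2 * S * normalizedNorm (residual σ x y θ₀) * T / √(m : ℝ) ≤ Real.log Γ)
    (hK : ∀ z z' : Input d, ‖z‖ ≤ M → ‖z'‖ ≤ M → |ntk σ θ₀ z z' - kinf z z'| ≤ ε₀) {E : ℝ → ℝ}
    (hE : ∀ t ∈ Icc 0 T, ε₀ +
      3 * S * (16 * S ^ 2 + (1 + M ^ 2) * (4 * L ^ 2 + 2 * L * L₂ * (M + 1))) *
        (t * Γ ^ 3 * (normalizedNorm (residual σ x y θ₀) / √(m : ℝ)) * (D₁ * B ^ 3)) ≤ E t) :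
    DeviationBound σ M x y T kinf θ₀ E := by
  intro γ hγ hγ0 t ht
  subst hγ0
  set R := normalizedNorm (residual σ x y (γ 0)) with hR
  have hR0 : 0 ≤ R := Real.sqrt_nonneg _
  have hS0 := hσ.S_nonneg
  have hL0 := hσ.L_nonneg
  have hL20 := hσ.L₂_nonneg
  have hM0 := hσ.M_nonneg
  have ht0 : 0 ≤ t := ht.1
  have hm0 : (0 : ℝ) < m := by exact_mod_cast hm
  have hN : (m : ℝ) ≤ Fintype.card ι := by exact_mod_cast hmN
  have : Nonempty ι := Fintype.card_pos_iff.1 (hm.trans hmN)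
  have hq : R / √(Fintype.card ι : ℝ) ≤ R / √(m : ℝ) := by gcongr
  set q := R / √(m : ℝ) with hqdef
  have hq0 : 0 ≤ q := by positivity
  have hexp : 2 * (S * q) * t ≤ Real.log Γ := by
    refine le_trans ?_ hT
    have : 2 * S * R * T / √(m : ℝ) = 2 * (S * q) * T := by rw [hqdef]; ring
    rw [this]
    gcongr
    exact ht.2
  have hΓ0 : 0 < Γ := zero_lt_one.trans hΓ
  have hexpΓ : Real.exp (2 * (S * q) * t) ≤ Γ := by
    rw [← Real.exp_log hΓ0]
    exact Real.exp_le_exp.2 hexp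
  have hlog : Real.log Γ ≤ Γ := (Real.log_le_sub_one_of_pos hΓ0).trans (by linarith)
  set H := 3 * S * B * Γ * (t * q) with hHdef
  have hdrift : ∀ l, ‖unitCLM l (γ t) - unitCLM l (γ 0)‖ ≤ H := by
    intro l
    refine (hγ.norm_unitCLM_sub_le hσ hn hx l ht).trans ?_
    have hv0 : 0 ≤ normalizedNorm fun i => preact (γ 0) l (x i) := Real.sqrt_nonneg _
    calc _ ≤ S * q * (3 * B) * t * Γ := by
          rw [← hR]
          refine mul_le_mul ?_ (le_trans (Real.exp_le_exp.2 (by gcongr)) hexpΓ)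
            (Real.exp_pos _).le (by positivity)
          gcongr
          linarith [ha l, hv l]
      _ = _ := by rw [hHdef]; ring
  have hHΓ : H ≤ 2 * B * Γ ^ 2 := by
    have h1 : S * (t * q) ≤ Γ / 2 := by nlinarith
    calc H = 3 * B * Γ * (S * (t * q)) := by rw [hHdef]; ring
      _ ≤ 3 * B * Γ * (Γ / 2) := by gcongr
      _ ≤ _ := by nlinarith [mul_pos (zero_lt_one.trans_le hB) (pow_pos hΓ0 2)]
  have hker : ∀ z z' : Input d, ‖z‖ ≤ M → ‖z'‖ ≤ M → |ntk σ (γ t) z z' - kinf z z'| ≤ E t := by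
    intro z z' hz hz'
    have h1 : |ntk σ (γ t) z z' - ntk σ (γ 0) z z'| ≤
        (16 * S ^ 2 + (1 + M ^ 2) * (4 * L ^ 2 + 2 * L * L₂ * (M + 1))) *
          (D₁ * B ^ 2 * Γ ^ 2 * H) := by
      rw [ntk_eq hσ.differentiable, ntk_eq hσ.differentiable, add_sub_add_left_eq_sub]
      exact abs_average_sub_le fun l => abs_kernelTerm_sub_le hσ hz hz' hB hD hΓ.le (ha l)
        (hu l z hz) (hu l z' hz') (hdrift l) hHΓ
    have h2 := abs_sub_le (ntk σ (γ t) z z') (ntk σ (γ 0) z z') (kinf z z')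
    have h3 := hK z z' hz hz'
    refine le_trans ?_ (hE t ht)
    refine (h2.trans (add_le_add h1 h3)).trans (le_of_eq ?_)
    rw [hHdef]; ring
  have hE0 : 0 ≤ E t := by
    have h0 : ‖(0 : Input d)‖ ≤ M := by simpa using hM0
    exact (abs_nonneg _).trans (hker 0 0 h0 h0)
  have hn0 : (0 : ℝ) < n := by exact_mod_cast hn
  refine ⟨hker, opNorm_le_of_abs_le hE0 fun i j => ?_, ?_⟩
  · rw [Matrix.sub_apply, abs_sub_comm]
    exact hker _ _ (hx i) (hx j)
  · have : E t = n * (1 / (n : ℝ) * E t) := by field_simp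
    rw [this]
    refine opNorm_le_of_abs_le (by positivity) fun i j => ?_
    rw [← smul_sub, Matrix.smul_apply, smul_eq_mul, abs_mul, abs_of_pos (by positivity)]
    refine mul_le_mul_of_nonneg_left ?_ (by positivity)
    rw [Matrix.sub_apply, abs_sub_comm]
    exact hker _ _ (hx i) (hx j)

end Deterministic

/-! ### Random blocks of hidden units -/

section ProductLaw

variable {I : Type} [Fintype I] {ν : I → Measure ℝ} {K : ℝ}

theorem lintegral_exp_sq_coord_le (hν : ∀ i, IsInitLaw K (ν i)) (hK : 1 ≤ K) (i : I) :
    ∫⁻ ω, ENNReal.ofReal (Real.exp (ω i ^ 2 / (2 * K) ^ 2)) ∂(Measure.pi ν) ≤ 2 := by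
  have := fun i => (hν i).isProb
  have h := (measurePreserving_eval ν i).lintegral_comp
    (f := fun u : ℝ => ENNReal.ofReal (Real.exp (u ^ 2 / (2 * K) ^ 2))) (by fun_prop)
  exact h.le.trans ((hν i).lintegral_exp_sq_le hK)

theorem hasSubgaussianMGF_coord (hν : ∀ i, IsInitLaw K (ν i)) (hK : 1 ≤ K) (i : I) :
    HasSubgaussianMGF (fun ω : I → ℝ => ω i) (2 * (2 * K).toNNReal ^ 2) (Measure.pi ν) := by
  have := fun i => (hν i).isProb
  have h2K : ((2 * K).toNNReal : ℝ) = 2 * K := Real.coe_toNNReal _ (by linarith)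
  refine HasSubgaussianMGF.of_map (Y := fun ω : I → ℝ => ω i) (X := id)
    (measurable_pi_apply i).aemeasurable ?_
  rw [(measurePreserving_eval ν i).map_eq]
  refine hasSubgaussianMGF_id_of_lintegral_exp_sq_le (Real.toNNReal_pos.2 (by linarith))
    (hν i).mean_zero ?_
  rw [h2K]
  exact (hν i).lintegral_exp_sq_le hK

/-- Linear combinations of distinct coordinates are subgaussian, with a constant depending only on
the Euclidean norm of the coefficients. -/
theorem hasSubgaussianMGF_linear (hν : ∀ i, IsInitLaw K (ν i)) (hK : 1 ≤ K) {κ : Type} [Fintype κ]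
    {e : κ → I} (he : Function.Injective e) (c : κ → ℝ) :
    HasSubgaussianMGF (fun ω : I → ℝ => ∑ k, c k * ω (e k))
      (∑ k, (c k ^ 2).toNNReal * (2 * (2 * K).toNNReal ^ 2)) (Measure.pi ν) := by
  have := fun i => (hν i).isProb
  have hind : iIndepFun (fun i (ω : I → ℝ) => ω i) (Measure.pi ν) :=
    iIndepFun_pi (X := fun _ x => x) fun i => aemeasurable_id
  refine HasSubgaussianMGF.sum_of_iIndepFun
    ((hind.precomp he).comp (fun k x => c k * x) fun k => by fun_prop) fun k _ => ?_
  rw [Real.toNNReal_of_nonneg (sq_nonneg (c k))]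
  exact (hasSubgaussianMGF_coord hν hK (e k)).const_mul (c k)

end ProductLaw

section Blocks

variable {m d : ℕ}

/-- Positions of the parameters of the hidden unit `l` among all parameters. -/
def unitIdx (l : Fin m) : Unit ⊕ Fin d ⊕ Unit → ParamIdx (Fin m) d :=
  Sum.elim (fun _ => Sum.inl l)
    (Sum.elim (fun j => Sum.inr (Sum.inl (l, j))) fun _ => Sum.inr (Sum.inr (Sum.inl l)))

theorem unitIdx_injective :
    Function.Injective (fun p : (_ : Fin m) × (Unit ⊕ Fin d ⊕ Unit) => unitIdx p.1 p.2) := by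
  rintro ⟨l, k⟩ ⟨l', k'⟩ h
  rcases k with k | k | k <;> rcases k' with k' | k' | k' <;> simp_all [unitIdx]

/-- The random numbers `(a_l, w_l, b_l)` of the hidden unit `l`. -/
def unitBlock (l : Fin m) (ω : ParamIdx (Fin m) d → ℝ) : Unit ⊕ Fin d ⊕ Unit → ℝ :=
  fun k => ω (unitIdx l k)

/-- The preactivation `⟨w, z⟩ + b` as a function of the block `(a, w, b)`. -/
noncomputable def blockPreact (v : Unit ⊕ Fin d ⊕ Unit → ℝ) (z : Input d) : ℝ :=
  ∑ j, v (Sum.inr (Sum.inl j)) * z j + v (Sum.inr (Sum.inr ()))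

/-- The outer weight `a` of the block `(a, w, b)`. -/
def blockOuter (v : Unit ⊕ Fin d ⊕ Unit → ℝ) : ℝ := v (Sum.inl ())

/-- The size `1 + a² + ‖w‖² + b²` of the block `(a, w, b)`. -/
noncomputable def blockSize (v : Unit ⊕ Fin d ⊕ Unit → ℝ) : ℝ := 1 + ∑ k, v k ^ 2

theorem preact_standardInit (l : Fin m) (ω : ParamIdx (Fin m) d → ℝ) (z : Input d) :
    preact (standardInit ω) l z = blockPreact (unitBlock l ω) z := rfl

@[fun_prop]
theorem measurable_unitBlock (l : Fin m) : Measurable (unitBlock (d := d) l) := by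
  unfold unitBlock; fun_prop

@[fun_prop]
theorem measurable_blockPreact (z : Input d) : Measurable fun v => blockPreact v z := by
  unfold blockPreact; fun_prop

@[fun_prop]
theorem measurable_blockOuter : Measurable (blockOuter (d := d)) := by
  unfold blockOuter; fun_prop

@[fun_prop]
theorem measurable_blockSize : Measurable (blockSize (d := d)) := by
  unfold blockSize; fun_prop

theorem one_le_blockSize (v : Unit ⊕ Fin d ⊕ Unit → ℝ) : 1 ≤ blockSize v :=
  le_add_of_nonneg_right (Finset.sum_nonneg fun _ _ => sq_nonneg _)

theorem blockSize_eq (v : Unit ⊕ Fin d ⊕ Unit → ℝ) :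
    blockSize v = 1 + (blockOuter v ^ 2 + (∑ j : Fin d, v (Sum.inr (Sum.inl j)) ^ 2 +
      v (Sum.inr (Sum.inr ())) ^ 2)) := by
  rw [blockSize, Fintype.sum_sum_type, Fintype.sum_sum_type]
  simp [blockOuter]

theorem sum_mul_abs_le (w : Fin d → ℝ) (z : Input d) :
    |∑ j, w j * z j| ≤ √(∑ j, w j ^ 2) * ‖z‖ := by
  rw [EuclideanSpace.norm_eq, ← Real.sqrt_mul (by positivity)]
  refine Real.abs_le_sqrt ((Finset.sum_mul_sq_le_sq_mul_sq _ _ _).trans (le_of_eq ?_))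
  simp

variable {ν : ParamIdx (Fin m) d → Measure ℝ} {K : ℝ}

theorem iIndepFun_unitBlock (hν : ∀ i, IsInitLaw K (ν i)) :
    iIndepFun (fun (l : Fin m) (ω : ParamIdx (Fin m) d → ℝ) => unitBlock l ω) (Measure.pi ν) := by
  have := fun i => (hν i).isProb
  exact iIndepFun_blocks ν unitIdx unitIdx_injective

/-- The exponent for which squares of preactivations on the ball of radius `M` have exponential
moments. -/
noncomputable def sqExponent (K M : ℝ) : ℝ := 1 / (32 * K ^ 2 * (M ^ 2 + 1))

theorem sqExponent_pos {K M : ℝ} (hK : 1 ≤ K) : 0 < sqExponent K M := by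
  unfold sqExponent; positivity

theorem sqExponent_le {K M : ℝ} (hK : 1 ≤ K) : sqExponent K M ≤ 1 / 32 := by
  unfold sqExponent
  refine one_div_le_one_div_of_le (by norm_num) ?_
  have : 1 ≤ K ^ 2 := one_le_pow₀ hK
  nlinarith [mul_nonneg (sq_nonneg K) (sq_nonneg M)]

theorem sqExponent_le_coord {K M : ℝ} (hK : 1 ≤ K) : sqExponent K M ≤ 1 / (2 * K) ^ 2 := by
  unfold sqExponent
  refine one_div_le_one_div_of_le (by positivity) ?_
  nlinarith [mul_nonneg (sq_nonneg K) (sq_nonneg M), sq_nonneg K]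

theorem lintegral_exp_sq_blockPreact_le (hν : ∀ i, IsInitLaw K (ν i)) (hK : 1 ≤ K) {M : ℝ}
    (l : Fin m) {z : Input d} (hz : ‖z‖ ≤ M) :
    ∫⁻ ω, ENNReal.ofReal (Real.exp (sqExponent K M * blockPreact (unitBlock l ω) z ^ 2))
      ∂(Measure.pi ν) ≤ 2 := by
  have := fun i => (hν i).isProb
  have he : Function.Injective fun k : Fin d ⊕ Unit => unitIdx l (Sum.inr k) := fun k k' h => by
    have := unitIdx_injective (a₁ := ⟨l, Sum.inr k⟩) (a₂ := ⟨l, Sum.inr k'⟩) h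
    simpa using this
  have h := hasSubgaussianMGF_linear hν hK he (Sum.elim z fun _ => 1)
  have hX : (fun ω : ParamIdx (Fin m) d → ℝ => ∑ k, Sum.elim z (fun _ => 1) k *
      ω (unitIdx l (Sum.inr k))) = fun ω => blockPreact (unitBlock l ω) z := by
    ext ω
    rw [Fintype.sum_sum_type]
    simp [blockPreact, unitBlock, mul_comm]
  rw [hX] at h
  refine lintegral_exp_mul_sq_le_of_hasSubgaussianMGF (by fun_prop) h
    (sqExponent_pos hK).le ?_
  have h2K : ((2 * K).toNNReal : ℝ) = 2 * K := Real.coe_toNNReal _ (by linarith)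
  have hz2 : ‖z‖ ^ 2 ≤ M ^ 2 := by gcongr
  rw [EuclideanSpace.real_norm_sq_eq] at hz2
  push_cast
  rw [h2K, ← Finset.sum_mul, Fintype.sum_sum_type]
  simp only [Real.coe_toNNReal _ (sq_nonneg _), Sum.elim_inl, Sum.elim_inr, Finset.univ_unique,
    Finset.sum_const, Finset.card_singleton, one_smul, one_pow, Real.toNNReal_one, NNReal.coe_one]
  unfold sqExponent
  rw [one_div_mul_eq_div, div_le_iff₀ (by positivity)]
  nlinarith [mul_le_mul_of_nonneg_left hz2 (sq_nonneg K)]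

theorem lintegral_exp_sq_blockOuter_le (hν : ∀ i, IsInitLaw K (ν i)) (hK : 1 ≤ K) {M : ℝ}
    (l : Fin m) :
    ∫⁻ ω, ENNReal.ofReal (Real.exp (sqExponent K M * blockOuter (unitBlock l ω) ^ 2))
      ∂(Measure.pi ν) ≤ 2 := by
  refine le_trans (lintegral_mono fun ω => ENNReal.ofReal_le_ofReal (Real.exp_le_exp.2 ?_))
    (lintegral_exp_sq_coord_le hν hK (Sum.inl l))
  rw [div_eq_inv_mul, ← one_div]
  exact mul_le_mul_of_nonneg_right (sqExponent_le_coord hK) (sq_nonneg _)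

/-- The empirical second moment of the preactivations of one unit on the data has an exponential
moment that does not depend on the number of data points. -/
theorem lintegral_exp_average_sq_blockPreact_le (hν : ∀ i, IsInitLaw K (ν i)) (hK : 1 ≤ K)
    {M : ℝ} (l : Fin m) {n : ℕ} (hn : 1 ≤ n) {x : Fin n → Input d} (hx : ∀ i, ‖x i‖ ≤ M) :
    ∫⁻ ω, ENNReal.ofReal (Real.exp (sqExponent K M *
      (1 / (n : ℝ) * ∑ i, blockPreact (unitBlock l ω) (x i) ^ 2))) ∂(Measure.pi ν) ≤ 2 := by
  have hn0 : (0 : ℝ) < n := by exact_mod_cast hn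
  have hconv : ∀ ω, ENNReal.ofReal (Real.exp (sqExponent K M *
      (1 / (n : ℝ) * ∑ i, blockPreact (unitBlock l ω) (x i) ^ 2))) ≤
      ∑ i, ENNReal.ofReal (1 / (n : ℝ)) *
        ENNReal.ofReal (Real.exp (sqExponent K M * blockPreact (unitBlock l ω) (x i) ^ 2)) := by
    intro ω
    have h := convexOn_exp.map_sum_le (t := Finset.univ) (w := fun _ : Fin n => 1 / (n : ℝ))
      (p := fun i => sqExponent K M * blockPreact (unitBlock l ω) (x i) ^ 2)
      (fun _ _ => by positivity) (by simp [hn0.ne']) fun _ _ => mem_univ _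
    simp only [smul_eq_mul] at h
    have e : sqExponent K M * (1 / (n : ℝ) * ∑ i, blockPreact (unitBlock l ω) (x i) ^ 2) =
        ∑ i, 1 / (n : ℝ) * (sqExponent K M * blockPreact (unitBlock l ω) (x i) ^ 2) := by
      simp only [Finset.mul_sum]
      exact Finset.sum_congr rfl fun i _ => by ring
    rw [e]
    refine (ENNReal.ofReal_le_ofReal h).trans (le_of_eq ?_)
    rw [ENNReal.ofReal_sum_of_nonneg fun i _ => by positivity]
    exact Finset.sum_congr rfl fun i _ => ENNReal.ofReal_mul (by positivity)
  refine (lintegral_mono hconv).trans ?_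
  rw [lintegral_finsetSum _ fun i _ => by fun_prop]
  calc _ ≤ ∑ _i : Fin n, ENNReal.ofReal (1 / (n : ℝ)) * 2 := by
        refine Finset.sum_le_sum fun i _ => ?_
        rw [lintegral_const_mul _ (by fun_prop)]
        gcongr
        exact lintegral_exp_sq_blockPreact_le hν hK l (hx i)
    _ = 2 := by
        rw [Finset.sum_const, Finset.card_univ, Fintype.card_fin, nsmul_eq_mul, ← mul_assoc,
          one_div, ENNReal.ofReal_inv_of_pos hn0, ENNReal.ofReal_natCast,
          ENNReal.mul_inv_cancel (by simpa using hn0.ne') (by simp), one_mul]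

/-- Exponential moments of variables that are at most quadratic in the outer weight and two
preactivations. -/
theorem lintegral_exp_abs_le_of_quadratic (hν : ∀ i, IsInitLaw K (ν i)) (hK : 1 ≤ K) {M Cg : ℝ}
    (hC : 1 ≤ Cg) (l : Fin m) {z z' : Input d} (hz : ‖z‖ ≤ M) (hz' : ‖z'‖ ≤ M)
    {Y : (ParamIdx (Fin m) d → ℝ) → ℝ}
    (hY : ∀ ω, |Y ω| ≤ Cg * (2 + blockPreact (unitBlock l ω) z ^ 2 +
      blockPreact (unitBlock l ω) z' ^ 2 + blockOuter (unitBlock l ω) ^ 2)) :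
    ∫⁻ ω, ENNReal.ofReal (Real.exp (sqExponent K M / (3 * Cg) * |Y ω|)) ∂(Measure.pi ν) ≤
      ENNReal.ofReal 4 := by
  set s := sqExponent K M with hs
  have hs0 : 0 < s := sqExponent_pos hK
  have hs1 : s ≤ 1 / 32 := sqExponent_le hK
  have he : Real.exp (2 * s / 3) ≤ 2 := by
    have h1 := Real.exp_one_lt_d9
    have h2 : Real.exp (2 * s / 3) ≤ Real.exp (1 / 2) := Real.exp_le_exp.2 (by linarith)
    have h3 : Real.exp (1 / 2) * Real.exp (1 / 2) = Real.exp 1 := by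
      rw [← Real.exp_add]; norm_num
    nlinarith [Real.exp_pos (1 / 2)]
  have hpt : ∀ ω, ENNReal.ofReal (Real.exp (s / (3 * Cg) * |Y ω|)) ≤
      ENNReal.ofReal (2 / 3) *
        (ENNReal.ofReal (Real.exp (s * blockPreact (unitBlock l ω) z ^ 2)) +
        (ENNReal.ofReal (Real.exp (s * blockPreact (unitBlock l ω) z' ^ 2)) +
        ENNReal.ofReal (Real.exp (s * blockOuter (unitBlock l ω) ^ 2)))) := by
    intro ω
    set p := s * blockPreact (unitBlock l ω) z ^ 2
    set q := s * blockPreact (unitBlock l ω) z' ^ 2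
    set r := s * blockOuter (unitBlock l ω) ^ 2
    have h1 : s / (3 * Cg) * |Y ω| ≤ 2 * s / 3 + (p + q + r) / 3 := by
      calc s / (3 * Cg) * |Y ω| ≤ s / (3 * Cg) * (Cg * (2 + blockPreact (unitBlock l ω) z ^ 2 +
            blockPreact (unitBlock l ω) z' ^ 2 + blockOuter (unitBlock l ω) ^ 2)) :=
            mul_le_mul_of_nonneg_left (hY ω) (by positivity)
        _ = 2 * s / 3 + (p + q + r) / 3 := by field_simp; ring
    have h2 : Real.exp ((p + q + r) / 3) ≤ 1 / 3 * (Real.exp p + (Real.exp q + Real.exp r)) := by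
      have h := convexOn_exp.map_sum_le (t := Finset.univ) (w := fun _ : Fin 3 => 1 / (3 : ℝ))
        (p := ![p, q, r]) (fun _ _ => by positivity) (by simp) fun _ _ => mem_univ _
      simp only [smul_eq_mul, Fin.sum_univ_three, Matrix.cons_val_zero, Matrix.cons_val_one,
        Matrix.cons_val] at h
      refine le_trans (le_of_eq ?_) (h.trans (le_of_eq ?_)) <;> ring_nf
    rw [← ENNReal.ofReal_add (Real.exp_pos _).le (Real.exp_pos _).le,
      ← ENNReal.ofReal_add (Real.exp_pos _).le (by positivity),
      ← ENNReal.ofReal_mul (by norm_num)]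
    refine ENNReal.ofReal_le_ofReal ?_
    calc Real.exp (s / (3 * Cg) * |Y ω|) ≤ Real.exp (2 * s / 3 + (p + q + r) / 3) :=
          Real.exp_le_exp.2 h1
      _ = Real.exp (2 * s / 3) * Real.exp ((p + q + r) / 3) := Real.exp_add _ _
      _ ≤ 2 * (1 / 3 * (Real.exp p + (Real.exp q + Real.exp r))) :=
          mul_le_mul he h2 (Real.exp_pos _).le zero_le_two
      _ = _ := by ring
  refine (lintegral_mono hpt).trans ?_
  rw [lintegral_const_mul _ (by fun_prop), lintegral_add_left (by fun_prop),
    lintegral_add_left (by fun_prop)]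
  calc _ ≤ ENNReal.ofReal (2 / 3) * (2 + (2 + 2)) := by
        gcongr
        · exact lintegral_exp_sq_blockPreact_le hν hK l hz
        · exact lintegral_exp_sq_blockPreact_le hν hK l hz'
        · exact lintegral_exp_sq_blockOuter_le hν hK l
    _ = ENNReal.ofReal 4 := by
        rw [show (2 + (2 + 2) : ℝ≥0∞) = ENNReal.ofReal 6 by norm_num,
          ← ENNReal.ofReal_mul (by norm_num)]
        norm_num

/-- The size of a block has a second moment of order `d²`. -/
theorem integral_blockSize_sq_le (hν : ∀ i, IsInitLaw K (ν i)) (hK : 1 ≤ K) (l : Fin m) :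
    Integrable (fun ω => blockSize (unitBlock l ω) ^ 2) (Measure.pi ν) ∧
    ∫ ω, blockSize (unitBlock l ω) ^ 2 ∂(Measure.pi ν) ≤ 2 + 128 * K ^ 4 * (d + 2) ^ 2 := by
  have := fun i => (hν i).isProb
  have hE : ∀ i, Integrable (fun ω : ParamIdx (Fin m) d → ℝ =>
      Real.exp (ω i ^ 2 / (2 * K) ^ 2)) (Measure.pi ν) := fun i =>
    integrable_exp_of_lintegral_le (A := 2) (by fun_prop)
      (by simpa using lintegral_exp_sq_coord_le hν hK i)
  have hE2 : ∀ i, ∫ ω : ParamIdx (Fin m) d → ℝ,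
      Real.exp (ω i ^ 2 / (2 * K) ^ 2) ∂(Measure.pi ν) ≤ 2 := fun i =>
    integral_exp_le_of_lintegral_le (by fun_prop) zero_le_two
      (by simpa using lintegral_exp_sq_coord_le hν hK i)
  have hpt : ∀ ω : ParamIdx (Fin m) d → ℝ, blockSize (unitBlock l ω) ^ 2 ≤
      2 + ∑ k, 2 * (d + 2) * (32 * K ^ 4) * Real.exp (ω (unitIdx l k) ^ 2 / (2 * K) ^ 2) := by
    intro ω
    have h1 : (∑ k, unitBlock l ω k ^ 2) ^ 2 ≤ (d + 2) * ∑ k, (unitBlock l ω k ^ 2) ^ 2 := by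
      have := sq_sum_le_card_mul_sum_sq (s := Finset.univ) (f := fun k => unitBlock l ω k ^ 2)
      refine this.trans (le_of_eq ?_)
      simp only [Finset.card_univ, Fintype.card_sum, Fintype.card_unit, Fintype.card_fin]
      push_cast; ring
    have h2 : ∀ k, (unitBlock l ω k ^ 2) ^ 2 ≤
        32 * K ^ 4 * Real.exp (ω (unitIdx l k) ^ 2 / (2 * K) ^ 2) := by
      intro k
      have h3 := Real.quadratic_le_exp_of_nonneg (x := ω (unitIdx l k) ^ 2 / (2 * K) ^ 2)
        (by positivity)
      have h4 : (unitBlock l ω k ^ 2) ^ 2 =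
          32 * K ^ 4 * ((ω (unitIdx l k) ^ 2 / (2 * K) ^ 2) ^ 2 / 2) := by
        simp only [unitBlock]; field_simp; ring
      rw [h4]
      have h5 : 0 ≤ ω (unitIdx l k) ^ 2 / (2 * K) ^ 2 := by positivity
      gcongr
      linarith
    calc blockSize (unitBlock l ω) ^ 2 ≤ 2 + 2 * (∑ k, unitBlock l ω k ^ 2) ^ 2 := by
          rw [blockSize]
          nlinarith [sq_nonneg (1 - ∑ k, unitBlock l ω k ^ 2)]
      _ ≤ 2 + 2 * ((d + 2) * ∑ k, (unitBlock l ω k ^ 2) ^ 2) := by gcongr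
      _ ≤ 2 + 2 * ((d + 2) * ∑ k, 32 * K ^ 4 *
            Real.exp (ω (unitIdx l k) ^ 2 / (2 * K) ^ 2)) := by
          gcongr with k
          exact h2 k
      _ = _ := by
          simp only [Finset.mul_sum]
          congr 1
          exact Finset.sum_congr rfl fun k _ => by ring
  have hint : Integrable (fun ω : ParamIdx (Fin m) d → ℝ => 2 + ∑ k, 2 * (d + 2) * (32 * K ^ 4) *
      Real.exp (ω (unitIdx l k) ^ 2 / (2 * K) ^ 2)) (Measure.pi ν) :=
    (integrable_const _).add (integrable_finsetSum _ fun k _ => (hE _).const_mul _)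
  have hI : Integrable (fun ω => blockSize (unitBlock l ω) ^ 2) (Measure.pi ν) :=
    hint.mono' (Measurable.aestronglyMeasurable (by fun_prop)) (ae_of_all _ fun ω => by
      rw [Real.norm_of_nonneg (sq_nonneg _)]; exact hpt ω)
  refine ⟨hI, (integral_mono hI hint hpt).trans ?_⟩
  rw [integral_add (integrable_const _) (integrable_finsetSum _ fun k _ => (hE _).const_mul _),
    integral_finsetSum _ fun k _ => (hE _).const_mul _]
  simp only [integral_const_mul]
  calc _ ≤ 2 + ∑ _k : Unit ⊕ Fin d ⊕ Unit, 2 * ((d : ℝ) + 2) * (32 * K ^ 4) * 2 := by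
        refine add_le_add (by simp) (Finset.sum_le_sum fun k _ => ?_)
        exact mul_le_mul_of_nonneg_left (hE2 _) (by positivity)
    _ = _ := by
        simp only [Finset.sum_const, Finset.card_univ, Fintype.card_sum, Fintype.card_unit,
          Fintype.card_fin, nsmul_eq_mul]
        push_cast; ring

end Blocks

/-! ### Uniform concentration of averages over the units -/

section Features

variable {m d : ℕ}

/-- A family of functions of the block `(a, w, b)` of one hidden unit, indexed by pairs of inputs
in the ball of radius `M`, with subexponential size and a Lipschitz dependence on the inputs. -/
structure UnitFeature (M Cg CL : ℝ) (G : Input d → Input d → (Unit ⊕ Fin d ⊕ Unit → ℝ) → ℝ) :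
    Prop where
  measurable : ∀ z z', Measurable (G z z')
  quadratic : ∀ z z' v, ‖z‖ ≤ M → ‖z'‖ ≤ M →
    |G z z' v| ≤ Cg * (2 + blockPreact v z ^ 2 + blockPreact v z' ^ 2 + blockOuter v ^ 2)
  lipschitz : ∀ z z' w w' v, ‖z‖ ≤ M → ‖z'‖ ≤ M → ‖w‖ ≤ M → ‖w'‖ ≤ M →
    |G z z' v - G w w' v| ≤ CL * blockSize v ^ 2 * (‖z - w‖ + ‖z' - w'‖)

/-- The kernel term of one unit as a function of its block. -/
noncomputable def kernelFeature (σ : ℝ → ℝ) (z z' : Input d) (v : Unit ⊕ Fin d ⊕ Unit → ℝ) : ℝ :=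
  σ (blockPreact v z) * σ (blockPreact v z') +
    blockOuter v ^ 2 * (deriv σ (blockPreact v z) * deriv σ (blockPreact v z')) *
      (1 + inner ℝ z z')

/-- The output of one unit at the first of two inputs, as a function of its block. The second input
is a dummy, so that outputs and kernel terms are unit features alike. -/
noncomputable def outputFeature (σ : ℝ → ℝ) (z _z' : Input d) (v : Unit ⊕ Fin d ⊕ Unit → ℝ) : ℝ :=
  blockOuter v * σ (blockPreact v z)

/-- Size constant of the two unit features. -/
noncomputable def featureSize (M L S : ℝ) : ℝ := S ^ 2 + L ^ 2 * (1 + M ^ 2) + S + 1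

/-- Lipschitz constant of the two unit features. -/
noncomputable def featureLip (M L L₂ S : ℝ) : ℝ :=
  2 * L * S * (1 + M) + L * L₂ * (1 + M ^ 2) + L ^ 2 * M + L

theorem sqrt_sum_sq_add_abs_le_blockSize (v : Unit ⊕ Fin d ⊕ Unit → ℝ) :
    √(∑ j : Fin d, v (Sum.inr (Sum.inl j)) ^ 2) + |v (Sum.inr (Sum.inr ()))| ≤ blockSize v := by
  set s := ∑ j : Fin d, v (Sum.inr (Sum.inl j)) ^ 2 with hs
  have hs0 : 0 ≤ s := Finset.sum_nonneg fun _ _ => sq_nonneg _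
  have h1 := Real.sq_sqrt hs0
  have h2 := sq_abs (v (Sum.inr (Sum.inr ())))
  rw [blockSize_eq, ← hs]
  nlinarith [sq_nonneg (√s - 1), sq_nonneg (|v (Sum.inr (Sum.inr ()))| - 1),
    sq_nonneg (blockOuter v)]

theorem abs_blockPreact_le {M : ℝ} {z : Input d} (hz : ‖z‖ ≤ M)
    (v : Unit ⊕ Fin d ⊕ Unit → ℝ) : |blockPreact v z| ≤ (1 + M) * blockSize v := by
  have hM : 0 ≤ M := (norm_nonneg _).trans hz
  have h1 := sum_mul_abs_le (fun j => v (Sum.inr (Sum.inl j))) z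
  have h2 := sqrt_sum_sq_add_abs_le_blockSize v
  set r := √(∑ j : Fin d, v (Sum.inr (Sum.inl j)) ^ 2)
  have hr : 0 ≤ r := Real.sqrt_nonneg _
  have h3 := abs_nonneg (v (Sum.inr (Sum.inr ())))
  calc |blockPreact v z| ≤ r * ‖z‖ + |v (Sum.inr (Sum.inr ()))| :=
        (abs_add_le _ _).trans (add_le_add h1 le_rfl)
    _ ≤ r * M + |v (Sum.inr (Sum.inr ()))| := by gcongr
    _ ≤ (1 + M) * (r + |v (Sum.inr (Sum.inr ()))|) := by nlinarith [mul_nonneg hM h3]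
    _ ≤ _ := by gcongr

theorem abs_blockPreact_sub_le (z w : Input d) (v : Unit ⊕ Fin d ⊕ Unit → ℝ) :
    |blockPreact v z - blockPreact v w| ≤ blockSize v * ‖z - w‖ := by
  have h1 := sum_mul_abs_le (fun j => v (Sum.inr (Sum.inl j))) (z - w)
  have h2 : blockPreact v z - blockPreact v w =
      ∑ j, v (Sum.inr (Sum.inl j)) * (z - w) j := by
    simp only [blockPreact, PiLp.sub_apply, mul_sub, Finset.sum_sub_distrib]
    ring
  rw [h2]
  exact h1.trans (mul_le_mul_of_nonneg_right
    ((le_add_of_nonneg_right (abs_nonneg _)).trans (sqrt_sum_sq_add_abs_le_blockSize v))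
    (norm_nonneg _))

variable {σ : ℝ → ℝ} {M L L₂ S : ℝ}

theorem unitFeature_kernelFeature (hσ : ActivationBounds σ M L L₂ S) :
    UnitFeature (d := d) M (featureSize M L S) (featureLip M L L₂ S) (kernelFeature σ) where
  measurable z z' := by
    have h1 : Measurable σ := hσ.differentiable.continuous.measurable
    have h2 : Measurable (deriv σ) := measurable_deriv σ
    unfold kernelFeature
    fun_prop
  quadratic z z' v hz hz' := by
    have hS0 := hσ.S_nonneg
    have hL0 := hσ.L_nonneg
    rw [kernelFeature]
    set u := blockPreact v z
    set u' := blockPreact v z'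
    set a := blockOuter v
    have h1 : |σ u * σ u'| ≤ S ^ 2 * (2 + u ^ 2 + u' ^ 2) := by
      rw [abs_mul]
      calc |σ u| * |σ u'| ≤ (S + S * |u|) * (S + S * |u'|) :=
            mul_le_mul (hσ.abs_le u) (hσ.abs_le u') (abs_nonneg _) (by positivity)
        _ = S ^ 2 * ((1 + |u|) * (1 + |u'|)) := by ring
        _ ≤ _ := by
          refine mul_le_mul_of_nonneg_left ?_ (sq_nonneg S)
          nlinarith [sq_nonneg (|u| - |u'|), sq_nonneg (|u| - 1), sq_nonneg (|u'| - 1), sq_abs u,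
            sq_abs u']
    have h2 : |a ^ 2 * (deriv σ u * deriv σ u') * (1 + inner ℝ z z')| ≤
        a ^ 2 * (L * L) * (1 + M ^ 2) := by
      rw [abs_mul, abs_mul, abs_mul (deriv σ u), abs_of_nonneg (sq_nonneg a)]
      have := hσ.deriv_le u
      have := hσ.deriv_le u'
      have := abs_one_add_inner_le hz hz'
      gcongr
    refine (abs_add_le _ _).trans ((add_le_add h1 h2).trans ?_)
    have e : featureSize M L S * (2 + u ^ 2 + u' ^ 2 + a ^ 2) =
        S ^ 2 * (2 + u ^ 2 + u' ^ 2) + a ^ 2 * (L * L) * (1 + M ^ 2) + (S ^ 2 * a ^ 2 +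
        L ^ 2 * (1 + M ^ 2) * (2 + u ^ 2 + u' ^ 2) + (S + 1) * (2 + u ^ 2 + u' ^ 2 + a ^ 2)) := by
      rw [featureSize]; ring
    rw [e]
    exact le_add_of_nonneg_right (by positivity)
  lipschitz z z' w w' v hz hz' hw hw' := by
    have hS0 := hσ.S_nonneg
    have hL0 := hσ.L_nonneg
    have hL20 := hσ.L₂_nonneg
    have hM0 := hσ.M_nonneg
    have hQ := one_le_blockSize v
    have ha : blockOuter v ^ 2 ≤ blockSize v := by
      rw [blockSize_eq]
      have : 0 ≤ ∑ j : Fin d, v (Sum.inr (Sum.inl j)) ^ 2 :=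
        Finset.sum_nonneg fun _ _ => sq_nonneg _
      nlinarith [sq_nonneg (v (Sum.inr (Sum.inr ())))]
    simp only [kernelFeature]
    set Q := blockSize v
    set ρ := ‖z - w‖ with hρ
    set ρ' := ‖z' - w'‖ with hρ'
    have hρ0 : 0 ≤ ρ := norm_nonneg _
    have hρ0' : 0 ≤ ρ' := norm_nonneg _
    have hd := abs_blockPreact_sub_le z w v
    have hd' := abs_blockPreact_sub_le z' w' v
    have hs : ∀ p : Input d, ‖p‖ ≤ M → |σ (blockPreact v p)| ≤ 2 * S * (1 + M) * Q := by
      intro p hp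
      have h1 := abs_blockPreact_le hp v
      have h2 : 1 ≤ (1 + M) * Q := by nlinarith
      calc _ ≤ S + S * |blockPreact v p| := hσ.abs_le _
        _ ≤ S * ((1 + M) * Q) + S * ((1 + M) * Q) := by
          gcongr
          exact le_mul_of_one_le_right hS0 h2
        _ = _ := by ring
    have hds : |σ (blockPreact v z) - σ (blockPreact v w)| ≤ L * (Q * ρ) :=
      (hσ.lip _ _).trans (by gcongr)
    have hds' : |σ (blockPreact v z') - σ (blockPreact v w')| ≤ L * (Q * ρ') :=
      (hσ.lip _ _).trans (by gcongr)
    have hdd : |deriv σ (blockPreact v z) - deriv σ (blockPreact v w)| ≤ L₂ * (Q * ρ) :=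
      (hσ.deriv_lip _ _).trans (by gcongr)
    have hdd' : |deriv σ (blockPreact v z') - deriv σ (blockPreact v w')| ≤ L₂ * (Q * ρ') :=
      (hσ.deriv_lip _ _).trans (by gcongr)
    have hin : |(inner ℝ z z' : ℝ) - inner ℝ w w'| ≤ M * (ρ + ρ') := by
      have e : (inner ℝ z z' : ℝ) - inner ℝ w w' = inner ℝ (z - w) z' + inner ℝ w (z' - w') := by
        rw [inner_sub_left, inner_sub_right]; ring
      rw [e]
      calc _ ≤ ρ * ‖z'‖ + ‖w‖ * ρ' := (abs_add_le _ _).trans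
            (add_le_add (abs_real_inner_le_norm _ _) (abs_real_inner_le_norm _ _))
        _ ≤ ρ * M + M * ρ' := by gcongr
        _ = _ := by ring
    have hin1 := abs_one_add_inner_le hz hz'
    have e : σ (blockPreact v z) * σ (blockPreact v z') +
        blockOuter v ^ 2 * (deriv σ (blockPreact v z) * deriv σ (blockPreact v z')) *
          (1 + inner ℝ z z') - (σ (blockPreact v w) * σ (blockPreact v w') +
        blockOuter v ^ 2 * (deriv σ (blockPreact v w) * deriv σ (blockPreact v w')) *
          (1 + inner ℝ w w')) =
        ((σ (blockPreact v z) - σ (blockPreact v w)) * σ (blockPreact v z') +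
        σ (blockPreact v w) * (σ (blockPreact v z') - σ (blockPreact v w'))) +
        blockOuter v ^ 2 *
          (((deriv σ (blockPreact v z) - deriv σ (blockPreact v w)) * deriv σ (blockPreact v z') +
          deriv σ (blockPreact v w) * (deriv σ (blockPreact v z') - deriv σ (blockPreact v w'))) *
          (1 + inner ℝ z z') + deriv σ (blockPreact v w) * deriv σ (blockPreact v w') *
          (inner ℝ z z' - inner ℝ w w')) := by ring
    rw [e]
    calc _ ≤ (L * (Q * ρ) * (2 * S * (1 + M) * Q) + 2 * S * (1 + M) * Q * (L * (Q * ρ'))) +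
          Q * ((L₂ * (Q * ρ) * L + L * (L₂ * (Q * ρ'))) * (1 + M ^ 2) +
            L * L * (M * (ρ + ρ'))) := by
          refine (abs_add_le _ _).trans (add_le_add ((abs_add_le _ _).trans (add_le_add ?_ ?_)) ?_)
          · rw [abs_mul]
            exact mul_le_mul hds (hs z' hz') (abs_nonneg _) (by positivity)
          · rw [abs_mul]
            exact mul_le_mul (hs w hw) hds' (abs_nonneg _) (by positivity)
          · rw [abs_mul, abs_of_nonneg (sq_nonneg _)]
            refine mul_le_mul ha ((abs_add_le _ _).trans (add_le_add ?_ ?_)) (abs_nonneg _)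
              (by positivity)
            · rw [abs_mul]
              refine mul_le_mul ((abs_add_le _ _).trans (add_le_add ?_ ?_)) hin1 (abs_nonneg _)
                (by positivity)
              · rw [abs_mul]
                exact mul_le_mul hdd (hσ.deriv_le _) (abs_nonneg _) (by positivity)
              · rw [abs_mul]
                exact mul_le_mul (hσ.deriv_le _) hdd' (abs_nonneg _) hL0
            · rw [abs_mul, abs_mul]
              exact mul_le_mul (mul_le_mul (hσ.deriv_le _) (hσ.deriv_le _) (abs_nonneg _) hL0)
                hin (abs_nonneg _) (by positivity)
      _ = (2 * L * S * (1 + M) + L * L₂ * (1 + M ^ 2)) * Q ^ 2 * (ρ + ρ') +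
            L ^ 2 * M * (Q * 1) * (ρ + ρ') := by ring
      _ ≤ (2 * L * S * (1 + M) + L * L₂ * (1 + M ^ 2)) * Q ^ 2 * (ρ + ρ') +
            L ^ 2 * M * (Q * Q) * (ρ + ρ') := by gcongr
      _ = (2 * L * S * (1 + M) + L * L₂ * (1 + M ^ 2) + L ^ 2 * M) * Q ^ 2 * (ρ + ρ') := by ring
      _ ≤ _ := by
          unfold featureLip
          exact mul_le_mul_of_nonneg_right (mul_le_mul_of_nonneg_right
            (le_add_of_nonneg_right hL0) (sq_nonneg Q)) (add_nonneg hρ0 hρ0')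

theorem unitFeature_outputFeature (hσ : ActivationBounds σ M L L₂ S) :
    UnitFeature (d := d) M (featureSize M L S) (featureLip M L L₂ S) (outputFeature σ) where
  measurable z z' := by
    have h1 : Measurable σ := hσ.differentiable.continuous.measurable
    unfold outputFeature
    fun_prop
  quadratic z z' v _ _ := by
    have hS0 := hσ.S_nonneg
    have hL0 := hσ.L_nonneg
    rw [outputFeature]
    set u := blockPreact v z
    set a := blockOuter v
    calc |a * σ u| ≤ |a| * (S + S * |u|) := by
          rw [abs_mul]; exact mul_le_mul_of_nonneg_left (hσ.abs_le u) (abs_nonneg _)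
      _ = S * (|a| * (1 + |u|)) := by ring
      _ ≤ S * (2 + u ^ 2 + blockPreact v z' ^ 2 + a ^ 2) := by
          refine mul_le_mul_of_nonneg_left ?_ hS0
          nlinarith [sq_nonneg (|a| - |u|), sq_nonneg (|a| - 1), sq_abs a, sq_abs u,
            sq_nonneg (blockPreact v z')]
      _ ≤ _ := by
          refine mul_le_mul_of_nonneg_right ?_ (by positivity)
          rw [featureSize]
          nlinarith [sq_nonneg S, mul_nonneg (sq_nonneg L) (sq_nonneg M), sq_nonneg L]
  lipschitz z z' w w' v _ _ _ _ := by
    have hS0 := hσ.S_nonneg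
    have hL0 := hσ.L_nonneg
    have hL20 := hσ.L₂_nonneg
    have hM0 := hσ.M_nonneg
    have hQ := one_le_blockSize v
    have ha : |blockOuter v| ≤ blockSize v := by
      rw [blockSize_eq]
      have : 0 ≤ ∑ j : Fin d, v (Sum.inr (Sum.inl j)) ^ 2 :=
        Finset.sum_nonneg fun _ _ => sq_nonneg _
      nlinarith [sq_nonneg (v (Sum.inr (Sum.inr ()))), sq_nonneg (|blockOuter v| - 1),
        sq_abs (blockOuter v)]
    have hd := abs_blockPreact_sub_le z w v
    simp only [outputFeature]
    rw [← mul_sub, abs_mul]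
    have hLle : L ≤ featureLip M L L₂ S := by
      rw [featureLip]
      exact le_add_of_nonneg_left (by positivity)
    have hF0 : 0 ≤ featureLip M L L₂ S := hL0.trans hLle
    have hρ' : 0 ≤ ‖z' - w'‖ := norm_nonneg _
    calc _ ≤ blockSize v * (L * (blockSize v * ‖z - w‖)) :=
          mul_le_mul ha ((hσ.lip _ _).trans (by gcongr)) (abs_nonneg _) (by positivity)
      _ = L * blockSize v ^ 2 * ‖z - w‖ := by ring
      _ ≤ featureLip M L L₂ S * blockSize v ^ 2 * (‖z - w‖ + ‖z' - w'‖) := by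
          gcongr
          exact le_add_of_nonneg_right hρ'

theorem one_le_featureSize (hσ : ActivationBounds σ M L L₂ S) : 1 ≤ featureSize M L S := by
  have := hσ.S_nonneg
  rw [featureSize]
  exact le_add_of_nonneg_left (by positivity)

theorem featureLip_nonneg (hσ : ActivationBounds σ M L L₂ S) : 0 ≤ featureLip M L L₂ S := by
  have := hσ.S_nonneg
  have := hσ.L_nonneg
  have := hσ.L₂_nonneg
  have := hσ.M_nonneg
  rw [featureLip]; positivity

end Features

section Uniform

variable {m d : ℕ} {ν : ParamIdx (Fin m) d → Measure ℝ} {K M Cg CL : ℝ}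
  {G : Input d → Input d → (Unit ⊕ Fin d ⊕ Unit → ℝ) → ℝ}

/-- A finite cover of the ball, with one point of the ball from each cube of side `η / d` that meets
the ball. -/
theorem exists_finset_cover_ball (d : ℕ) {M η : ℝ} (hM : 0 ≤ M) (hη : 0 < η) (hd : 1 ≤ d) :
    ∃ N : Finset (Input d), (∀ z ∈ N, ‖z‖ ≤ M) ∧
      (N.card : ℝ) ≤ (2 * (M * d / η) + 5) ^ d ∧
      ∀ z : Input d, ‖z‖ ≤ M → ∃ w ∈ N, ‖z - w‖ ≤ η := by
  classical
  have hd0 : (0 : ℝ) < d := by exact_mod_cast hd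
  set s := η / d with hs
  have hs0 : 0 < s := by positivity
  -- the cell of a point, and the cells that meet the ball
  set cell : Input d → Fin d → ℤ := fun z j => ⌊z j / s⌋ with hcell
  set k : ℕ := ⌈M / s⌉₊ + 1 with hk
  set cells := (Fintype.piFinset fun _ : Fin d => Finset.Icc (-(k : ℤ)) k).filter
    fun c => ∃ z : Input d, ‖z‖ ≤ M ∧ cell z = c with hcells
  have hmem : ∀ c ∈ cells, ∃ z : Input d, ‖z‖ ≤ M ∧ cell z = c := fun c hc =>
    (Finset.mem_filter.1 hc).2
  choose! rep hrep using hmem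
  refine ⟨cells.image rep, ?_, ?_, ?_⟩
  · intro z hz
    obtain ⟨c, hc, rfl⟩ := Finset.mem_image.1 hz
    exact (hrep c hc).1
  · have h1 : (cells.image rep).card ≤ (2 * k + 1) ^ d := by
      refine Finset.card_image_le.trans ((Finset.card_filter_le _ _).trans (le_of_eq ?_))
      rw [Fintype.card_piFinset_const, Int.card_Icc]
      congr 1
      omega
    have h2 : ((2 * k + 1 : ℕ) : ℝ) ≤ 2 * (M * d / η) + 5 := by
      have h3 := (Nat.ceil_lt_add_one (div_nonneg hM hs0.le)).le
      have h4 : M / s = M * d / η := by rw [hs]; field_simp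
      rw [h4] at h3
      rw [hk]
      push_cast
      rw [h4]
      linarith
    calc ((cells.image rep).card : ℝ) ≤ ((2 * k + 1 : ℕ) : ℝ) ^ d := by exact_mod_cast h1
      _ ≤ _ := by gcongr
  · intro z hz
    have hc : cell z ∈ cells := by
      refine Finset.mem_filter.2 ⟨Fintype.mem_piFinset.2 fun j => ?_, z, hz, rfl⟩
      have h1 : |z j| ≤ M := (PiLp.norm_apply_le z j).trans hz
      have h2 : |z j / s| ≤ M / s := by rw [abs_div, abs_of_pos hs0]; gcongr
      have h3 := Nat.le_ceil (M / s)
      have h4 := abs_le.1 h2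
      rw [Finset.mem_Icc]
      constructor
      · refine Int.le_floor.2 ?_
        push_cast [hk]
        linarith
      · refine Int.floor_le_iff.2 ?_
        push_cast [hk]
        linarith
    refine ⟨rep (cell z), Finset.mem_image_of_mem _ hc, ?_⟩
    have hj : ∀ j, |z j - rep (cell z) j| ≤ s := by
      intro j
      have h1 : ⌊rep (cell z) j / s⌋ = ⌊z j / s⌋ := congrFun (hrep _ hc).2 j
      have h2 := (Int.abs_sub_lt_one_of_floor_eq_floor h1.symm).le
      rwa [← sub_div, abs_div, abs_of_pos hs0, div_le_one hs0] at h2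
    refine le_of_sq_le_sq ?_ hη.le
    rw [EuclideanSpace.real_norm_sq_eq]
    calc ∑ j, (z - rep (cell z)) j ^ 2 ≤ ∑ _j : Fin d, s ^ 2 :=
          Finset.sum_le_sum fun j _ => sq_le_sq' (abs_le.1 (hj j)).1 (abs_le.1 (hj j)).2
      _ = d * s ^ 2 := by simp
      _ ≤ d * d * s ^ 2 := by
          have : (1 : ℝ) ≤ d := by exact_mod_cast hd
          gcongr
          exact le_mul_of_one_le_left hd0.le this
      _ = η ^ 2 := by rw [hs]; field_simp

/-- Uniform concentration of the average of a unit feature over the ball: Bernstein's inequality on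
a finite cover, extended by the Lipschitz bound where the blocks are of moderate size. -/
theorem measure_exists_deviation_le (hν : ∀ i, IsInitLaw K (ν i)) (hK : 1 ≤ K)
    (hG : UnitFeature M Cg CL G) (hCg : 1 ≤ Cg) (hCL : 0 ≤ CL) (hm : 1 ≤ m) {N : Finset (Input d)}
    (hN : ∀ z ∈ N, ‖z‖ ≤ M) {η : ℝ} (hη : ∀ z : Input d, ‖z‖ ≤ M → ∃ w ∈ N, ‖z - w‖ ≤ η)
    {τ q : ℝ} (hτ : 0 ≤ τ) (hτ' : τ ≤ 32 / (sqExponent K M / (3 * Cg))) :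
    Measure.pi ν {ω | (∀ l, blockSize (unitBlock l ω) ≤ q) ∧ ∃ z z' : Input d, ‖z‖ ≤ M ∧ ‖z'‖ ≤ M ∧
        τ + 2 * CL * η * (q ^ 2 + (2 + 128 * K ^ 4 * (d + 2) ^ 2)) <
          |1 / (m : ℝ) * ∑ l, G z z' (unitBlock l ω) -
            1 / (m : ℝ) * ∑ l : Fin m, ∫ ω', G z z' (unitBlock l ω') ∂(Measure.pi ν)|} ≤
      ENNReal.ofReal ((N.card : ℝ) ^ 2 *
        (2 * Real.exp (-(m * τ ^ 2 * (sqExponent K M / (3 * Cg)) ^ 2 / 128)))) := by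
  have := fun i => (hν i).isProb
  set c := sqExponent K M / (3 * Cg) with hc
  have hc0 : 0 < c := div_pos (sqExponent_pos hK) (by positivity)
  have hm0 : (0 : ℝ) < m := by exact_mod_cast hm
  have hne : Nonempty (Fin m) := ⟨⟨0, hm⟩⟩
  have hexp : ∀ (l : Fin m) {z z' : Input d}, ‖z‖ ≤ M → ‖z'‖ ≤ M →
      ∫⁻ ω, ENNReal.ofReal (Real.exp (c * |G z z' (unitBlock l ω)|)) ∂(Measure.pi ν) ≤
        ENNReal.ofReal 4 := fun l z z' hz hz' =>
    lintegral_exp_abs_le_of_quadratic hν hK hCg l hz hz' fun ω => hG.quadratic z z' _ hz hz'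
  have hmeas : ∀ (l : Fin m) (z z' : Input d), Measurable fun ω => G z z' (unitBlock l ω) :=
    fun l z z' => (hG.measurable z z').comp (measurable_unitBlock l)
  set bad : Input d × Input d → Set (ParamIdx (Fin m) d → ℝ) := fun p =>
    {ω | (Fintype.card (Fin m) : ℝ) * τ ≤ |∑ l, (G p.1 p.2 (unitBlock l ω) -
      ∫ ω', G p.1 p.2 (unitBlock l ω') ∂(Measure.pi ν))|} with hbad
  have hsub : {ω | (∀ l, blockSize (unitBlock l ω) ≤ q) ∧ ∃ z z' : Input d, ‖z‖ ≤ M ∧ ‖z'‖ ≤ M ∧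
        τ + 2 * CL * η * (q ^ 2 + (2 + 128 * K ^ 4 * (d + 2) ^ 2)) <
          |1 / (m : ℝ) * ∑ l, G z z' (unitBlock l ω) -
            1 / (m : ℝ) * ∑ l : Fin m, ∫ ω', G z z' (unitBlock l ω') ∂(Measure.pi ν)|} ⊆
      ⋃ p ∈ N ×ˢ N, bad p := by
    intro ω hω
    rw [mem_ofPred_eq] at hω
    obtain ⟨hq, z, z', hz, hz', hdev⟩ := hω
    obtain ⟨w, hw, hzw⟩ := hη z hz
    obtain ⟨w', hw', hzw'⟩ := hη z' hz'
    have hwM := hN w hw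
    have hwM' := hN w' hw'
    refine mem_biUnion (x := (w, w')) (Finset.mem_coe.2 (Finset.mk_mem_product hw hw')) ?_
    rw [hbad, mem_ofPred_eq, Fintype.card_fin]
    by_contra hcon
    rw [not_le] at hcon
    have hη0 : 0 ≤ η := (norm_nonneg _).trans hzw
    have hlip : ∀ v, |G z z' v - G w w' v| ≤ 2 * CL * η * blockSize v ^ 2 := fun v => by
      refine (hG.lipschitz z z' w w' v hz hz' hwM hwM').trans ?_
      calc CL * blockSize v ^ 2 * (‖z - w‖ + ‖z' - w'‖) ≤ CL * blockSize v ^ 2 * (η + η) := by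
            gcongr
        _ = _ := by ring
    -- moving `(z, z')` to `(w, w')` changes the average and its mean by the discretization error
    have h1 : |1 / (m : ℝ) * ∑ l, G z z' (unitBlock l ω) -
        1 / (m : ℝ) * ∑ l, G w w' (unitBlock l ω)| ≤ 2 * CL * η * q ^ 2 := by
      have := abs_average_sub_le (ι := Fin m) (f := fun l => G z z' (unitBlock l ω))
        (g := fun l => G w w' (unitBlock l ω)) (C := 2 * CL * η * q ^ 2) fun l =>
        (hlip _).trans (by
          have := one_le_blockSize (unitBlock l ω)
          have := hq l
          gcongr)
      simpa using this
    have h2 : |1 / (m : ℝ) * ∑ l : Fin m, ∫ ω', G z z' (unitBlock l ω') ∂(Measure.pi ν) -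
        1 / (m : ℝ) * ∑ l : Fin m, ∫ ω', G w w' (unitBlock l ω') ∂(Measure.pi ν)| ≤
        2 * CL * η * (2 + 128 * K ^ 4 * (d + 2) ^ 2) := by
      have := abs_average_sub_le (ι := Fin m)
        (f := fun l => ∫ ω', G z z' (unitBlock l ω') ∂(Measure.pi ν))
        (g := fun l => ∫ ω', G w w' (unitBlock l ω') ∂(Measure.pi ν))
        (C := 2 * CL * η * (2 + 128 * K ^ 4 * (d + 2) ^ 2)) fun l => by
        have hQ := integral_blockSize_sq_le hν hK l
        rw [← integral_sub (integrable_of_subexponential (hmeas l z z') hc0 (hexp l hz hz'))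
          (integrable_of_subexponential (hmeas l w w') hc0 (hexp l hwM hwM'))]
        calc _ ≤ ∫ ω', 2 * CL * η * blockSize (unitBlock l ω') ^ 2 ∂(Measure.pi ν) := by
              rw [← Real.norm_eq_abs]
              exact norm_integral_le_of_norm_le (hQ.1.const_mul _)
                (ae_of_all _ fun ω' => hlip _)
          _ ≤ _ := by
              rw [integral_const_mul]
              exact mul_le_mul_of_nonneg_left hQ.2 (by positivity)
      simpa using this
    have h3 : |1 / (m : ℝ) * ∑ l, G w w' (unitBlock l ω) -
        1 / (m : ℝ) * ∑ l : Fin m, ∫ ω', G w w' (unitBlock l ω') ∂(Measure.pi ν)| ≤ τ := by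
      rw [← mul_sub, ← Finset.sum_sub_distrib, abs_mul, abs_of_pos (by positivity), one_div,
        inv_mul_le_iff₀ hm0]
      exact hcon.le
    have h1' := abs_le.1 h1
    have h2' := abs_le.1 h2
    have h3' := abs_le.1 h3
    refine hdev.not_ge (abs_le.2 ⟨?_, ?_⟩) <;> nlinarith
  refine (measure_mono hsub).trans ((measure_biUnion_finset_le _ _).trans ?_)
  have hone : ∀ p ∈ N ×ˢ N, Measure.pi ν (bad p) ≤
      ENNReal.ofReal (2 * Real.exp (-(m * τ ^ 2 * c ^ 2 / 128))) := by
    intro p hp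
    obtain ⟨hp1, hp2⟩ := Finset.mem_product.1 hp
    have h := measureReal_abs_sum_sub_integral_ge_le (P := Measure.pi ν)
      (Y := fun (l : Fin m) ω => G p.1 p.2 (unitBlock l ω)) (fun l => hmeas l _ _)
      ((iIndepFun_unitBlock hν).comp (fun _ => G p.1 p.2) fun _ => hG.measurable _ _)
      hc0 (A := 4) (by norm_num) hτ (by norm_num; exact hτ')
      fun l => hexp l (hN _ hp1) (hN _ hp2)
    rw [← ENNReal.ofReal_toReal (measure_ne_top (Measure.pi ν) (bad p))]
    refine ENNReal.ofReal_le_ofReal (h.trans (le_of_eq ?_))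
    rw [Fintype.card_fin]
    norm_num
  refine (Finset.sum_le_sum hone).trans (le_of_eq ?_)
  rw [Finset.sum_const, Finset.card_product, nsmul_eq_mul,
    ENNReal.ofReal_mul (p := (N.card : ℝ) ^ 2) (by positivity),
    ENNReal.ofReal_pow (Nat.cast_nonneg _), ENNReal.ofReal_natCast, Nat.cast_mul,
    pow_two (N.card : ℝ≥0∞)]

end Uniform

/-! ### Kernel and output at initialization -/

section Initialization

variable {m d : ℕ} {ν : ParamIdx (Fin m) d → Measure ℝ} {K M L L₂ S : ℝ} {σ : ℝ → ℝ}

theorem ntk_standardInit (hσ : Differentiable ℝ σ) (ω : ParamIdx (Fin m) d → ℝ)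
    (z z' : Input d) :
    ntk σ (standardInit ω) z z' = 1 + 1 / (m : ℝ) * ∑ l, kernelFeature σ z z' (unitBlock l ω) := by
  rw [ntk_eq hσ, Fintype.card_fin]
  rfl

/-- Doubling the units changes neither the outer weights up to sign nor the preactivations, so it
leaves the kernel unchanged. -/
theorem ntk_doubledInit (hσ : Differentiable ℝ σ) (ω : ParamIdx (Fin m) d → ℝ)
    (z z' : Input d) : ntk σ (doubledInit ω) z z' = ntk σ (standardInit ω) z z' := by
  rw [ntk_eq hσ, ntk_eq hσ, Fintype.sum_sum_type, Fintype.card_sum, Fintype.card_fin]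
  have h1 : ∀ l : Fin m, kernelTerm σ (doubledInit ω) (Sum.inl l) z z' =
      kernelTerm σ (standardInit ω) l z z' := fun l => rfl
  have h2 : ∀ l : Fin m, kernelTerm σ (doubledInit ω) (Sum.inr l) z z' =
      kernelTerm σ (standardInit ω) l z z' := fun l => by
    have h3 : Param.a (doubledInit ω) (Sum.inr l) = -Param.a (standardInit ω) l := rfl
    have h4 : ∀ w, preact (doubledInit ω) (Sum.inr l) w = preact (standardInit ω) l w :=
      fun w => rfl
    simp only [kernelTerm, h3, h4, neg_sq]
  simp only [h1, h2]
  push_cast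
  rw [← two_mul, ← two_mul, ← mul_assoc]
  congr 2
  rw [one_div, mul_inv, mul_right_comm, inv_mul_cancel₀ two_ne_zero, one_mul, one_div]

theorem net_standardInit (ω : ParamIdx (Fin m) d → ℝ) (z : Input d) :
    net σ (standardInit ω) z = 1 / √(m : ℝ) * ∑ l, outputFeature σ z 0 (unitBlock l ω) +
      ω (Sum.inr (Sum.inr (Sum.inr ()))) := by
  rw [net, Fintype.card_fin]
  rfl

theorem net_doubledInit (ω : ParamIdx (Fin m) d → ℝ) (z : Input d) :
    net σ (doubledInit ω) z = 0 := by
  have h0 : Param.b₀ (doubledInit ω) = 0 := rfl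
  have h1 : ∀ l : Fin m, Param.a (doubledInit ω) (Sum.inr l) *
        σ (∑ j, Param.W (doubledInit ω) (Sum.inr l) j * z j + Param.b (doubledInit ω) (Sum.inr l)) =
      -(Param.a (doubledInit ω) (Sum.inl l) *
        σ (∑ j, Param.W (doubledInit ω) (Sum.inl l) j * z j +
          Param.b (doubledInit ω) (Sum.inl l))) := fun l => neg_mul _ _
  rw [net, h0, Fintype.sum_sum_type]
  simp only [h1, Finset.sum_neg_distrib, add_neg_cancel, mul_zero, add_zero]

theorem integral_ntk_standardInit (hν : ∀ i, IsInitLaw K (ν i)) (hK : 1 ≤ K)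
    (hσ : ActivationBounds σ M L L₂ S) {z z' : Input d} (hz : ‖z‖ ≤ M) (hz' : ‖z'‖ ≤ M) :
    ∫ ω, ntk σ (standardInit ω) z z' ∂(Measure.pi ν) =
      1 + 1 / (m : ℝ) * ∑ l : Fin m, ∫ ω, kernelFeature σ z z' (unitBlock l ω) ∂(Measure.pi ν) := by
  have := fun i => (hν i).isProb
  have hF := unitFeature_kernelFeature (d := d) hσ
  have hC := one_le_featureSize hσ
  have hint : ∀ l : Fin m, Integrable (fun ω => kernelFeature σ z z' (unitBlock l ω))
      (Measure.pi ν) := fun l =>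
    integrable_of_subexponential ((hF.measurable z z').comp (measurable_unitBlock l))
      (div_pos (sqExponent_pos (M := M) hK) (by positivity))
      (lintegral_exp_abs_le_of_quadratic hν hK hC l hz hz' fun ω => hF.quadratic z z' _ hz hz')
  simp_rw [ntk_standardInit hσ.differentiable]
  rw [integral_add (integrable_const _) ((integrable_finsetSum _ fun l _ => hint l).const_mul _),
    integral_const_mul, integral_finsetSum _ fun l _ => hint l]
  simp

/-- The output of a unit has mean zero, since the outer weight is centred and independent of the
inner parameters. -/
theorem integral_outputFeature (hν : ∀ i, IsInitLaw K (ν i)) (hσ : Measurable σ) (l : Fin m)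
    (z z' : Input d) : ∫ ω, outputFeature σ z z' (unitBlock l ω) ∂(Measure.pi ν) = 0 := by
  classical
  have := fun i => (hν i).isProb
  have hind : iIndepFun (fun i (ω : ParamIdx (Fin m) d → ℝ) => ω i) (Measure.pi ν) :=
    iIndepFun_pi (X := fun _ x => x) fun i => aemeasurable_id
  have h := hind.indepFun_finset {Sum.inl l} (Finset.univ.erase (Sum.inl l))
    (by simp) fun i => measurable_pi_apply i
  have hφ : Measurable fun v : ({Sum.inl l} : Finset (ParamIdx (Fin m) d)) → ℝ =>
      v ⟨Sum.inl l, by simp⟩ := by fun_prop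
  have hψ : Measurable fun v : (Finset.univ.erase (Sum.inl l) : Finset (ParamIdx (Fin m) d)) → ℝ =>
      σ (∑ j, v ⟨Sum.inr (Sum.inl (l, j)), by simp⟩ * z j +
        v ⟨Sum.inr (Sum.inr (Sum.inl l)), by simp⟩) := by fun_prop
  have h2 := (h.comp hφ hψ).integral_mul_eq_mul_integral
    (hφ.comp (by fun_prop)).aestronglyMeasurable (hψ.comp (by fun_prop)).aestronglyMeasurable
  have hmean : ∫ ω : ParamIdx (Fin m) d → ℝ, ω (Sum.inl l) ∂(Measure.pi ν) = 0 := by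
    have h3 := (measurePreserving_eval ν (Sum.inl l)).map_eq
    have h4 := integral_map (μ := Measure.pi ν) (φ := Function.eval (Sum.inl l))
      (measurable_pi_apply _).aemeasurable (f := fun u : ℝ => u) (by fun_prop)
    rw [h3, (hν _).mean_zero] at h4
    exact h4.symm
  refine h2.trans ?_
  simp only [Function.comp_def]
  rw [hmean, zero_mul]

/-- Markov's inequality for exponential moments, with a union bound. -/
theorem measure_exists_log_lt_le {Ω J : Type*} [MeasurableSpace Ω] [Fintype J] [Nonempty J]
    {P : Measure Ω} {f : J → Ω → ℝ} (hf : ∀ j, Measurable (f j))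
    (h : ∀ j, ∫⁻ ω, ENNReal.ofReal (Real.exp (f j ω)) ∂P ≤ 2) {δ : ℝ} (hδ : 0 < δ) :
    P {ω | ∃ j, Real.log (8 * Fintype.card J / δ) < f j ω} ≤ ENNReal.ofReal (δ / 4) := by
  have hJ : (0 : ℝ) < Fintype.card J := by exact_mod_cast Fintype.card_pos
  have hpos : 0 < 8 * Fintype.card J / δ := by positivity
  have hsub : {ω | ∃ j, Real.log (8 * Fintype.card J / δ) < f j ω} ⊆
      ⋃ j ∈ (Finset.univ : Finset J),
        {ω | ENNReal.ofReal (8 * Fintype.card J / δ) ≤ ENNReal.ofReal (Real.exp (f j ω))} := by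
    intro ω hω
    rw [mem_ofPred_eq] at hω
    obtain ⟨j, hj⟩ := hω
    refine mem_biUnion (x := j) (Finset.mem_coe.2 (Finset.mem_univ j)) ?_
    rw [mem_ofPred_eq]
    exact ENNReal.ofReal_le_ofReal ((Real.log_lt_iff_lt_exp hpos).1 hj).le
  refine (measure_mono hsub).trans ((measure_biUnion_finset_le _ _).trans ?_)
  have hone : ∀ j, P {ω | ENNReal.ofReal (8 * Fintype.card J / δ) ≤
      ENNReal.ofReal (Real.exp (f j ω))} ≤ ENNReal.ofReal (δ / (4 * Fintype.card J)) := by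
    intro j
    have hfj := hf j
    refine (meas_ge_le_lintegral_div (by fun_prop) (by simpa using hpos) (by simp)).trans ?_
    refine (ENNReal.div_le_div_right (h j) _).trans (le_of_eq ?_)
    rw [show (2 : ℝ≥0∞) = ENNReal.ofReal 2 by simp, ← ENNReal.ofReal_div_of_pos hpos]
    congr 1
    field_simp
    norm_num
  refine (Finset.sum_le_sum fun j _ => hone j).trans (le_of_eq ?_)
  rw [Finset.sum_const, Finset.card_univ, nsmul_eq_mul, ← ENNReal.ofReal_natCast,
    ← ENNReal.ofReal_mul hJ.le]
  congr 1
  field_simp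

end Initialization

/-! ### Numerical estimates and the good event -/

section Numerics

/-- The logarithmic factor `1 + log(m / δ)`. -/
noncomputable def logFactor (m : ℕ) (δ : ℝ) : ℝ := 1 + Real.log (m / δ)

variable {d m : ℕ} {δ : ℝ}

theorem logFactor_eq (hm : 1 ≤ m) (hδ : 0 < δ) :
    logFactor m δ = 1 + Real.log m + Real.log (1 / δ) := by
  have hm0 : (m : ℝ) ≠ 0 := by positivity
  rw [logFactor, Real.log_div hm0 hδ.ne', Real.log_div one_ne_zero hδ.ne', Real.log_one]
  ring

theorem log_one_div_nonneg (hδ : 0 < δ) (hδ1 : δ < 1) : 0 ≤ Real.log (1 / δ) :=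
  Real.log_nonneg (by rw [le_div_iff₀ hδ]; linarith)

theorem one_add_log_le_logFactor (hm : 1 ≤ m) (hδ : 0 < δ) (hδ1 : δ < 1) :
    1 + Real.log m ≤ logFactor m δ := by
  rw [logFactor_eq hm hδ]
  linarith [log_one_div_nonneg hδ hδ1]

theorem one_le_logFactor (hm : 1 ≤ m) (hδ : 0 < δ) (hδ1 : δ < 1) : 1 ≤ logFactor m δ := by
  have := one_add_log_le_logFactor hm hδ hδ1
  have : 0 ≤ Real.log m := Real.log_natCast_nonneg m
  linarith

theorem mul_one_add_log_le_widthTerm :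
    Real.log (1 / δ) + d * (1 + Real.log m) ≤ widthTerm 3 d m δ := by
  have h1 : 0 ≤ Real.log m := Real.log_natCast_nonneg m
  have h2 : 1 + Real.log m ≤ (1 + Real.log m) ^ 3 := le_self_pow₀ (by linarith) (by norm_num)
  have h3 := mul_le_mul_of_nonneg_left h2 (Nat.cast_nonneg (α := ℝ) d)
  rw [widthTerm]
  linarith

theorem logFactor_le_widthTerm (hd : 1 ≤ d) (hm : 1 ≤ m) (hδ : 0 < δ) (hδ1 : δ < 1) :
    logFactor m δ ≤ widthTerm 3 d m δ := by
  have h := mul_one_add_log_le_widthTerm (d := d) (m := m) (δ := δ)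
  have h1 : 0 ≤ Real.log m := Real.log_natCast_nonneg m
  have hd1 : (1 : ℝ) ≤ d := by exact_mod_cast hd
  rw [logFactor_eq hm hδ]
  nlinarith

theorem natCast_le_widthTerm (hδ : 0 < δ) (hδ1 : δ < 1) : (d : ℝ) ≤ widthTerm 3 d m δ := by
  have h := mul_one_add_log_le_widthTerm (d := d) (m := m) (δ := δ)
  have h1 : 0 ≤ Real.log m := Real.log_natCast_nonneg m
  have h2 := log_one_div_nonneg hδ hδ1
  nlinarith [mul_nonneg (Nat.cast_nonneg (α := ℝ) d) h1]

/-- The power of `logFactor` is `6` because its cube is the logarithmic factor of the final rate,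
after the square root in the Bernstein deviation. -/
theorem widthTerm_le_logFactor (hd : 1 ≤ d) (hm : 1 ≤ m) (hδ : 0 < δ) (hδ1 : δ < 1) :
    widthTerm 3 d m δ ≤ 2 * d * logFactor m δ ^ 6 := by
  have h0 := one_le_logFactor hm hδ hδ1
  have h1 := one_add_log_le_logFactor hm hδ hδ1
  have h2 : 0 ≤ Real.log m := Real.log_natCast_nonneg m
  have hd1 : (1 : ℝ) ≤ d := by exact_mod_cast hd
  have h3 : logFactor m δ ≤ logFactor m δ ^ 6 := le_self_pow₀ h0 (by norm_num)
  have h4 : (1 + Real.log m) ^ 3 ≤ logFactor m δ ^ 6 :=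
    (pow_le_pow_left₀ (by linarith) h1 3).trans (pow_le_pow_right₀ h0 (by norm_num))
  have h5 : Real.log (1 / δ) ≤ logFactor m δ := by rw [logFactor_eq hm hδ]; linarith
  have h6 : Real.log (1 / δ) ≤ d * logFactor m δ ^ 6 := by nlinarith
  have h7 := mul_le_mul_of_nonneg_left h4 (Nat.cast_nonneg (α := ℝ) d)
  rw [widthTerm]
  linarith

theorem log_mul_pow_div_le (hm : 1 ≤ m) (hδ : 0 < δ) (hδ1 : δ < 1) :
    Real.log (32 * (m : ℝ) ^ 2 / δ) ≤ 4 * logFactor m δ := by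
  have hm0 : (0 : ℝ) < m := by exact_mod_cast hm
  have h32 : Real.log 32 ≤ 4 := by
    rw [show (32 : ℝ) = 2 ^ 5 by norm_num, Real.log_pow]
    have := Real.log_two_lt_d9
    norm_num
    linarith
  have h0 : 0 ≤ Real.log m := Real.log_natCast_nonneg m
  have h1 := log_one_div_nonneg hδ hδ1
  have e : 32 * (m : ℝ) ^ 2 / δ = 32 * (m : ℝ) ^ 2 * (1 / δ) := by ring
  rw [e, Real.log_mul (by positivity) (by positivity), Real.log_mul (by norm_num) (by positivity),
    Real.log_pow, logFactor_eq hm hδ]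
  push_cast
  linarith

/-- The cardinality of the square of the cover is absorbed by the exponential tail. The cover has
mesh `m⁻⁵`, so the logarithm of its cardinality is at most `log (2 M + 5) + 6` times
`d (1 + log m)`. -/
theorem cover_mul_exp_le {M : ℝ} (hM : 0 ≤ M) (hd : 1 ≤ d) (hm : 1 ≤ m) (hdm : d ≤ m)
    (hδ : 0 < δ) (hδ1 : δ < 1) {N : ℝ} (hN0 : 0 ≤ N)
    (hN : N ≤ (2 * (M * d / (1 / (m : ℝ) ^ 5)) + 5) ^ d) :
    N ^ 2 * (2 * Real.exp (-((4 + 2 * (Real.log (2 * M + 5) + 6)) * widthTerm 3 d m δ))) ≤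
      δ / 4 := by
  set w := widthTerm 3 d m δ with hw
  set CN := Real.log (2 * M + 5) + 6 with hCN
  have hm1 : (1 : ℝ) ≤ m := by exact_mod_cast hm
  have hdm' : (d : ℝ) ≤ m := by exact_mod_cast hdm
  have hlogm : 0 ≤ Real.log m := Real.log_natCast_nonneg m
  have hlogM : 0 ≤ Real.log (2 * M + 5) := Real.log_nonneg (by linarith)
  have h1 : 2 * (M * d / (1 / (m : ℝ) ^ 5)) + 5 ≤ Real.exp (CN * (1 + Real.log m)) := by
    calc 2 * (M * d / (1 / (m : ℝ) ^ 5)) + 5 = 2 * M * (d * (m : ℝ) ^ 5) + 5 := by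
          rw [div_div_eq_mul_div, div_one]; ring
      _ ≤ 2 * M * (m * (m : ℝ) ^ 5) + 5 * (m : ℝ) ^ 6 := by
          have : (1 : ℝ) ≤ (m : ℝ) ^ 6 := one_le_pow₀ hm1
          gcongr
          linarith
      _ = (2 * M + 5) * (m : ℝ) ^ 6 := by ring
      _ = Real.exp (Real.log (2 * M + 5) + 6 * Real.log m) := by
          rw [Real.exp_add, Real.exp_log (by linarith), mul_comm (6 : ℝ),
            Real.exp_mul, Real.exp_log (by linarith)]
          norm_cast
      _ ≤ _ := by
          refine Real.exp_le_exp.2 ?_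
          rw [hCN]
          nlinarith [mul_nonneg hlogM hlogm]
  have hwge := mul_one_add_log_le_widthTerm (d := d) (m := m) (δ := δ)
  have hlogδ := log_one_div_nonneg hδ hδ1
  have hd1 : (1 : ℝ) ≤ d := by exact_mod_cast hd
  have hw1 : 1 ≤ w := (one_le_logFactor hm hδ hδ1).trans (logFactor_le_widthTerm hd hm hδ hδ1)
  have h2 : N ≤ Real.exp (CN * w) := by
    calc N ≤ Real.exp (CN * (1 + Real.log m)) ^ d :=
          hN.trans (pow_le_pow_left₀ (by positivity) h1 d)
      _ = Real.exp (CN * (d * (1 + Real.log m))) := by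
          rw [← Real.exp_nat_mul]; ring_nf
      _ ≤ _ := by
          refine Real.exp_le_exp.2 (mul_le_mul_of_nonneg_left ?_ (by positivity))
          linarith
  have h8 : (8 : ℝ) ≤ Real.exp (3 * w) := by
    have := Real.exp_one_gt_d9
    calc (8 : ℝ) = 2 ^ 3 := by norm_num
      _ ≤ Real.exp 1 ^ 3 := by gcongr; linarith
      _ = Real.exp 3 := by rw [← Real.exp_nat_mul]; norm_num
      _ ≤ _ := Real.exp_le_exp.2 (by linarith)
  have hδw : Real.exp (-w) ≤ δ := by
    have h3 : Real.log (1 / δ) ≤ w := by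
      have : 0 ≤ (d : ℝ) * (1 + Real.log m) := by positivity
      linarith
    rw [one_div, Real.log_inv] at h3
    calc Real.exp (-w) ≤ Real.exp (Real.log δ) := Real.exp_le_exp.2 (by linarith)
      _ = δ := Real.exp_log hδ
  calc N ^ 2 * (2 * Real.exp (-((4 + 2 * CN) * w)))
      ≤ Real.exp (CN * w) ^ 2 * (2 * Real.exp (-((4 + 2 * CN) * w))) := by gcongr
    _ = 2 * Real.exp (-(3 * w)) * Real.exp (-w) := by
        rw [← Real.exp_nat_mul, mul_left_comm, ← Real.exp_add, mul_assoc, ← Real.exp_add]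
        congr 2
        push_cast
        ring
    _ ≤ 2 * (1 / 8) * δ := by
        gcongr
        rw [Real.exp_neg, ← one_div]
        exact one_div_le_one_div_of_le (by norm_num) h8
    _ = δ / 4 := by ring

end Numerics

section GoodEvent

variable {m d n : ℕ}

/-- Initial random numbers for which every unit is of moderate size (`logFactor` up to a constant,
with an additional `√d` for preactivations at arbitrary points of the ball), the kernel is uniformly
close to `kinf`, and the squared output of the network is at most of order `widthTerm`. -/
structure GoodInit (σ : ℝ → ℝ) (M C δ : ℝ) (x : Fin n → Input d) (kinf : Input d → Input d → ℝ)
    (ω : ParamIdx (Fin m) d → ℝ) : Prop where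
  outer : ∀ l, |Param.a (standardInit ω) l| ≤ C * logFactor m δ
  data : ∀ l, normalizedNorm (fun i => preact (standardInit ω) l (x i)) ≤ C * logFactor m δ
  ball : ∀ l z, ‖z‖ ≤ M → |preact (standardInit ω) l z| ≤ √(d : ℝ) * (C * logFactor m δ)
  kernel : ∀ z z' : Input d, ‖z‖ ≤ M → ‖z'‖ ≤ M →
    |ntk σ (standardInit ω) z z' - kinf z z'| ≤ C * (√(d : ℝ) / √(m : ℝ)) * logFactor m δ ^ 3
  output : ∀ z : Input d, ‖z‖ ≤ M → net σ (standardInit ω) z ^ 2 ≤ C * widthTerm 3 d m δ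

/-- The factor `A` in the Bernstein deviation `τ = √(A w / m)`, where `w` is the width term. It is
chosen so that the exponent `m τ² c² / 128` of the tail, with `c = sqExponent K M / (3 Cg)`, is the
multiple of `w` that absorbs the cover. -/
noncomputable def bernsteinFactor (K M Cg : ℝ) : ℝ :=
  (4 + 2 * (Real.log (2 * M + 5) + 6)) * 128 / (sqExponent K M / (3 * Cg)) ^ 2

/-- The discretization error of the cover is this constant divided by the width. -/
noncomputable def coverError (K CL : ℝ) : ℝ := 2 * CL * (22200 * K ^ 4)

/-- The constant for which the initialization is good with high probability. Each summand serves one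
requirement: the Gaussian range of Bernstein's inequality, and the coordinates, the data, the kernel
and the output in `GoodInit`. -/
noncomputable def initConst (K M Cg CL : ℝ) : ℝ :=
  1 + bernsteinFactor K M Cg * (sqExponent K M / (3 * Cg)) ^ 2 / 1024 + 4 * K * (M + 1) +
    3 / sqExponent K M + (√(2 * bernsteinFactor K M Cg) + coverError K CL) +
    3 * (bernsteinFactor K M Cg + coverError K CL ^ 2 + 16 * K ^ 2)

/-- The mesh `m⁻⁵` of the cover beats the Lipschitz constants of the unit features, which are of
order `m⁴` on realizations with moderate coordinates. -/
theorem discretization_le {K CL : ℝ} (hK : 1 ≤ K) (hCL : 0 ≤ CL) (hm : 1 ≤ m) (hdm : d ≤ m) :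
    2 * CL * (1 / (m : ℝ) ^ 5) *
      ((145 * K ^ 2 * (m : ℝ) ^ 2) ^ 2 + (2 + 128 * K ^ 4 * (d + 2) ^ 2)) ≤
    coverError K CL / m := by
  have hm1 : (1 : ℝ) ≤ m := by exact_mod_cast hm
  have hdm' : (d : ℝ) ≤ m := by exact_mod_cast hdm
  have hm0 : (0 : ℝ) < m := by linarith
  have hK4 : 1 ≤ K ^ 4 := one_le_pow₀ hK
  have hm4 : (1 : ℝ) ≤ (m : ℝ) ^ 4 := one_le_pow₀ hm1
  have h1 : ((d : ℝ) + 2) ^ 2 ≤ 9 * (m : ℝ) ^ 4 := by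
    have h2 : (d : ℝ) + 2 ≤ 3 * (m : ℝ) ^ 2 := by nlinarith
    calc ((d : ℝ) + 2) ^ 2 ≤ (3 * (m : ℝ) ^ 2) ^ 2 := by gcongr
      _ = _ := by ring
  have h4 : 1 ≤ K ^ 4 * (m : ℝ) ^ 4 := one_le_mul_of_one_le_of_one_le hK4 hm4
  have h5 := mul_le_mul_of_nonneg_left h1 (zero_le_one.trans hK4)
  have h3 : (145 * K ^ 2 * (m : ℝ) ^ 2) ^ 2 + (2 + 128 * K ^ 4 * (d + 2) ^ 2) ≤
      22200 * K ^ 4 * (m : ℝ) ^ 4 := by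
    have e : (145 * K ^ 2 * (m : ℝ) ^ 2) ^ 2 = 21025 * (K ^ 4 * (m : ℝ) ^ 4) := by ring
    rw [e]
    linarith
  calc _ ≤ 2 * CL * (1 / (m : ℝ) ^ 5) * (22200 * K ^ 4 * (m : ℝ) ^ 4) := by gcongr
    _ = _ := by rw [coverError]; field_simp

theorem blockSize_le_of_sq_le {K ℓ : ℝ} (hK : 1 ≤ K) (hℓ0 : 0 ≤ ℓ) (hm : 1 ≤ m) (hdm : d ≤ m)
    (hℓ : ℓ ≤ m) {ω : ParamIdx (Fin m) d → ℝ} (hω : ∀ i, ω i ^ 2 ≤ 16 * K ^ 2 * ℓ) (l : Fin m) :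
    blockSize (unitBlock l ω) ≤ 145 * K ^ 2 * (m : ℝ) ^ 2 := by
  have hm1 : (1 : ℝ) ≤ m := by exact_mod_cast hm
  have hdm' : (d : ℝ) ≤ m := by exact_mod_cast hdm
  have h5 : ∑ k, unitBlock l ω k ^ 2 ≤ (d + 2) * (16 * K ^ 2 * ℓ) := by
    refine (Finset.sum_le_sum fun k _ => hω (unitIdx l k)).trans (le_of_eq ?_)
    simp only [Finset.sum_const, Finset.card_univ, Fintype.card_sum, Fintype.card_unit,
      Fintype.card_fin, nsmul_eq_mul]
    push_cast; ring
  have h6 : ((d : ℝ) + 2) * (16 * K ^ 2 * ℓ) ≤ (3 * m) * (16 * K ^ 2 * m) := by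
    gcongr
    linarith
  have h7 : 1 ≤ K ^ 2 * (m : ℝ) ^ 2 :=
    one_le_mul_of_one_le_of_one_le (one_le_pow₀ hK) (one_le_pow₀ hm1)
  rw [blockSize]
  nlinarith

/-- Bounds on the random numbers of one realization that make it good. -/
theorem goodInit_of_bounds {σ : ℝ → ℝ} {K M A E C δ : ℝ} (hK : 1 ≤ K) (hM : 0 ≤ M) (hA : 0 ≤ A)
    (hE : 0 ≤ E) (hC1 : 4 * K * (M + 1) ≤ C) (hC2 : 3 / sqExponent K M ≤ C)
    (hC3 : √(2 * A) + E ≤ C) (hC4 : 3 * (A + E ^ 2 + 16 * K ^ 2) ≤ C) (hd : 1 ≤ d) (hm : 1 ≤ m)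
    (hδ : 0 < δ) (hδ1 : δ < 1) {x : Fin n → Input d} {kinf : Input d → Input d → ℝ}
    {ω : ParamIdx (Fin m) d → ℝ} (hω : ∀ i, ω i ^ 2 ≤ 16 * K ^ 2 * logFactor m δ)
    (hdata : ∀ l, sqExponent K M * (1 / (n : ℝ) * ∑ i, blockPreact (unitBlock l ω) (x i) ^ 2) ≤
      3 * logFactor m δ)
    (hker : ∀ z z' : Input d, ‖z‖ ≤ M → ‖z'‖ ≤ M →
      |ntk σ (standardInit ω) z z' - kinf z z'| ≤ √(A * widthTerm 3 d m δ / m) + E / m)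
    (hout : ∀ z : Input d, ‖z‖ ≤ M → |1 / (m : ℝ) * ∑ l, outputFeature σ z 0 (unitBlock l ω)| ≤
      √(A * widthTerm 3 d m δ / m) + E / m) :
    GoodInit σ M C δ x kinf ω := by
  have hs0 : 0 < sqExponent K M := sqExponent_pos hK
  have hs1 : sqExponent K M ≤ 1 / 32 := sqExponent_le hK
  have hK0 : 0 ≤ K := by linarith
  have hℓ1 : 1 ≤ logFactor m δ := one_le_logFactor hm hδ hδ1
  have hℓw : logFactor m δ ≤ widthTerm 3 d m δ := logFactor_le_widthTerm hd hm hδ hδ1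
  have hwℓ := widthTerm_le_logFactor hd hm hδ hδ1
  set s := sqExponent K M
  set w := widthTerm 3 d m δ
  set ℓ := logFactor m δ
  have hw1 : 1 ≤ w := hℓ1.trans hℓw
  have hw0 : 0 ≤ w := by linarith
  have hℓ0 : 0 ≤ ℓ := by linarith
  have hm1 : (1 : ℝ) ≤ m := by exact_mod_cast hm
  have hm0 : (0 : ℝ) < m := by linarith
  have hd1 : (1 : ℝ) ≤ d := by exact_mod_cast hd
  have hsqrtd : 1 ≤ √(d : ℝ) := Real.one_le_sqrt.2 hd1
  have hsm : 0 < √(m : ℝ) := Real.sqrt_pos.2 hm0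
  set τ := √(A * w / m) with hτ
  have hτ0 : 0 ≤ τ := Real.sqrt_nonneg _
  have hτsq : τ ^ 2 = A * w / m := Real.sq_sqrt (by positivity)
  have habs : ∀ i, |ω i| ≤ 4 * K * ℓ := by
    intro i
    refine Real.sqrt_sq_eq_abs (ω i) ▸ Real.sqrt_le_iff.2 ⟨by positivity, ?_⟩
    calc ω i ^ 2 ≤ 16 * K ^ 2 * (ℓ * 1) := by rw [mul_one]; exact hω i
      _ ≤ 16 * K ^ 2 * (ℓ * ℓ) := by gcongr
      _ = _ := by ring
  refine ⟨fun l => ?_, fun l => ?_, fun l z hz => ?_, fun z z' hz hz' => ?_, fun z hz => ?_⟩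
  · refine (habs (Sum.inl l)).trans (mul_le_mul_of_nonneg_right (le_trans ?_ hC1) hℓ0)
    nlinarith [mul_nonneg hK0 hM]
  · have h7 : 1 / (n : ℝ) * ∑ i, blockPreact (unitBlock l ω) (x i) ^ 2 ≤ 3 / s * ℓ := by
      refine ((le_div_iff₀ hs0).2 ?_).trans (le_of_eq (div_mul_eq_mul_div 3 s ℓ).symm)
      rw [mul_comm]
      exact hdata l
    have h8 : 1 ≤ 3 / s * ℓ := by
      rw [div_mul_eq_mul_div, le_div_iff₀ hs0]; linarith
    calc normalizedNorm (fun i => preact (standardInit ω) l (x i)) ≤ √(3 / s * ℓ) :=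
          Real.sqrt_le_sqrt h7
      _ ≤ 3 / s * ℓ := Real.sqrt_le_iff.2 ⟨by linarith, le_self_pow₀ h8 two_ne_zero⟩
      _ ≤ C * ℓ := mul_le_mul_of_nonneg_right hC2 hℓ0
  · rw [preact_standardInit]
    have h5 : √(∑ j : Fin d, unitBlock l ω (Sum.inr (Sum.inl j)) ^ 2) ≤
        √(d : ℝ) * (4 * K * ℓ) := by
      refine Real.sqrt_le_iff.2 ⟨by positivity, ?_⟩
      rw [mul_pow, Real.sq_sqrt (by positivity)]
      calc ∑ j : Fin d, unitBlock l ω (Sum.inr (Sum.inl j)) ^ 2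
          ≤ ∑ _j : Fin d, (4 * K * ℓ) ^ 2 := Finset.sum_le_sum fun j _ =>
            sq_le_sq' (abs_le.1 (habs (unitIdx l (Sum.inr (Sum.inl j))))).1
              (abs_le.1 (habs (unitIdx l (Sum.inr (Sum.inl j))))).2
        _ = _ := by simp
    have h6 := sum_mul_abs_le (fun j => unitBlock l ω (Sum.inr (Sum.inl j))) z
    have h7 : |unitBlock l ω (Sum.inr (Sum.inr ()))| ≤ 4 * K * ℓ := habs _
    calc |blockPreact (unitBlock l ω) z|
        ≤ √(d : ℝ) * (4 * K * ℓ) * M + 1 * (4 * K * ℓ) := by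
          refine (abs_add_le _ _).trans (add_le_add (h6.trans ?_) (by rwa [one_mul]))
          exact mul_le_mul h5 hz (norm_nonneg _) (by positivity)
      _ ≤ √(d : ℝ) * (4 * K * ℓ) * M + √(d : ℝ) * (4 * K * ℓ) := by gcongr
      _ = √(d : ℝ) * (4 * K * (M + 1) * ℓ) := by ring
      _ ≤ √(d : ℝ) * (C * ℓ) := by gcongr
  · have hℓ3 : 1 ≤ ℓ ^ 3 := one_le_pow₀ hℓ1
    have h6 : τ ≤ √(2 * A) * (√(d : ℝ) / √(m : ℝ)) * ℓ ^ 3 := by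
      refine Real.sqrt_le_iff.2 ⟨by positivity, ?_⟩
      rw [mul_pow, mul_pow, div_pow, Real.sq_sqrt (by positivity), Real.sq_sqrt (by positivity),
        Real.sq_sqrt hm0.le]
      calc A * w / m ≤ A * (2 * d * ℓ ^ 6) / m := by gcongr
        _ = _ := by ring
    have h7 : E / m ≤ E * (√(d : ℝ) / √(m : ℝ)) * ℓ ^ 3 := by
      have h8 : 1 / (m : ℝ) ≤ √(d : ℝ) / √(m : ℝ) := by
        refine div_le_div₀ (by positivity) hsqrtd hsm ?_
        exact Real.sqrt_le_iff.2 ⟨hm0.le, le_self_pow₀ hm1 two_ne_zero⟩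
      calc E / m = E * (1 / m) * 1 := by ring
        _ ≤ _ := by gcongr
    calc _ ≤ τ + E / m := hker z z' hz hz'
      _ ≤ (√(2 * A) + E) * ((√(d : ℝ) / √(m : ℝ)) * ℓ ^ 3) := by linarith
      _ ≤ C * ((√(d : ℝ) / √(m : ℝ)) * ℓ ^ 3) := by gcongr
      _ = _ := by ring
  · have hsm2 : √(m : ℝ) ^ 2 = m := Real.sq_sqrt hm0.le
    have h5 := hout z hz
    have h6 : (1 / √(m : ℝ) * ∑ l, outputFeature σ z 0 (unitBlock l ω)) ^ 2 ≤
        m * (τ + E / m) ^ 2 := by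
      have e : 1 / √(m : ℝ) * ∑ l, outputFeature σ z 0 (unitBlock l ω) =
          √(m : ℝ) * (1 / (m : ℝ) * ∑ l, outputFeature σ z 0 (unitBlock l ω)) := by
        rw [← mul_assoc, mul_one_div, Real.sqrt_div_self']
      rw [e, mul_pow, hsm2]
      exact mul_le_mul_of_nonneg_left (sq_le_sq' (abs_le.1 h5).1 (abs_le.1 h5).2) hm0.le
    have hb := hω (Sum.inr (Sum.inr (Sum.inr ())))
    rw [net_standardInit]
    set X := 1 / √(m : ℝ) * ∑ l, outputFeature σ z 0 (unitBlock l ω)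
    set b := ω (Sum.inr (Sum.inr (Sum.inr ())))
    have h7 : m * (τ + E / m) ^ 2 ≤ 2 * (A * w + E ^ 2) := by
      have h8 : (τ + E / m) ^ 2 ≤ 2 * (τ ^ 2 + (E / m) ^ 2) := by
        nlinarith [sq_nonneg (τ - E / m)]
      have h9 : m * (E / m) ^ 2 ≤ E ^ 2 := by
        have : m * (E / m) ^ 2 = E ^ 2 / m := by field_simp
        rw [this]
        exact div_le_self (sq_nonneg E) hm1
      have h10 : m * τ ^ 2 = A * w := by rw [hτsq]; field_simp
      calc m * (τ + E / m) ^ 2 ≤ m * (2 * (τ ^ 2 + (E / m) ^ 2)) := by gcongr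
        _ = 2 * (m * τ ^ 2 + m * (E / m) ^ 2) := by ring
        _ ≤ _ := by rw [h10]; gcongr
    have h8 : (X + b) ^ 2 ≤ 3 / 2 * X ^ 2 + 3 * b ^ 2 := by
      nlinarith [sq_nonneg (X - 2 * b)]
    calc (X + b) ^ 2 ≤ 3 * (A * w + E ^ 2 * 1 + 16 * K ^ 2 * ℓ) := by linarith
      _ ≤ 3 * (A * w + E ^ 2 * w + 16 * K ^ 2 * w) := by gcongr
      _ = 3 * (A + E ^ 2 + 16 * K ^ 2) * w := by ring
      _ ≤ C * w := by gcongr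

/-- There are at most `4 m²` parameters, so the logarithm in the union bound over all coordinates
is of the order of `logFactor`. -/
theorem sq_le_of_div_le_log {K δ : ℝ} (hK : 1 ≤ K) (hm : 1 ≤ m) (hdm : d ≤ m) (hδ : 0 < δ)
    (hδ1 : δ < 1) {u : ℝ}
    (hu : u ^ 2 / (2 * K) ^ 2 ≤ Real.log (8 * Fintype.card (ParamIdx (Fin m) d) / δ)) :
    u ^ 2 ≤ 16 * K ^ 2 * logFactor m δ := by
  have hm1 : (1 : ℝ) ≤ m := by exact_mod_cast hm
  have hdm' : (d : ℝ) ≤ m := by exact_mod_cast hdm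
  have hcard : (Fintype.card (ParamIdx (Fin m) d) : ℝ) ≤ 4 * (m : ℝ) ^ 2 := by
    simp only [ParamIdx, Fintype.card_sum, Fintype.card_prod, Fintype.card_fin, Fintype.card_unit]
    push_cast
    nlinarith
  have hcard0 : 0 < (Fintype.card (ParamIdx (Fin m) d) : ℝ) := by
    exact_mod_cast Fintype.card_pos_iff.2 ⟨Sum.inr (Sum.inr (Sum.inr ()))⟩
  have h5 : Real.log (8 * Fintype.card (ParamIdx (Fin m) d) / δ) ≤ 4 * logFactor m δ := by
    refine le_trans (Real.log_le_log (by positivity) ?_) (log_mul_pow_div_le hm hδ hδ1)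
    exact div_le_div_of_nonneg_right (by linarith) hδ.le
  have h6 := hu.trans h5
  rw [div_le_iff₀ (by positivity)] at h6
  linarith

theorem log_eight_mul_div_le {δ : ℝ} (hm : 1 ≤ m) (hδ : 0 < δ) (hδ1 : δ < 1) :
    Real.log (8 * m / δ) ≤ 3 * logFactor m δ := by
  have hm0 : (0 : ℝ) < m := by exact_mod_cast hm
  have h1 := one_le_logFactor hm hδ hδ1
  rw [mul_div_assoc, Real.log_mul (by norm_num) (by positivity)]
  have h8 : Real.log 8 ≤ 3 := by
    rw [show (8 : ℝ) = 2 ^ 3 by norm_num, Real.log_pow]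
    have := Real.log_two_lt_d9
    norm_num
    linarith
  have : Real.log (m / δ) = logFactor m δ - 1 := by rw [logFactor]; ring
  linarith

/-- With probability at least `1 - δ` the initialization is good. -/
theorem measure_not_goodInit_le {σ : ℝ → ℝ} {K M L L₂ S : ℝ} (hσ : ActivationBounds σ M L L₂ S)
    (hK : 1 ≤ K) {ν : ParamIdx (Fin m) d → Measure ℝ} (hν : ∀ i, IsInitLaw K (ν i))
    (hd : 1 ≤ d) (hm : 1 ≤ m) (hn : 1 ≤ n) {x : Fin n → Input d} (hx : ∀ i, ‖x i‖ ≤ M) {δ : ℝ}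
    (hδ : 0 < δ) (hδ1 : δ < 1)
    (hw : initConst K M (featureSize M L S) (featureLip M L L₂ S) * widthTerm 3 d m δ ≤ m) :
    Measure.pi ν {ω | ¬ GoodInit σ M (initConst K M (featureSize M L S) (featureLip M L L₂ S)) δ x
      (fun z z' => ∫ ω', ntk σ (standardInit ω') z z' ∂(Measure.pi ν)) ω} ≤ ENNReal.ofReal δ := by
  have hM0 := hσ.M_nonneg
  have hCg1 : 1 ≤ featureSize M L S := one_le_featureSize hσ
  have hCL0 : 0 ≤ featureLip M L L₂ S := featureLip_nonneg hσ
  have hFk := unitFeature_kernelFeature (d := d) hσ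
  have hFo := unitFeature_outputFeature (d := d) hσ
  generalize featureSize M L S = Cg at *
  generalize featureLip M L L₂ S = CL at *
  have hs0 : 0 < sqExponent K M := sqExponent_pos hK
  obtain ⟨c, hc⟩ : ∃ c, c = sqExponent K M / (3 * Cg) := ⟨_, rfl⟩
  have hc0 : 0 < c := by rw [hc]; positivity
  have hlogM : 0 ≤ Real.log (2 * M + 5) := Real.log_nonneg (by linarith)
  obtain ⟨A, hA⟩ : ∃ A, A = bernsteinFactor K M Cg := ⟨_, rfl⟩
  have hAc : A * c ^ 2 / 128 = 4 + 2 * (Real.log (2 * M + 5) + 6) := by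
    rw [hA, bernsteinFactor, ← hc]; field_simp
  have hA0 : 0 < A := by
    rw [hA, bernsteinFactor, ← hc]; positivity
  obtain ⟨E, hE⟩ : ∃ E, E = coverError K CL := ⟨_, rfl⟩
  have hE0 : 0 ≤ E := by rw [hE, coverError]; positivity
  obtain ⟨C, hC⟩ : ∃ C, C = initConst K M Cg CL := ⟨_, rfl⟩
  have hCeq : C = 1 + A * c ^ 2 / 1024 + 4 * K * (M + 1) + 3 / sqExponent K M +
      (√(2 * A) + E) + 3 * (A + E ^ 2 + 16 * K ^ 2) := by
    rw [hC, hA, hE, hc]; rfl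
  rw [← hC] at hw ⊢
  have p1 : 0 ≤ A * c ^ 2 / 1024 := by positivity
  have p2 : 0 ≤ 4 * K * (M + 1) := by positivity
  have p3 : 0 ≤ 3 / sqExponent K M := by positivity
  have p4 : 0 ≤ √(2 * A) + E := by positivity
  have p5 : 0 ≤ 3 * (A + E ^ 2 + 16 * K ^ 2) := by positivity
  have hℓ1 : 1 ≤ logFactor m δ := one_le_logFactor hm hδ hδ1
  have hℓw : logFactor m δ ≤ widthTerm 3 d m δ := logFactor_le_widthTerm hd hm hδ hδ1
  have hw1 : 1 ≤ widthTerm 3 d m δ := hℓ1.trans hℓw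
  have hw0 : 0 < widthTerm 3 d m δ := by linarith
  have hwm : widthTerm 3 d m δ ≤ m :=
    le_trans (le_mul_of_one_le_left hw0.le (by linarith)) hw
  have hdm : d ≤ m := by exact_mod_cast (natCast_le_widthTerm hδ hδ1).trans hwm
  have hm0 : (0 : ℝ) < m := by exact_mod_cast hm
  have hne : Nonempty (Fin m) := ⟨⟨0, hm⟩⟩
  obtain ⟨N, hNM, hNcard, hNη⟩ := exists_finset_cover_ball d (η := 1 / (m : ℝ) ^ 5) hM0
    (by positivity) hd
  obtain ⟨τ, hτ⟩ : ∃ τ, τ = √(A * widthTerm 3 d m δ / m) := ⟨_, rfl⟩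
  have hτ0 : 0 ≤ τ := hτ ▸ Real.sqrt_nonneg _
  have hτsq : τ ^ 2 = A * widthTerm 3 d m δ / m := by rw [hτ]; exact Real.sq_sqrt (by positivity)
  have hτc : τ ≤ 32 / c := by
    rw [hτ]
    refine Real.sqrt_le_iff.2 ⟨by positivity, ?_⟩
    rw [div_le_iff₀ hm0, div_pow, div_mul_eq_mul_div, le_div_iff₀ (by positivity)]
    have h1 : A * c ^ 2 / 1024 * widthTerm 3 d m δ ≤ m :=
      le_trans (mul_le_mul_of_nonneg_right (by linarith) hw0.le) hw
    linarith
  have htail : ((N.card : ℝ)) ^ 2 * (2 * Real.exp (-(m * τ ^ 2 * c ^ 2 / 128))) ≤ δ / 4 := by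
    have e : m * τ ^ 2 * c ^ 2 / 128 =
        (4 + 2 * (Real.log (2 * M + 5) + 6)) * widthTerm 3 d m δ := by
      rw [hτsq, ← hAc]; field_simp
    rw [e]
    exact cover_mul_exp_le hM0 hd hm hdm hδ hδ1 (Nat.cast_nonneg _) hNcard
  have herr := add_le_add_right (discretization_le (d := d) hK hCL0 hm hdm) τ
  rw [← hE] at herr
  -- the exceptional events: large coordinates, large units on the data, large deviations
  have hP1 := measure_exists_log_lt_le (P := Measure.pi ν)
    (f := fun i (ω : ParamIdx (Fin m) d → ℝ) => ω i ^ 2 / (2 * K) ^ 2)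
    (fun i => by fun_prop) (lintegral_exp_sq_coord_le hν hK) hδ
  have hP2 := measure_exists_log_lt_le (P := Measure.pi ν)
    (f := fun (l : Fin m) (ω : ParamIdx (Fin m) d → ℝ) =>
      sqExponent K M * (1 / (n : ℝ) * ∑ i, blockPreact (unitBlock l ω) (x i) ^ 2))
    (fun l => by fun_prop) (fun l => lintegral_exp_average_sq_blockPreact_le hν hK l hn hx) hδ
  have hdev : ∀ G, UnitFeature M Cg CL G → _ := fun G hG =>
    (measure_exists_deviation_le (G := G) (q := 145 * K ^ 2 * (m : ℝ) ^ 2) hν hK hG hCg1 hCL0 hm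
      hNM hNη hτ0 (hc ▸ hτc)).trans (ENNReal.ofReal_le_ofReal (hc ▸ htail))
  have hP3 := hdev _ hFk
  have hP4 := hdev _ hFo
  refine (measure_mono ?_).trans ((measure_union_le _ _).trans ((add_le_add
    ((measure_union_le _ _).trans (add_le_add hP1 hP2))
    ((measure_union_le _ _).trans (add_le_add hP3 hP4))).trans (le_of_eq ?_)))
  · intro ω hω
    rw [mem_ofPred_eq] at hω
    by_contra hcon
    refine hω ?_
    simp only [mem_union, not_or, mem_ofPred_eq, not_exists, not_and, not_lt] at hcon
    obtain ⟨⟨h1, h2⟩, h3, h4⟩ := hcon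
    have hcoord := fun i => sq_le_of_div_le_log hK hm hdm hδ hδ1 (h1 i)
    have hsize := blockSize_le_of_sq_le hK (by linarith) hm hdm (hℓw.trans hwm) hcoord
    have hker := h3 hsize
    have hout := h4 hsize
    refine goodInit_of_bounds hK hM0 hA0.le hE0 (by linarith) (by linarith) (by linarith)
      (by linarith) hd hm hδ hδ1 hcoord (fun l => ?_) (fun z z' hz hz' => ?_) (fun z hz => ?_)
    · refine (h2 l).trans ?_
      rw [Fintype.card_fin]
      exact log_eight_mul_div_le hm hδ hδ1
    · rw [ntk_standardInit hσ.differentiable]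
      rw [integral_ntk_standardInit hν hK hσ hz hz', add_sub_add_left_eq_sub, ← hτ]
      exact (hker z z' hz hz').trans herr
    · have h5 := (hout z 0 hz (by simpa using hM0)).trans herr
      simp only [integral_outputFeature hν hσ.differentiable.continuous.measurable,
        Finset.sum_const_zero, mul_zero, sub_zero] at h5
      rwa [← hτ]
  · rw [← ENNReal.ofReal_add (by positivity) (by positivity),
      ← ENNReal.ofReal_add (by positivity) (by positivity)]
    congr 1
    ring

end GoodEvent

/-! ### The deviation bound for good initializations -/

section Assembly

theorem abs_le_supNorm {g : ℝ → ℝ} (hg : BddAbove (range fun u => |g u|)) (u : ℝ) :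
    |g u| ≤ supNorm g := le_ciSup hg u

theorem abs_sub_le_supNorm_deriv {g : ℝ → ℝ} (hg : Differentiable ℝ g)
    (hb : BddAbove (range fun u => |deriv g u|)) (u v : ℝ) :
    |g u - g v| ≤ supNorm (deriv g) * |u - v| := by
  have := convex_univ.norm_image_sub_le_of_norm_deriv_le (f := g) (C := supNorm (deriv g))
    (fun x _ => hg x) (fun x _ => by rw [Real.norm_eq_abs]; exact abs_le_supNorm hb x)
    (mem_univ v) (mem_univ u)
  simpa only [Real.norm_eq_abs] using this

theorem IsAdmissibleActivation.activationBounds {σ : ℝ → ℝ} (h : IsAdmissibleActivation σ) {M : ℝ}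
    (hM : 0 < M) : ActivationBounds σ M (supNorm (deriv σ)) (supNorm (deriv (deriv σ)))
      (constD σ M / 3) := by
  have hS : constD σ M / 3 =
      max (max |σ 0| (M * supNorm (deriv σ))) (max (supNorm (deriv σ)) 1) := by
    rw [constD]; ring
  have hd : Differentiable ℝ σ := h.contDiff.differentiable two_ne_zero
  have hd2 : Differentiable ℝ (deriv σ) :=
    (contDiff_succ_iff_deriv.1 (show ContDiff ℝ (1 + 1) σ by
      rw [one_add_one_eq_two]; exact h.contDiff)).2.2.differentiable one_ne_zero
  refine ⟨hd, hM.le, abs_sub_le_supNorm_deriv hd h.bdd_deriv, abs_le_supNorm h.bdd_deriv,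
    abs_sub_le_supNorm_deriv hd2 h.bdd_deriv2, ?_, ?_, ?_⟩ <;> rw [hS]
  · exact (le_max_left _ _).trans (le_max_left _ _)
  · exact (le_max_left _ _).trans (le_max_right _ _)
  · exact (le_max_right _ _).trans (le_max_left _ _)

/-- The factor of the drift term in the deterministic bound along the flow. -/
noncomputable def driftConst (M L L₂ S : ℝ) : ℝ :=
  3 * S * (16 * S ^ 2 + (1 + M ^ 2) * (4 * L ^ 2 + 2 * L * L₂ * (M + 1)))

variable {ι : Type} [Fintype ι] {m d n : ℕ} {σ : ℝ → ℝ} {M L L₂ S : ℝ}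

theorem driftConst_nonneg (hσ : ActivationBounds σ M L L₂ S) : 0 ≤ driftConst M L L₂ S := by
  have hS0 := hσ.S_nonneg
  have hL0 := hσ.L_nonneg
  have hL20 := hσ.L₂_nonneg
  have hM0 := hσ.M_nonneg
  unfold driftConst
  positivity

theorem one_le_initConst {K : ℝ} (hσ : ActivationBounds σ M L L₂ S) (hK : 1 ≤ K) :
    1 ≤ initConst K M (featureSize M L S) (featureLip M L L₂ S) := by
  have h1 := one_le_featureSize hσ
  have h2 := featureLip_nonneg hσ
  have hM0 := hσ.M_nonneg
  have hs0 : 0 < sqExponent K M := sqExponent_pos hK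
  have hlogM : 0 ≤ Real.log (2 * M + 5) := Real.log_nonneg (by linarith)
  have h3 : 0 ≤ bernsteinFactor K M (featureSize M L S) := by
    unfold bernsteinFactor; positivity
  have h4 : 0 ≤ coverError K (featureLip M L L₂ S) := by unfold coverError; positivity
  unfold initConst
  simp only [add_assoc]
  exact le_add_of_nonneg_right (by positivity)

/-- A good initialization, or any initialization with the same unit sizes and the same kernel,
satisfies the deviation bound as soon as its residual is small enough for the given horizon. -/
theorem GoodInit.deviationBound (hσ : ActivationBounds σ M L L₂ S) (hd : 1 ≤ d) (hm : 1 ≤ m)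
    (hn : 1 ≤ n) {x : Fin n → Input d} (hx : ∀ i, ‖x i‖ ≤ M) (y : Fin n → ℝ) {δ T Γ C₀ C : ℝ}
    (hδ : 0 < δ) (hδ1 : δ < 1) (hΓ : 1 < Γ) (hC₀ : 1 ≤ C₀)
    (hC : C₀ + driftConst M L L₂ S * C₀ ^ 3 ≤ C) {kinf : Input d → Input d → ℝ}
    {ω : ParamIdx (Fin m) d → ℝ} (hω : GoodInit σ M C₀ δ x kinf ω) {θ : Param ι d}
    (hmN : m ≤ Fintype.card ι) (e : ι → Fin m)
    (ha : ∀ l, |Param.a θ l| = |Param.a (standardInit ω) (e l)|)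
    (hu : ∀ l z, preact θ l z = preact (standardInit ω) (e l) z)
    (hk : ∀ z z', ntk σ θ z z' = ntk σ (standardInit ω) z z')
    (hT : (2 * S * normalizedNorm (residual σ x y θ) * T) ^ 2 ≤ m * Real.log Γ ^ 2) :
    DeviationBound σ M x y T kinf θ
      (fun t => deviationRate C 3 d m δ Γ (normalizedNorm (residual σ x y θ)) t) := by
  have hℓ1 := one_le_logFactor hm hδ hδ1
  have hm0 : (0 : ℝ) < m := by exact_mod_cast hm
  have hS0 := hσ.S_nonneg
  have hL0 := hσ.L_nonneg
  have hL20 := hσ.L₂_nonneg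
  have hM0 := hσ.M_nonneg
  have hD0 := driftConst_nonneg hσ
  have hR0 : 0 ≤ normalizedNorm (residual σ x y θ) := Real.sqrt_nonneg _
  have hd1 : (1 : ℝ) ≤ d := by exact_mod_cast hd
  refine deviationBound_of_init (B := C₀ * logFactor m δ) (D₁ := √(d : ℝ)) hσ hn hx y hΓ hm hmN
    (one_le_mul_of_one_le_of_one_le hC₀ hℓ1) (Real.one_le_sqrt.2 hd1)
    (fun l => by rw [ha]; exact hω.outer _) (fun l => ?_)
    (fun l z hz => by rw [hu]; exact hω.ball _ z hz) ?_
    (fun z z' hz hz' => by rw [hk]; exact hω.kernel z z' hz hz') ?_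
  · simp only [hu]; exact hω.data _
  · rw [div_le_iff₀ (Real.sqrt_pos.2 hm0)]
    refine le_of_sq_le_sq ?_ (mul_nonneg (Real.log_nonneg hΓ.le) (Real.sqrt_nonneg _))
    rw [mul_pow (Real.log Γ), Real.sq_sqrt hm0.le]
    linarith
  · intro t ht
    have ht0 : 0 ≤ t := ht.1
    have hlog : 1 + Real.log (m / δ) = logFactor m δ := rfl
    simp only [deviationRate]
    rw [hlog]
    set R := normalizedNorm (residual σ x y θ)
    set ℓ := logFactor m δ
    have hΓ0 : 0 < Γ := zero_lt_one.trans hΓ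
    have h1 : C₀ ≤ C := le_trans (le_add_of_nonneg_right (by positivity)) hC
    have h2 : driftConst M L L₂ S * C₀ ^ 3 ≤ C := le_trans (le_add_of_nonneg_left (by linarith)) hC
    have e1 : C * (√(d : ℝ) / √(m : ℝ) * (1 + t * Γ ^ 3 * R)) * ℓ ^ 3 =
        C * (√(d : ℝ) / √(m : ℝ)) * ℓ ^ 3 +
          C * (t * Γ ^ 3 * (R / √(m : ℝ)) * (√(d : ℝ) * ℓ ^ 3)) := by ring
    rw [e1]
    refine add_le_add (by gcongr) ?_
    calc _ = driftConst M L L₂ S * C₀ ^ 3 *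
          (t * Γ ^ 3 * (R / √(m : ℝ)) * (√(d : ℝ) * ℓ ^ 3)) := by rw [driftConst]; ring
      _ ≤ _ := by gcongr

theorem sq_normalizedNorm (v : Fin n → ℝ) : normalizedNorm v ^ 2 = 1 / (n : ℝ) * ∑ i, v i ^ 2 :=
  Real.sq_sqrt (by positivity)

theorem sq_normalizedNorm_sub_le (hn : 1 ≤ n) {f y : Fin n → ℝ} {F : ℝ} (hf : ∀ i, f i ^ 2 ≤ F) :
    normalizedNorm (fun i => f i - y i) ^ 2 ≤ 2 * F + 2 * normalizedNorm y ^ 2 := by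
  have hn0 : (0 : ℝ) < n := by exact_mod_cast hn
  rw [sq_normalizedNorm, sq_normalizedNorm]
  calc 1 / (n : ℝ) * ∑ i, (f i - y i) ^ 2 ≤ 1 / (n : ℝ) * ∑ i, (2 * F + 2 * y i ^ 2) := by
        gcongr with i
        nlinarith [sq_nonneg (f i + y i), hf i]
    _ = _ := by
        simp only [Finset.sum_add_distrib, ← Finset.mul_sum, Finset.sum_const, Finset.card_univ,
          Fintype.card_fin, nsmul_eq_mul]
        field_simp

theorem isInitLaw_sumElim {K : ℝ} {μa μw μb μb₀ : Measure ℝ} (ha : IsInitLaw K μa)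
    (hw : IsInitLaw K μw) (hb : IsInitLaw K μb) (hb₀ : IsInitLaw K μb₀)
    (i : ParamIdx (Fin m) d) :
    IsInitLaw K ((Sum.elim (fun _ => μa) (Sum.elim (fun _ => μw) (Sum.elim (fun _ => μb)
      (fun _ => μb₀))) : ParamIdx (Fin m) d → Measure ℝ) i) := by
  rcases i with i | i | i | i <;> assumption

end Assembly

end ShallowNTK

theorem mainTheorem7 :
    ∃ p : ℕ, ∀ (σ : ℝ → ℝ) (M K : ℝ),
      ShallowNTK.IsAdmissibleActivation σ → 0 < M → 1 ≤ K →
      ∃ C : ℝ, 0 < C ∧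
        ∀ (μa μw μb μb₀ : MeasureTheory.Measure ℝ),
          ShallowNTK.IsInitLaw K μa → ShallowNTK.IsInitLaw K μw →
          ShallowNTK.IsInitLaw K μb → ShallowNTK.IsInitLaw K μb₀ →
        ∀ (d m n : ℕ), 1 ≤ d → 1 ≤ m → 1 ≤ n →
        ∀ (x : Fin n → ShallowNTK.Input d) (y : Fin n → ℝ), (∀ i, ‖x i‖ ≤ M) →
        ∀ (δ T Γ : ℝ), 0 < δ → δ < 1 → 0 < T → 1 < Γ →
          4 * ShallowNTK.constD σ M ^ 2 * ShallowNTK.normalizedNorm y ^ 2 * T ^ 2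
              / Real.log Γ ^ 2 ≤ m →
          C * ShallowNTK.widthTerm p d m δ ≤ m →
          -- standard initialization
          (4 * ShallowNTK.constD σ M ^ 2 * (C * ShallowNTK.widthTerm p d m δ) * T ^ 2
              / Real.log Γ ^ 2 ≤ m →
            ShallowNTK.initLaw μa μw μb μb₀ m d
              {ω | ¬ ShallowNTK.DeviationBound σ M x y T
                  (ShallowNTK.ntkInf σ (ShallowNTK.initLaw μa μw μb μb₀ m d)
                    ShallowNTK.standardInit)
                  (ShallowNTK.standardInit ω)
                  (fun t => ShallowNTK.deviationRate C p d m δ Γ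
                    (ShallowNTK.normalizedNorm
                      (ShallowNTK.residual σ x y (ShallowNTK.standardInit ω))) t)}
              ≤ ENNReal.ofReal δ) ∧
          -- initialization by the doubling trick
          ShallowNTK.initLaw μa μw μb μb₀ m d
            {ω | ¬ ShallowNTK.DeviationBound σ M x y T
                (ShallowNTK.ntkInf σ (ShallowNTK.initLaw μa μw μb μb₀ m d)
                  ShallowNTK.doubledInit)
                (ShallowNTK.doubledInit ω)
                (fun t => ShallowNTK.deviationRate C p d m δ Γ
                  (ShallowNTK.normalizedNorm
                    (ShallowNTK.residual σ x y (ShallowNTK.doubledInit ω))) t)}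
            ≤ ENNReal.ofReal δ := by
  refine ⟨3, fun σ M K hadm hM hK => ?_⟩
  have hσ := hadm.activationBounds hM
  -- `C₀` is the constant of the good event; the drift along the flow needs its cube
  obtain ⟨C₀, hC₀⟩ : ∃ C₀, C₀ = ShallowNTK.initConst K M
    (ShallowNTK.featureSize M (ShallowNTK.supNorm (deriv σ)) (ShallowNTK.constD σ M / 3))
    (ShallowNTK.featureLip M (ShallowNTK.supNorm (deriv σ))
      (ShallowNTK.supNorm (deriv (deriv σ))) (ShallowNTK.constD σ M / 3)) := ⟨_, rfl⟩
  obtain ⟨C, hC⟩ : ∃ C, C = C₀ + ShallowNTK.driftConst M (ShallowNTK.supNorm (deriv σ))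
      (ShallowNTK.supNorm (deriv (deriv σ))) (ShallowNTK.constD σ M / 3) * C₀ ^ 3 := ⟨_, rfl⟩
  have hC₀1 : 1 ≤ C₀ := hC₀ ▸ ShallowNTK.one_le_initConst hσ hK
  have hCC₀ : C₀ ≤ C := by
    rw [hC]
    exact le_add_of_nonneg_right (mul_nonneg (ShallowNTK.driftConst_nonneg hσ) (by positivity))
  refine ⟨C, by linarith, ?_⟩
  intro μa μw μb μb₀ ha hw hb hb₀ d m n hd hm hn x y hx δ T Γ hδ hδ1 hT hΓ hm1 hm2
  have hν := ShallowNTK.isInitLaw_sumElim (m := m) (d := d) ha hw hb hb₀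
  have hw1 : 1 ≤ ShallowNTK.widthTerm 3 d m δ :=
    (ShallowNTK.one_le_logFactor hm hδ hδ1).trans
      (ShallowNTK.logFactor_le_widthTerm hd hm hδ hδ1)
  have hw0 : 0 ≤ ShallowNTK.widthTerm 3 d m δ := by linarith
  have hC₀w : C₀ * ShallowNTK.widthTerm 3 d m δ ≤ C * ShallowNTK.widthTerm 3 d m δ :=
    mul_le_mul_of_nonneg_right hCC₀ hw0
  have hgood := ShallowNTK.measure_not_goodInit_le hσ hK hν hd hm hn hx hδ hδ1
    (by rw [← hC₀]; exact hC₀w.trans hm2)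
  rw [← hC₀] at hgood
  have hlog : 0 < Real.log Γ := Real.log_pos hΓ
  rw [div_le_iff₀ (by positivity)] at hm1
  refine ⟨fun hm3 => ?_, ?_⟩
  · rw [div_le_iff₀ (by positivity)] at hm3
    refine (MeasureTheory.measure_mono ?_).trans hgood
    intro ω hω
    rw [Set.mem_ofPred_eq] at hω ⊢
    contrapose! hω
    refine hω.deviationBound hσ hd hm hn hx y hδ hδ1 hΓ hC₀1 hC.ge (by simp) id
      (fun _ => rfl) (fun _ _ => rfl) (fun _ _ => rfl) ?_
    have hres := ShallowNTK.sq_normalizedNorm_sub_le (y := y) hn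
      (f := fun i => ShallowNTK.net σ (ShallowNTK.standardInit ω) (x i)) fun i =>
        (hω.output (x i) (hx i)).trans hC₀w
    have hres' : ShallowNTK.normalizedNorm
        (ShallowNTK.residual σ x y (ShallowNTK.standardInit ω)) ^ 2 ≤ _ := hres
    -- `S = D / 3`, so `(2 S T)² (2 C w + 2 ‖y‖²)` is at most `4/9` of the available `m (log Γ)²`
    have hST := mul_le_mul_of_nonneg_left hres'
      (sq_nonneg (2 * (ShallowNTK.constD σ M / 3) * T))
    have hpos : 0 ≤ (m : ℝ) * Real.log Γ ^ 2 := by positivity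
    nlinarith
  · refine (MeasureTheory.measure_mono ?_).trans hgood
    intro ω hω
    rw [Set.mem_ofPred_eq] at hω ⊢
    contrapose! hω
    have hk := ShallowNTK.ntk_doubledInit hσ.differentiable (m := m) (d := d)
    have hkinf : ShallowNTK.ntkInf σ (ShallowNTK.initLaw μa μw μb μb₀ m d)
        ShallowNTK.doubledInit = ShallowNTK.ntkInf σ (ShallowNTK.initLaw μa μw μb μb₀ m d)
        ShallowNTK.standardInit := by
      funext z z'
      simp only [ShallowNTK.ntkInf, hk]
    rw [hkinf]
    refine hω.deviationBound hσ hd hm hn hx y hδ hδ1 hΓ hC₀1 hC.ge (by simp) (Sum.elim id id)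
      (fun l => ?_) (fun l z => ?_) (hk ω) ?_
    · rcases l with l | l
      · rfl
      · exact abs_neg _
    · rcases l with l | l <;> rfl
    · -- the doubled network vanishes initially, so its residual is `-y`
      have hres := ShallowNTK.sq_normalizedNorm_sub_le (y := y) hn (F := 0)
        (f := fun i => ShallowNTK.net σ (ShallowNTK.doubledInit ω) (x i)) fun i => by
          rw [ShallowNTK.net_doubledInit]; norm_num
      have hres' : ShallowNTK.normalizedNorm
          (ShallowNTK.residual σ x y (ShallowNTK.doubledInit ω)) ^ 2 ≤ _ := hres
      have hST := mul_le_mul_of_nonneg_left hres'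
        (sq_nonneg (2 * (ShallowNTK.constD σ M / 3) * T))
      have hpos : 0 ≤ (m : ℝ) * Real.log Γ ^ 2 := by positivity
      nlinarith
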